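/- **Setting.** Let $-\infty\le l<0<r\le\infty$. Let $\mathbf s:(l,r)\to\mathbb R$ be nonconstant and increasing (not necessarily strictly, nor continuous) with $\mathbf s(0-)=\mathbf s(0)=\mathbf s(0+)=0$, and let $\mathfrak m$ be a Borel measure on $[l,r]$ with $\mathfrak m([a,b])<\infty$ whenever $l<a\le b<r$ and $\mathfrak m(\{0\})=0$. Extend $\mathbf s$ to $[l,r]$ by its limits $\mathbf s(l),\mathbf s(r)\in[-\infty,\infty]$, and put $\mathbf s(l-)=\mathbf s(l)$, $\mathbf s(r+)=\mathbf s(r)$. The endpoint $r$ is *approachable* if $\mathbf s(r)<\infty$, and *reflecting* if moreover $\mathfrak m((a,r))<\infty$ for some $a<r$ and $\mathfrak m(\{r\})<\infty$; similarly for $l$. Let $I$ be the interval with ends $l,r$ that contains exactly those ends which are reflecting, and write $\mathfrak m$ also for the restriction of $\mathfrak m$ to $I$. Let $D^\pm=\{x\in[l,r]:\mathbf s(x)\ne\mathbf s(x\pm)\}$ and $D=D^+\cup D^-$. Let $U$ be the set of points of $[l,r]$ near which $\mathbf s$ is constant. A connected component $(c,d)$ of $U\setminus\{l,r\}$ is called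 *isolated* if $c,d\in D\cup\{l,r\}$. Assume: * (DK) if $l$ or $r$ is an endpoint of an isolated component $(c,d)$, then it is reflecting; * (DM) $[l,r]\setminus U\subset\operatorname{supp}\mathfrak m$; $\mathfrak m(\{x\})>0$ for $x\in D^+\cap D^-$; and $\mathfrak m(J)>0$ for every isolated component $(c,d)$, where $J$ is $(c,d)$ together with $c$ if $c\notin D^+$ and with $d$ if $d\notin D^-$. **The form $(\mathscr E,\mathscr F)$.** Let $\mu_d^+=\sum_{x\in D^+}(\mathbf s(x+)-\mathbf s(x))\delta_x$ and $\mu_d^-=\sum_{x\in D^-}(\mathbf s(x)-\mathbf s(x-))\delta_x$, and let $\mathbf s_c(x)=\mathbf s(x)-\mu_d^+((0,x))-\mu_d^-((0,x])$, with Lebesgue–Stieltjes measure $\mu_c$; here and below, for $x<0$, $\int_{(0,x)}$ means $-\int_{[x,0)}$ and $\int_{(0,x]}$ means $-\int_{(x,0)}$. A function $f:I\to\mathbb R$ is *$\mathbf s$-continuous* if it has finite one-sided limits on $I$ and is left (right) continuous wherever $\mathbf s$ is. For such $f$ put $f'_{\mathbf s,\pm}(x)=\frac{f(x)-f(x\pm)}{\mathbf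 s(x)-\mathbf s(x\pm)}$ for $x\in D^\pm$ and $$f^c(x)=f(x)-\int_{(0,x)}f'_{\mathbf s,+}\,d\mu_d^+-\int_{(0,x]}f'_{\mathbf s,-}\,d\mu_d^-.$$ Let $\mathscr S$ be the set of all $\mathbf s$-continuous $f$ with $f'_{\mathbf s,\pm}\in L^2(\mu_d^\pm)$ such that $f^c$ is continuous and $f^c=\varphi\circ\mathbf s_c$ for some $\varphi$ absolutely continuous on $\mathbf s_c(I)$ with $\frac{df^c}{d\mathbf s_c}:=\varphi'\circ\mathbf s_c\in L^2(I,\mu_c)$. Let $\mathscr F$ be the set of all $f\in\mathscr S\cap L^2(I,\mathfrak m)$ that tend to $0$ at each approachable endpoint not in $I$, and $$\mathscr E(f,g)=\tfrac12\Big(\int_I\tfrac{df^c}{d\mathbf s_c}\tfrac{dg^c}{d\mathbf s_c}\,d\mu_c+\int_{D^+}f'_{\mathbf s,+}g'_{\mathbf s,+}\,d\mu_d^++\int_{D^-}f'_{\mathbf s,-}g'_{\mathbf s,-}\,d\mu_d^-\Big).$$ **The regularization.** Let $\widehat l=\mathbf s(l)$ and $\widehat r=\mathbf s(r)$. Let $\widehat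 I$ be the closure of $\mathbf s([l,r])$ in $[-\infty,\infty]$ with $\widehat l$ (resp. $\widehat r$) removed if $l$ (resp. $r$) is not reflecting; let $\widehat{\mathfrak m}=\mathfrak m\circ\mathbf s^{-1}$ on $\widehat I$; and let $(\widehat a_k,\widehat b_k)$, $k\ge1$, be the connected components of the open set $(\widehat l,\widehat r)\setminus\widehat I$. For $f\in\mathscr S$ define $\widehat\iota f=\widehat f:\widehat I\to\mathbb R$ by $\widehat f(\mathbf s(x))=f(x)$ for $x\in I$ and $\widehat f(\mathbf s(x\pm))=f(x\pm)$ for $x\in D^\pm$ (wherever the arguments lie in $\widehat I$). Put $\widehat{\mathscr S}=\widehat\iota(\mathscr S)$, $\widehat{\mathscr F}=\widehat\iota(\mathscr F)$ and $\widehat{\mathscr E}(\widehat f,\widehat g)=\mathscr E(\widehat\iota^{-1}\widehat f,\widehat\iota^{-1}\widehat g)$. **Terminology.** A *Dirichlet form in the wide sense* on $L^2(E,\mu)$ is a nonnegative symmetric bilinear form on a (not necessarily dense) linear subspace that is closed and Markovian; it is a *Dirichlet form* if its domain is dense. It is *regular* if $E$ is a locally compact separable metrizable space, $\mu$ is a fully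 supported Radon measure, and the functions of $C_c(E)$ that belong to the domain are dense in the domain for $\mathscr E_1=\mathscr E+(\cdot,\cdot)_\mu$ and in $C_c(E)$ for the uniform norm. It is *irreducible* if every set $A$ that is invariant for its $L^2$-semigroup $(T_t)$, i.e. $T_t(1_Af)=1_AT_tf$ for all $t>0$ and $f\in L^2$, satisfies $\mu(A)=0$ or $\mu(A^c)=0$. A regular Dirichlet form $(\mathscr E^2,\mathscr F^2)$ on $L^2(E_2,\mu_2)$ is a *regular representation* of a Dirichlet form in the wide sense $(\mathscr E^1,\mathscr F^1)$ on $L^2(E_1,\mu_1)$ if there is an algebra isomorphism from $\mathscr F^1\cap L^\infty$ onto $\mathscr F^2\cap L^\infty$ that preserves the $L^\infty$-norm, the $L^2$-norm and the energy $\mathscr E^i(f,f)$. **Theorem.** The map $\widehat\iota$ is a well-defined injection of $\mathscr S$ into the continuous functions on $\widehat I$, every gap $(\widehat a_k,\widehat b_k)$ is bounded with both ends in $\widehat I$, and $(\mathscr E,\mathscr F)$ and $(\widehat{\mathscr E},\widehat{\mathscr F})$ are well defined on classes of functions that agree almost everywhere. Moreover: 1. $\widehat{\mathfrak m}$ is a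 fully supported Radon measure on $\widehat I$. 2. $(\widehat{\mathscr E},\widehat{\mathscr F})$ is a regular and irreducible Dirichlet form on $L^2(\widehat I,\widehat{\mathfrak m})$. 3. $$\widehat{\mathscr F}=\Big\{\widehat f\in L^2(\widehat I,\widehat{\mathfrak m})\cap\widehat{\mathscr S}:\ \lim_{\widehat x\to\widehat j}\widehat f(\widehat x)=0\ \text{ whenever }\widehat j\in\{\widehat l,\widehat r\}\cap(\mathbb R\setminus\widehat I)\Big\},$$ and every $\widehat f\in\widehat{\mathscr F}$ is differentiable along $\widehat I$ at Lebesgue-almost every point of $\widehat I$, with $$\widehat{\mathscr E}(\widehat f,\widehat f)=\frac12\int_{\widehat I}\widehat f'(\widehat x)^2\,d\widehat x+\frac12\sum_{k\ge1}\frac{\big(\widehat f(\widehat a_k)-\widehat f(\widehat b_k)\big)^2}{|\widehat b_k-\widehat a_k|},$$ both terms being finite. 4. $(\mathscr E,\mathscr F)$ is a Dirichlet form in the wide sense on $L^2(I,\mathfrak m)$, and $(\widehat I,\widehat{\mathfrak m},\widehat{\mathscr E},\widehat{\mathscr F})$ is a regular representation of $(I,\mathfrak m,\mathscr E,\mathscr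 F)$. -/

import Mathlib

open Set Filter Topology MeasureTheory
open scoped ENNReal

noncomputable section

/-! ### Symmetric forms on `L²` -/

/-- A form on `L²(X, μ)`: a domain and a real-valued function of two arguments, of which only the
values on the domain matter. -/
structure L2Form {X : Type*} [MeasurableSpace X] (μ : Measure X) where
  dom : Set (Lp ℝ 2 μ)
  form : Lp ℝ 2 μ → Lp ℝ 2 μ → ℝ

namespace L2Form

variable {X : Type*} [MeasurableSpace X] {μ : Measure X}

/-- `E₁(u, u) = E(u, u) + (u, u)`. -/
def energyOne (a : L2Form μ) (u : Lp ℝ 2 μ) : ℝ := a.form u u + inner ℝ u u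

/-- Dirichlet form in the wide sense: a nonnegative symmetric bilinear form on a linear subspace of
`L²(X, μ)` (not required to be dense) that is closed and Markovian. -/
structure IsDirichletWide (a : L2Form μ) : Prop where
  zero_mem : 0 ∈ a.dom
  add_mem : ∀ u ∈ a.dom, ∀ v ∈ a.dom, u + v ∈ a.dom
  smul_mem : ∀ (c : ℝ), ∀ u ∈ a.dom, c • u ∈ a.dom
  add_left : ∀ u ∈ a.dom, ∀ v ∈ a.dom, ∀ w ∈ a.dom, a.form (u + v) w = a.form u w + a.form v w
  smul_left : ∀ (c : ℝ), ∀ u ∈ a.dom, ∀ v ∈ a.dom, a.form (c • u) v = c * a.form u v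
  symm : ∀ u ∈ a.dom, ∀ v ∈ a.dom, a.form u v = a.form v u
  nonneg : ∀ u ∈ a.dom, 0 ≤ a.form u u
  closed : ∀ u : ℕ → Lp ℝ 2 μ, (∀ n, u n ∈ a.dom) →
    (∀ ε > 0, ∃ N, ∀ p ≥ N, ∀ q ≥ N, a.energyOne (u p - u q) < ε) →
    ∃ v ∈ a.dom, Tendsto (fun n => a.energyOne (u n - v)) atTop (𝓝 0)
  markov : ∀ u ∈ a.dom, ∃ v ∈ a.dom,
    (∀ᵐ x ∂μ, v x = min (max 0 (u x)) 1) ∧ a.form v v ≤ a.form u u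

/-- Dirichlet form on `L²(X, μ)`: a densely defined Dirichlet form in the wide sense. -/
structure IsDirichletForm (a : L2Form μ) : Prop extends IsDirichletWide a where
  dense : Dense a.dom

/-- Regularity: the state space is locally compact, separable and metrizable, `μ` is a fully
supported Radon measure, and `F ∩ C_c(X)` is dense both in `F` with respect to `E₁` and in `C_c(X)`
with respect to the uniform norm. -/
structure IsRegular [TopologicalSpace X] (a : L2Form μ) : Prop where
  locallyCompact : LocallyCompactSpace X
  separable : TopologicalSpace.SeparableSpace X
  metrizable : TopologicalSpace.MetrizableSpace X
  radon : μ.Regular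
  fullSupport : μ.IsOpenPosMeasure
  dense_form : ∀ u ∈ a.dom, ∀ ε > 0, ∃ v ∈ a.dom,
    (∃ φ : X → ℝ, Continuous φ ∧ HasCompactSupport φ ∧ v =ᵐ[μ] φ) ∧ a.energyOne (u - v) < ε
  dense_unif : ∀ φ : X → ℝ, Continuous φ → HasCompactSupport φ → ∀ ε > 0,
    ∃ ψ : X → ℝ, Continuous ψ ∧ HasCompactSupport ψ ∧ (∃ v ∈ a.dom, v =ᵐ[μ] ψ) ∧
      ∀ x, |φ x - ψ x| < ε

/-- `T` is the `L²`-semigroup of the form `a`: the strongly continuous semigroup `(T_t)_{t > 0}` of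
symmetric contractions with `F = {u : lim_{t ↓ 0} (u - T_t u, u) / t < ∞}` and
`E(u, v) = lim_{t ↓ 0} (u - T_t u, v) / t` on `F`. The quotient `(u - T_t u, u) / t` increases as
`t` decreases, so that its limit is finite exactly when it is bounded. -/
structure IsSemigroup (a : L2Form μ) (T : ℝ → Lp ℝ 2 μ →L[ℝ] Lp ℝ 2 μ) : Prop where
  semigroup : ∀ s > 0, ∀ t > 0, ∀ u, T (s + t) u = T s (T t u)
  contraction : ∀ t > 0, ∀ u, ‖T t u‖ ≤ ‖u‖
  symmetric : ∀ t > 0, ∀ u v, inner ℝ (T t u) v = inner ℝ u (T t v)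
  strongly_continuous : ∀ u, Tendsto (fun t => T t u) (𝓝[>] 0) (𝓝 u)
  mem_dom_iff : ∀ u, u ∈ a.dom ↔ ∃ C : ℝ, ∀ t > 0, inner ℝ (u - T t u) u / t ≤ C
  form_eq : ∀ u ∈ a.dom, ∀ v ∈ a.dom,
    Tendsto (fun t => inner ℝ (u - T t u) v / t) (𝓝[>] 0) (𝓝 (a.form u v))

/-- `A` is invariant for the semigroup of `a`: `T_t (1_A u) = 1_A T_t u` for all `u ∈ L²`. -/
def IsInvariantSet (a : L2Form μ) (A : Set X) : Prop :=
  MeasurableSet A ∧ ∃ T, a.IsSemigroup T ∧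
    ∀ t > 0, ∀ u v : Lp ℝ 2 μ, v =ᵐ[μ] A.indicator u → T t v =ᵐ[μ] A.indicator (T t u)

/-- Irreducibility: invariant sets are trivial. -/
def IsIrreducible (a : L2Form μ) : Prop :=
  ∀ A : Set X, a.IsInvariantSet A → μ A = 0 ∨ μ Aᶜ = 0

/-- `F_b = F ∩ L^∞(X, μ)`. -/
def bddDom (a : L2Form μ) : Set (Lp ℝ 2 μ) := {u | u ∈ a.dom ∧ eLpNorm u ∞ μ < ∞}

/-- Two Dirichlet spaces (in the wide sense) are equivalent: there is an algebra isomorphism of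
`F_b` onto `F'_b` which preserves the `L^∞`-norm, the `L²`-norm and the energy. -/
def Equivalent {Y : Type*} [MeasurableSpace Y] {ν : Measure Y} (a : L2Form μ) (b : L2Form ν) :
    Prop :=
  a.IsDirichletWide ∧ b.IsDirichletWide ∧
    ∃ Φ : Lp ℝ 2 μ → Lp ℝ 2 ν, BijOn Φ a.bddDom b.bddDom ∧
      (∀ u ∈ a.bddDom, ∀ v ∈ a.bddDom, Φ (u + v) = Φ u + Φ v) ∧
      (∀ (c : ℝ), ∀ u ∈ a.bddDom, Φ (c • u) = c • Φ u) ∧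
      (∀ u ∈ a.bddDom, ∀ v ∈ a.bddDom, ∃ w ∈ a.bddDom,
        (∀ᵐ x ∂μ, w x = u x * v x) ∧ ∀ᵐ y ∂ν, Φ w y = Φ u y * Φ v y) ∧
      ∀ u ∈ a.bddDom, eLpNorm (Φ u) ∞ ν = eLpNorm u ∞ μ ∧
        (inner ℝ (Φ u) (Φ u) : ℝ) = inner ℝ u u ∧ b.form (Φ u) (Φ u) = a.form u u

/-- `b` is a regular representation of `a`. -/
def IsRegularRepresentation {Y : Type*} [MeasurableSpace Y] [TopologicalSpace Y] {ν : Measure Y}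
    (b : L2Form ν) (a : L2Form μ) : Prop :=
  a.Equivalent b ∧ b.IsDirichletForm ∧ b.IsRegular

/-- A family `F` of square integrable functions together with a function `E` of two arguments
descends to `μ`-equivalence classes. -/
def Descends (μ : Measure X) (F : Set (X → ℝ)) (E : (X → ℝ) → (X → ℝ) → ℝ) : Prop :=
  (∀ f ∈ F, MemLp f 2 μ) ∧
    ∀ f ∈ F, ∀ f' ∈ F, ∀ g ∈ F, ∀ g' ∈ F, f =ᵐ[μ] f' → g =ᵐ[μ] g' → E f g = E f' g'

open Classical in
/-- The form on `L²(X, μ)` induced by a family `F` of functions and a function `E` of two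
arguments, through representatives in `F`; see `Descends`. -/
def ofFun (μ : Measure X) (F : Set (X → ℝ)) (E : (X → ℝ) → (X → ℝ) → ℝ) : L2Form μ where
  dom := {u | ∃ f ∈ F, u =ᵐ[μ] f}
  form u v :=
    if h : (∃ f ∈ F, u =ᵐ[μ] f) ∧ (∃ g ∈ F, v =ᵐ[μ] g) then E h.1.choose h.2.choose else 0

end L2Form

/-- `(a, b)` is one of the disjoint open intervals that make up the open set `V`. -/
def IsComponentInterval {α : Type*} [Preorder α] (V : Set α) (a b : α) : Prop :=
  a < b ∧ Ioo a b ⊆ V ∧ a ∉ V ∧ b ∉ V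

/-! ### Scale functions and speed measures -/

/-- An interval with endpoints `-∞ ≤ l < 0 < r ≤ ∞`, a nonconstant increasing function `s` on
`(l, r)` (the values of `s` outside are irrelevant) with `s(0-) = s(0) = s(0+) = 0`, and a Borel
measure `m` on `[l, r]` that is Radon on `(l, r)` and does not charge `0`. -/
structure ScaleSpeed where
  l : EReal
  r : EReal
  s : ℝ → ℝ
  m : Measure EReal
  l_neg : l < 0
  r_pos : 0 < r
  s_mono : MonotoneOn s {x : ℝ | l < (x : EReal) ∧ (x : EReal) < r}
  s_nonconst : ∃ x y : ℝ, l < (x : EReal) ∧ (x : EReal) < r ∧ l < (y : EReal) ∧ (y : EReal) < r ∧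
    s x ≠ s y
  s_zero : s 0 = 0
  s_cont_zero : ContinuousAt s 0
  m_compl : m (Icc l r)ᶜ = 0
  m_radon : ∀ a b : EReal, l < a → b < r → m (Icc a b) < ∞
  m_zero : m {0} = 0

namespace ScaleSpeed

variable (T : ScaleSpeed)

/-! #### The scale function on `[l, r]` -/

open Classical in
/-- The scale function extended to `[l, r]` by its limits at `l` and `r` (and to the whole of
`[-∞, ∞]` by these constants). -/
def scale (x : EReal) : EReal :=
  if x ≤ T.l then ⨅ y : {y : ℝ // T.l < (y : EReal) ∧ (y : EReal) < T.r}, (T.s y : EReal)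
  else if T.r ≤ x then ⨆ y : {y : ℝ // T.l < (y : EReal) ∧ (y : EReal) < T.r}, (T.s y : EReal)
  else (T.s x.toReal : EReal)

/-- The right limit `s(x+)`. -/
def scaleR (x : EReal) : EReal := Function.rightLim T.scale x

/-- The left limit `s(x-)`. -/
def scaleL (x : EReal) : EReal := Function.leftLim T.scale x

/-- The set of points of `[l, r]` near which the scale function is constant. -/
def flat : Set EReal :=
  {x | x ∈ Icc T.l T.r ∧ ∃ V ∈ 𝓝 x, ∀ y ∈ V ∩ Icc T.l T.r, T.scale y = T.scale x}

/-- The support of the scale function. -/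
def suppScale : Set EReal := Icc T.l T.r \ T.flat

/-- `D⁺`. -/
def DR : Set EReal := {x | x ∈ Icc T.l T.r ∧ T.scale x ≠ T.scaleR x}

/-- `D⁻`. -/
def DL : Set EReal := {x | x ∈ Icc T.l T.r ∧ T.scale x ≠ T.scaleL x}

/-- `(c, d)` is one of the maximal open intervals of `flat \ {l, r}`. -/
def IsFlatInterval (c d : EReal) : Prop := IsComponentInterval (T.flat \ {T.l, T.r}) c d

/-- `(c, d)` is an isolated maximal flat interval: both ends lie in `D ∪ {l, r}`. -/
def IsIsolatedInterval (c d : EReal) : Prop :=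
  T.IsFlatInterval c d ∧ c ∈ T.DR ∪ T.DL ∪ {T.l, T.r} ∧ d ∈ T.DR ∪ T.DL ∪ {T.l, T.r}

/-! #### Classification of the endpoints -/

/-- `l` is approachable: `s(l) > -∞`. -/
def ApproachableL : Prop := T.scale T.l ≠ ⊥

/-- `r` is approachable: `s(r) < ∞`. -/
def ApproachableR : Prop := T.scale T.r ≠ ⊤

/-- `l` is reflecting: approachable, `m(l+) < ∞` and `m({l}) < ∞`. -/
def ReflectingL : Prop :=
  T.ApproachableL ∧ (∃ a, T.l < a ∧ T.m (Ioo T.l a) < ∞) ∧ T.m {T.l} < ∞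

/-- `r` is reflecting: approachable, `m(r-) < ∞` and `m({r}) < ∞`. -/
def ReflectingR : Prop :=
  T.ApproachableR ∧ (∃ a, a < T.r ∧ T.m (Ioo a T.r) < ∞) ∧ T.m {T.r} < ∞

/-- The interval `I` with ends `l`, `r`, containing exactly those of them that are reflecting. -/
def I : Set EReal :=
  {x | x ∈ Icc T.l T.r ∧ (x = T.l → T.ReflectingL) ∧ (x = T.r → T.ReflectingR)}

/-- The speed measure on `I`. -/
def mI : Measure T.I := T.m.comap Subtype.val

/-- Hypothesis (DK). -/
def DK : Prop :=
  ∀ c d, T.IsIsolatedInterval c d → (c = T.l → T.ReflectingL) ∧ (d = T.r → T.ReflectingR)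

/-- Hypothesis (DM). -/
def DM : Prop :=
  T.suppScale ⊆ T.m.support ∧
    (∀ x ∈ T.DR ∩ T.DL, 0 < T.m {x}) ∧
    ∀ c d, T.IsIsolatedInterval c d →
      0 < T.m {x | (c < x ∧ x < d) ∨ (x = c ∧ c ∉ T.DR) ∨ (x = d ∧ d ∉ T.DL)}

/-! #### Absolute continuity with respect to the scale function -/

/-- `μ_d⁺ = ∑_{x ∈ D⁺} (s(x+) - s(x)) δ_x`. -/
def muR : Measure T.I :=
  Measure.sum fun x : {x : T.I // (x : EReal) ∈ T.DR} =>
    ENNReal.ofReal ((T.scaleR x.1).toReal - (T.scale x.1).toReal) • Measure.dirac x.1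

/-- `μ_d⁻ = ∑_{x ∈ D⁻} (s(x) - s(x-)) δ_x`. -/
def muL : Measure T.I :=
  Measure.sum fun x : {x : T.I // (x : EReal) ∈ T.DL} =>
    ENNReal.ofReal ((T.scale x.1).toReal - (T.scaleL x.1).toReal) • Measure.dirac x.1

open Classical in
/-- `∫_{(0, x)} g dμ`, which means `-∫_{[x, 0)} g dμ` for `x < 0`. -/
def intOpen (μ : Measure T.I) (g : T.I → ℝ) (x : T.I) : ℝ :=
  if (0 : EReal) ≤ x then ∫ y in {y : T.I | (0 : EReal) < y ∧ y < x}, g y ∂μ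
  else -∫ y in {y : T.I | x ≤ y ∧ (y : EReal) < 0}, g y ∂μ

open Classical in
/-- `∫_{(0, x]} g dμ`, which means `-∫_{(x, 0)} g dμ` for `x < 0`. -/
def intClosed (μ : Measure T.I) (g : T.I → ℝ) (x : T.I) : ℝ :=
  if (0 : EReal) ≤ x then ∫ y in {y : T.I | (0 : EReal) < y ∧ y ≤ x}, g y ∂μ
  else -∫ y in {y : T.I | x < y ∧ (y : EReal) < 0}, g y ∂μ

/-- The continuous part `s_c = s - s_d⁺ - s_d⁻` of the scale function. -/
def sC (x : T.I) : ℝ :=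
  (T.scale x).toReal - T.intOpen T.muR (fun _ => 1) x - T.intClosed T.muL (fun _ => 1) x

open Classical in
/-- `μ_c`, the Lebesgue–Stieltjes measure of the continuous increasing function `s_c`: the unique
measure on `I` which gives mass `s_c(b) - s_c(a)` to every `[a, b] ⊆ I`. -/
def muC : Measure T.I :=
  if h : ∃ ν : Measure T.I, ∀ a b : T.I, a ≤ b → ν (Icc a b) = ENNReal.ofReal (T.sC b - T.sC a)
  then h.choose else 0

/-- `s`-continuity: `f` has finite one-sided limits on `I`, and is left (right) continuous at each
point where the scale function is. -/
def SCont (f : T.I → ℝ) : Prop :=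
  ∀ x : T.I, (∃ y, Tendsto f (𝓝[<] x) (𝓝 y)) ∧ (∃ y, Tendsto f (𝓝[>] x) (𝓝 y)) ∧
    ((x : EReal) ∉ T.DL → Tendsto f (𝓝[<] x) (𝓝 (f x))) ∧
    ((x : EReal) ∉ T.DR → Tendsto f (𝓝[>] x) (𝓝 (f x)))

/-- `f'_{s,+}(x) = (f(x) - f(x+)) / (s(x) - s(x+))` (used for `x ∈ D⁺`). -/
def slopeR (f : T.I → ℝ) (x : T.I) : ℝ :=
  (f x - Function.rightLim f x) / ((T.scale x).toReal - (T.scaleR x).toReal)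

/-- `f'_{s,-}(x) = (f(x) - f(x-)) / (s(x) - s(x-))` (used for `x ∈ D⁻`). -/
def slopeL (f : T.I → ℝ) (x : T.I) : ℝ :=
  (f x - Function.leftLim f x) / ((T.scale x).toReal - (T.scaleL x).toReal)

/-- The continuous part `f^c` of `f`. -/
def contPart (f : T.I → ℝ) (x : T.I) : ℝ :=
  f x - T.intOpen T.muR (T.slopeR f) x - T.intClosed T.muL (T.slopeL f) x

/-- `g = φ ∘ s_c` with `φ` absolutely continuous on the interval `s_c(I)`. -/
def IsACRep (g : T.I → ℝ) (φ : ℝ → ℝ) : Prop :=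
  (∀ x, g x = φ (T.sC x)) ∧ ∀ a b : T.I, AbsolutelyContinuousOnInterval φ (T.sC a) (T.sC b)

open Classical in
/-- `dg/ds_c = φ' ∘ s_c` if `g = φ ∘ s_c` with `φ` absolutely continuous on `s_c(I)`; it is
determined up to a `μ_c`-null set. -/
def derivC (g : T.I → ℝ) : T.I → ℝ :=
  if h : ∃ φ, T.IsACRep g φ then fun x => deriv h.choose (T.sC x) else 0

/-- The family `𝒮_c`. -/
def SC : Set (T.I → ℝ) :=
  {g | Continuous g ∧ (∃ φ, T.IsACRep g φ) ∧ MemLp (T.derivC g) 2 T.muC}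

/-- The family `𝒮`. -/
def S : Set (T.I → ℝ) :=
  {f | T.SCont f ∧ MemLp (T.slopeR f) 2 T.muR ∧ MemLp (T.slopeL f) 2 T.muL ∧ T.contPart f ∈ T.SC}

/-- The form `E(f, g) = ½ ∫_I (df/ds)(dg/ds) ds`. -/
def E (f g : T.I → ℝ) : ℝ :=
  (1 / 2 : ℝ) * (∫ x, T.derivC (T.contPart f) x * T.derivC (T.contPart g) x ∂T.muC +
    ∫ x, T.slopeR f x * T.slopeR g x ∂T.muR + ∫ x, T.slopeL f x * T.slopeL g x ∂T.muL)

/-- The domain `F`: functions in `𝒮 ∩ L²(I, m)` that tend to `0` at the approachable endpoints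
outside `I`. -/
def F : Set (T.I → ℝ) :=
  {f | f ∈ T.S ∧ MemLp f 2 T.mI ∧
    (T.l ∉ T.I → T.ApproachableL → Tendsto f (comap Subtype.val (𝓝 T.l)) (𝓝 0)) ∧
    (T.r ∉ T.I → T.ApproachableR → Tendsto f (comap Subtype.val (𝓝 T.r)) (𝓝 0))}

/-- The form `(E, F)` on `L²(I, m)`. -/
def form : L2Form T.mI := L2Form.ofFun T.mI T.F T.E

/-! #### The canonical regularization -/

/-- `Î`: the closure of `s([l, r])` without those of the ends `s(l)`, `s(r)` that are not
reflecting. -/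
def IHat : Set ℝ :=
  {y | (y : EReal) ∈ closure (T.scale '' Icc T.l T.r) ∧
    ((y : EReal) = T.scale T.l → T.ReflectingL) ∧ ((y : EReal) = T.scale T.r → T.ReflectingR)}

/-- `m̂ = m ∘ s⁻¹` on `Î`. -/
def mHat : Measure T.IHat := (T.m.map T.scale).comap fun y : T.IHat => ((y : ℝ) : EReal)

/-- `f̂(s(x)) = f(x)` for `x ∈ I` and `f̂(s(x±)) = f(x±)` for `x ∈ D^±`, wherever the arguments
belong to `Î`. -/
def IsHat (f : T.I → ℝ) (fh : T.IHat → ℝ) : Prop :=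
  (∀ (x : T.I) (y : T.IHat), ((y : ℝ) : EReal) = T.scale x → fh y = f x) ∧
  (∀ (x : T.I) (y : T.IHat), (x : EReal) ∈ T.DR → ((y : ℝ) : EReal) = T.scaleR x →
    fh y = Function.rightLim f x) ∧
  (∀ (x : T.I) (y : T.IHat), (x : EReal) ∈ T.DL → ((y : ℝ) : EReal) = T.scaleL x →
    fh y = Function.leftLim f x)

open Classical in
/-- The map `ι̂ : f ↦ f̂`, where `f̂` is the function with `IsHat f f̂`. -/
def hat (f : T.I → ℝ) : T.IHat → ℝ := if h : ∃ fh, T.IsHat f fh then h.choose else 0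

/-- `𝒮̂ = ι̂(𝒮)`. -/
def SHat : Set (T.IHat → ℝ) := T.hat '' T.S

/-- The inverse of `ι̂ : 𝒮 → 𝒮̂`. -/
def hatInv (fh : T.IHat → ℝ) : T.I → ℝ := Function.invFunOn T.hat T.S fh

/-- `F̂ = ι̂(F)`. -/
def FHat : Set (T.IHat → ℝ) := T.hat '' T.F

/-- `Ê(f̂, ĝ) = E(ι̂⁻¹ f̂, ι̂⁻¹ ĝ)`. -/
def EHat (fh gh : T.IHat → ℝ) : ℝ := T.E (T.hatInv fh) (T.hatInv gh)

/-- The form `(Ê, F̂)` on `L²(Î, m̂)`. -/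
def formHat : L2Form T.mHat := L2Form.ofFun T.mHat T.FHat T.EHat

/-- The open set `(s(l), s(r)) \ Î`. -/
def gapSet : Set EReal :=
  Ioo (T.scale T.l) (T.scale T.r) \ ((fun y : ℝ => (y : EReal)) '' T.IHat)

/-- The index set of the gaps `(â_k, b̂_k)`. -/
def Gap : Type :=
  {p : T.IHat × T.IHat // IsComponentInterval T.gapSet ((p.1 : ℝ) : EReal) ((p.2 : ℝ) : EReal)}

/-- The left end `â_k` of a gap. -/
def Gap.left {T : ScaleSpeed} (k : T.Gap) : T.IHat := k.1.1

/-- The right end `b̂_k` of a gap. -/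
def Gap.right {T : ScaleSpeed} (k : T.Gap) : T.IHat := k.1.2

/-- A function on `Î` as a function on `ℝ` (the values outside `Î` are irrelevant). -/
def ext (fh : T.IHat → ℝ) : ℝ → ℝ := Function.extend Subtype.val fh 0

/-- The derivative `f̂'` of a function along `Î`. -/
def derivHat (fh : T.IHat → ℝ) (x : ℝ) : ℝ := derivWithin (T.ext fh) T.IHat x

end ScaleSpeed

end

/-!
The scale function turns everything into function theory on the set `Î ⊂ ℝ`. Each `f ∈ 𝒮` is of the
form `G ∘ s`, where `G` is a primitive of some `H ∈ L²(ℝ)`: on a jump interval of `s`, `H` is the slope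
of `f` at this jump, elsewhere it is `df^c/ds_c`, and it vanishes outside `(s(l), s(r))`
(`ScaleSpeed.eq_add_integral`). The three integrals in the energy add up to
`E(f, g) = ½ ⟨H_f, H_g⟩` (`ScaleSpeed.energy_eq`), and every primitive of a square integrable density
which is constant on the jump intervals arises in this way (`ScaleSpeed.mem_S_of_density`). By (DK),
the jump intervals are exactly the gaps of `Î`, with ends in `Î` (`ScaleSpeed.exists_jump_of_gap`). So
the densities which occur are those in the closed span `densitySpace Î` of the steps `1_{(a, b]}` with
`a, b ∈ Î`, and `f̂` is the restriction of `G` to `Î`.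

It remains to study an abstract form (`IsEnergyForm`): on a set `K ⊂ ℝ` with compact intervals and
with a Radon measure of full support, the form `½ ⟨H_u, H_v⟩` on the square integrable primitives of
elements of `densitySpace K` that vanish at the boundary points of `K` outside `K`.

* It is closed, as the densities and the values at points of `K` converge along a Cauchy sequence,
  and Markovian, as a contraction of the line decreases the norm of the density.
* It is regular: multiplication by cutoff functions approximates the functions of the domain by
  functions of compact support (`exists_approx_right`). Near a boundary point outside `K`, or near
  infinity, the energy needed for the cutoff is small (`exists_ramp`).
* It is irreducible: the indicator of an invariant set could change its value only across a gap, and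
  this is excluded by a tent next to this gap, whose energy relative to the indicator would be
  negative instead of zero (`IsEnergyForm.not_switch`).
* The norm of a density splits into the contributions of `K`, where the density is the derivative
  along `K`, and of the gaps, where it is constant (`IsDensity.norm_sq_eq`). This gives the formula
  for `Ê`.

Condition (DM) is needed for `m̂` to have full support (`ScaleSpeed.measure_preimage_pos`). Finally,
`m̂` is the image of `m` on the part of `I` that `s` maps to `Î`; the other points of `I` are mapped to
boundary points of `Î`, where the functions in `F̂` vanish (`ScaleSpeed.indicator_core_hat`).
Therefore composition with `s` is an isometry of `L²(Î, m̂)` into `L²(I, m)` which maps `F̂` onto `F` and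
`Ê` to `E`, and this makes `E` a Dirichlet form in the wide sense that is represented by `Ê`
(`L2Form.IsDirichletWide.equivalent_pull`).
-/


/-! ### Densities of functions on a subset of the line -/

/-- The Hilbert space `L²(ℝ)` of the Lebesgue measure. -/
abbrev LineL2 : Type := Lp ℝ 2 (volume : Measure ℝ)

/-- The indicator of `(a, b]` as an element of `L²(ℝ)`. -/
noncomputable def stepL2 (a b : ℝ) : LineL2 :=
  indicatorConstLp 2 (measurableSet_Ioc (a := a) (b := b)) measure_Ioc_lt_top.ne (1 : ℝ)

theorem inner_stepL2 {a b : ℝ} (hab : a ≤ b) (H : LineL2) :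
    inner ℝ (stepL2 a b) H = ∫ y in a..b, H y := by
  rw [stepL2, L2.inner_indicatorConstLp_one, intervalIntegral.integral_of_le hab]

theorem norm_stepL2_sq {a b : ℝ} (hab : a ≤ b) : ‖stepL2 a b‖ ^ 2 = b - a := by
  rw [← real_inner_self_eq_norm_sq, stepL2,
    L2.real_inner_indicatorConstLp_one_indicatorConstLp_one _ _ measure_Ioc_lt_top.ne
      measure_Ioc_lt_top.ne]
  simp [hab]

theorem sq_integral_le {a b : ℝ} (hab : a ≤ b) (H : LineL2) :
    (∫ y in a..b, H y) ^ 2 ≤ (b - a) * ‖H‖ ^ 2 := by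
  rw [← inner_stepL2 hab, ← norm_stepL2_sq hab, ← mul_pow]
  exact sq_le_sq' (neg_le_of_abs_le (abs_real_inner_le_norm _ _)) (real_inner_le_norm _ _)

theorem lineL2_locallyIntegrable (H : LineL2) : LocallyIntegrable H volume :=
  (Lp.memLp H).locallyIntegrable (by norm_num)

theorem lineL2_intervalIntegrable (H : LineL2) (a b : ℝ) : IntervalIntegrable H volume a b :=
  intervalIntegrable_iff.2 (((lineL2_locallyIntegrable H).integrableOn_isCompact
    isCompact_uIcc).mono_set uIoc_subset_uIcc)

theorem norm_sq_toLp {X : Type*} [MeasurableSpace X] {μ : Measure X} {f : X → ℝ}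
    (hf : MemLp f 2 μ) : ‖hf.toLp f‖ ^ 2 = ∫ y, f y ^ 2 ∂μ := by
  rw [← real_inner_self_eq_norm_sq, L2.inner_def]
  refine integral_congr_ae ?_
  filter_upwards [hf.coeFn_toLp] with y hy
  rw [hy]; simp [sq]

/-- The closed span in `L²(ℝ)` of the indicators of the intervals `(a, b]` with `a, b ∈ K`. Its
elements vanish outside the convex hull of `K` and are constant on the gaps of `K`. -/
noncomputable def densitySpace (K : Set ℝ) : Submodule ℝ LineL2 :=
  (Submodule.span ℝ {F | ∃ a ∈ K, ∃ b ∈ K, a ≤ b ∧ F = stepL2 a b}).topologicalClosure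

theorem isClosed_densitySpace (K : Set ℝ) : IsClosed (densitySpace K : Set LineL2) :=
  Submodule.isClosed_topologicalClosure _

instance (K : Set ℝ) : CompleteSpace (densitySpace K) :=
  (isClosed_densitySpace K).completeSpace_coe

theorem stepL2_mem_densitySpace {K : Set ℝ} {a b : ℝ} (ha : a ∈ K) (hb : b ∈ K) (hab : a ≤ b) :
    stepL2 a b ∈ densitySpace K :=
  Submodule.le_topologicalClosure _ (Submodule.subset_span ⟨a, ha, b, hb, hab, rfl⟩)

/-- An element of the density space is determined by its integrals between points of `K`: if these
vanish, the element is orthogonal to all steps that span the space, hence to itself. -/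
theorem eq_zero_of_mem_densitySpace {K : Set ℝ} {H : LineL2} (hH : H ∈ densitySpace K)
    (h : ∀ a ∈ K, ∀ b ∈ K, a ≤ b → ∫ y in a..b, H y = 0) : H = 0 := by
  have h1 : densitySpace K ≤ (Submodule.span ℝ {H})ᗮ := by
    refine Submodule.topologicalClosure_minimal _ ?_ (Submodule.isClosed_orthogonal _)
    rw [Submodule.span_le]
    rintro F ⟨a, ha, b, hb, hab, rfl⟩
    rw [SetLike.mem_coe, Submodule.mem_orthogonal_singleton_iff_inner_left, inner_stepL2 hab]
    exact h a ha b hb hab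
  have h2 := h1 hH
  rwa [Submodule.mem_orthogonal_singleton_iff_inner_left, inner_self_eq_zero] at h2

/-- `H` is the density of `u : K → ℝ`: it belongs to the density space of `K` and its integrals
are the increments of `u`. So `H` is the derivative of the function which interpolates `u` linearly
on the gaps of `K`. -/
structure IsDensity {K : Set ℝ} (u : K → ℝ) (H : LineL2) : Prop where
  mem : H ∈ densitySpace K
  sub_eq : ∀ a b : K, (a : ℝ) ≤ b → u b - u a = ∫ y in (a : ℝ)..b, H y

namespace IsDensity

variable {K : Set ℝ} {u v : K → ℝ} {H H' : LineL2}

theorem sub_eq' (h : IsDensity u H) (a b : K) : u b - u a = ∫ y in (a : ℝ)..b, H y := by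
  rcases le_total (a : ℝ) b with hab | hab
  · exact h.sub_eq a b hab
  · rw [intervalIntegral.integral_symm, ← h.sub_eq b a hab]; ring

theorem unique (h : IsDensity u H) (h' : IsDensity u H') : H = H' := by
  rw [← sub_eq_zero]
  refine eq_zero_of_mem_densitySpace (K := K) (Submodule.sub_mem _ h.mem h'.mem) ?_
  intro a ha b hb hab
  rw [← inner_stepL2 hab, inner_sub_right, inner_stepL2 hab, inner_stepL2 hab,
    ← h.sub_eq ⟨a, ha⟩ ⟨b, hb⟩ hab, ← h'.sub_eq ⟨a, ha⟩ ⟨b, hb⟩ hab, sub_self]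

theorem add (h : IsDensity u H) (h' : IsDensity v H') : IsDensity (u + v) (H + H') where
  mem := Submodule.add_mem _ h.mem h'.mem
  sub_eq a b hab := by
    rw [← inner_stepL2 hab, inner_add_right, inner_stepL2 hab, inner_stepL2 hab,
      ← h.sub_eq a b hab, ← h'.sub_eq a b hab]
    simp only [Pi.add_apply]; ring

theorem smul (c : ℝ) (h : IsDensity u H) : IsDensity (c • u) (c • H) where
  mem := Submodule.smul_mem _ _ h.mem
  sub_eq a b hab := by
    rw [← inner_stepL2 hab, inner_smul_right, inner_stepL2 hab, ← h.sub_eq a b hab]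
    simp only [Pi.smul_apply, smul_eq_mul]; ring

theorem sub (h : IsDensity u H) (h' : IsDensity v H') : IsDensity (u - v) (H - H') := by
  have h1 := h.add (h'.smul (-1))
  simpa only [neg_smul, one_smul, ← sub_eq_add_neg] using h1

theorem zero : IsDensity (0 : K → ℝ) 0 where
  mem := Submodule.zero_mem _
  sub_eq a b hab := by
    rw [← inner_stepL2 hab]; simp

theorem sq_sub_le (h : IsDensity u H) (a b : K) : (u b - u a) ^ 2 ≤ |(b : ℝ) - a| * ‖H‖ ^ 2 := by
  rcases le_total (a : ℝ) b with hab | hab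
  · rw [h.sub_eq a b hab, abs_of_nonneg (sub_nonneg.2 hab)]
    exact sq_integral_le hab H
  · rw [← neg_sub, neg_sq, h.sub_eq b a hab, abs_sub_comm, abs_of_nonneg (sub_nonneg.2 hab)]
    exact sq_integral_le hab H

/-- A function with a density extends to a primitive of its density on the whole line. -/
theorem exists_primitive (h : IsDensity u H) :
    ∃ G : ℝ → ℝ, (∀ y : K, G y = u y) ∧ ∀ a b : ℝ, ∫ y in a..b, H y = G b - G a := by
  rcases isEmpty_or_nonempty K with hK | ⟨⟨y₀⟩⟩
  · refine ⟨fun y => ∫ t in (0 : ℝ)..y, H t, fun y => hK.elim y, fun a b => ?_⟩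
    simp only
    rw [intervalIntegral.integral_interval_sub_left] <;> exact lineL2_intervalIntegrable H _ _
  · refine ⟨fun y => u y₀ + ∫ t in (y₀ : ℝ)..y, H t, fun y => ?_, fun a b => ?_⟩
    · simp only
      rw [← h.sub_eq']; ring
    · simp only
      rw [add_sub_add_left_eq_sub, intervalIntegral.integral_interval_sub_left] <;>
        exact lineL2_intervalIntegrable H _ _

end IsDensity

/-- Interpolation: the orthogonal projection onto the density space replaces a square integrable
function by its mean on each gap of `K`, which keeps the integrals between points of `K`. -/
theorem exists_isDensity_of_integral {K : Set ℝ} {u : K → ℝ} {F : ℝ → ℝ} (hF : MemLp F 2 volume)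
    (hu : ∀ a b : K, (a : ℝ) ≤ b → u b - u a = ∫ y in (a : ℝ)..b, F y) :
    ∃ H, IsDensity u H ∧ ‖H‖ ^ 2 ≤ ∫ y, F y ^ 2 := by
  refine ⟨(densitySpace K).starProjection (hF.toLp F), ⟨Submodule.starProjection_apply_mem _ _,
    fun a b hab => ?_⟩, ?_⟩
  · have h1 := Submodule.starProjection_inner_eq_zero (K := densitySpace K) (hF.toLp F) (stepL2 a b)
      (stepL2_mem_densitySpace a.2 b.2 hab)
    rw [inner_sub_left, sub_eq_zero, real_inner_comm, real_inner_comm (stepL2 _ _),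
      inner_stepL2 hab, inner_stepL2 hab] at h1
    rw [← h1, hu a b hab]
    refine intervalIntegral.integral_congr_ae ?_
    filter_upwards [hF.coeFn_toLp] with y hy _
    exact hy.symm
  · rw [← norm_sq_toLp hF]
    gcongr
    exact Submodule.norm_starProjection_apply_le _ _

section Primitive

variable {H : LineL2} {G : ℝ → ℝ}

theorem primitive_eq (hG : ∀ a b : ℝ, ∫ y in a..b, H y = G b - G a) :
    G = fun y => G 0 + ∫ t in (0 : ℝ)..y, H t := by
  funext y; rw [hG]; ring

theorem primitive_absolutelyContinuous (hG : ∀ a b : ℝ, ∫ y in a..b, H y = G b - G a) (a b : ℝ) :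
    AbsolutelyContinuousOnInterval G a b := by
  have h1 := (lineL2_intervalIntegrable H a b).absolutelyContinuousOnInterval_intervalIntegral
    (left_mem_uIcc)
  have h2 : AbsolutelyContinuousOnInterval (fun _ : ℝ => G a) a b :=
    (LipschitzWith.const (G a)).lipschitzOnWith.absolutelyContinuousOnInterval
  have h3 : G = (fun _ : ℝ => G a) + fun x => ∫ t in a..x, H t := by
    funext y; simp only [Pi.add_apply]; rw [hG]; ring
  rw [h3]
  exact h2.add h1

/-- Lebesgue differentiation. -/
theorem primitive_ae_hasDerivAt (hG : ∀ a b : ℝ, ∫ y in a..b, H y = G b - G a) :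
    ∀ᵐ y, HasDerivAt G (H y) y := by
  filter_upwards [LocallyIntegrable.ae_hasDerivAt_integral (lineL2_locallyIntegrable H)] with y hy
  rw [primitive_eq hG]
  exact (hy 0).const_add _

theorem primitive_continuous (hG : ∀ a b : ℝ, ∫ y in a..b, H y = G b - G a) : Continuous G := by
  rw [primitive_eq hG]
  exact continuous_const.add (intervalIntegral.continuous_primitive
    (fun a b => lineL2_intervalIntegrable H a b) 0)

end Primitive

/-- The restriction to `K` of a locally absolutely continuous function with square integrable
derivative has a density, and passing to `K` does not increase the energy. -/
theorem exists_isDensity_of_deriv {K : Set ℝ} {u : K → ℝ} {G F : ℝ → ℝ}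
    (hGu : ∀ y : K, G y = u y) (hG : ∀ a b, AbsolutelyContinuousOnInterval G a b)
    (hF : MemLp F 2 volume) (hFG : ∀ᵐ y, deriv G y = F y) :
    ∃ H, IsDensity u H ∧ ‖H‖ ^ 2 ≤ ∫ y, F y ^ 2 := by
  refine exists_isDensity_of_integral hF fun a b hab => ?_
  rw [← hGu, ← hGu, ← (hG a b).integral_deriv_eq_sub]
  refine intervalIntegral.integral_congr_ae ?_
  filter_upwards [hFG] with y hy _ using hy

theorem absolutelyContinuous_comp_lipschitz {G φ : ℝ → ℝ} {C : NNReal} (hφ : LipschitzWith C φ)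
    {a b : ℝ} (hG : AbsolutelyContinuousOnInterval G a b) :
    AbsolutelyContinuousOnInterval (φ ∘ G) a b := by
  rw [absolutelyContinuousOnInterval_iff] at hG ⊢
  intro ε hε
  obtain ⟨δ, hδ, h⟩ := hG (ε / (C + 1)) (by positivity)
  refine ⟨δ, hδ, fun E hE hlen => ?_⟩
  have h1 := h E hE hlen
  rw [lt_div_iff₀ (by positivity)] at h1
  refine lt_of_le_of_lt ?_ h1
  rw [Finset.sum_mul]
  refine Finset.sum_le_sum fun i _ => (hφ.dist_le_mul _ _).trans ?_
  rw [mul_comm]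
  exact mul_le_mul_of_nonneg_left (by simp) dist_nonneg

/-- Composing `G` with a contraction does not increase the modulus of the derivative. No chain rule
is needed: the difference quotients are compared, and at points where the composition is not
differentiable its derivative is `0` by convention. -/
theorem norm_deriv_comp_le {G φ : ℝ → ℝ} (hφ : LipschitzWith 1 φ) {y d : ℝ}
    (hd : HasDerivAt G d y) : ‖deriv (φ ∘ G) y‖ ≤ ‖d‖ := by
  by_cases hdiff : DifferentiableAt ℝ (φ ∘ G) y
  · have h1 := (hasDerivAt_iff_tendsto_slope.1 hdiff.hasDerivAt).norm
    have h2 := (hasDerivAt_iff_tendsto_slope.1 hd).norm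
    refine le_of_tendsto_of_tendsto h1 h2 (Eventually.of_forall fun z => ?_)
    simp only [slope, vsub_eq_sub, norm_smul, Function.comp_apply]
    refine mul_le_mul_of_nonneg_left ?_ (norm_nonneg _)
    simpa [Real.dist_eq] using hφ.dist_le_mul (G z) (G y)
  · rw [deriv_zero_of_not_differentiableAt hdiff]; simp

/-- Contractions reduce the energy. -/
theorem IsDensity.exists_comp {K : Set ℝ} {u : K → ℝ} {H : LineL2} (h : IsDensity u H) {φ : ℝ → ℝ}
    (hφ : LipschitzWith 1 φ) : ∃ H', IsDensity (φ ∘ u) H' ∧ ‖H'‖ ^ 2 ≤ ‖H‖ ^ 2 := by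
  obtain ⟨G, hGu, hG⟩ := h.exists_primitive
  have hb : ∀ᵐ y, ‖deriv (φ ∘ G) y‖ ≤ ‖H y‖ := by
    filter_upwards [primitive_ae_hasDerivAt hG] with y hy using norm_deriv_comp_le hφ hy
  have hF : MemLp (deriv (φ ∘ G)) 2 volume :=
    (Lp.memLp H).of_le (aestronglyMeasurable_deriv _ _) hb
  obtain ⟨H', hH', hle⟩ := exists_isDensity_of_deriv (K := K) (u := φ ∘ u) (G := φ ∘ G)
    (fun y => by simp [hGu]) (fun a b => absolutelyContinuous_comp_lipschitz hφ
      (primitive_absolutelyContinuous hG a b)) hF (Eventually.of_forall fun _ => rfl)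
  refine ⟨H', hH', hle.trans ?_⟩
  have hHn : ‖H‖ ^ 2 = ∫ y, H y ^ 2 := by
    rw [← real_inner_self_eq_norm_sq, L2.inner_def]; simp [sq]
  rw [hHn]
  refine integral_mono_ae hF.integrable_sq (Lp.memLp H).integrable_sq ?_
  filter_upwards [hb] with y hy
  exact sq_le_sq.2 hy

/-- The product of a Lipschitz function on the line with a function that has a density, provided
that the derivative of the product is square integrable. -/
theorem IsDensity.exists_mul_lipschitz {K : Set ℝ} {u : K → ℝ} {H : LineL2} {G : ℝ → ℝ}
    (hGu : ∀ y : K, G y = u y) (hG : ∀ a b : ℝ, ∫ y in a..b, H y = G b - G a)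
    {W : ℝ → ℝ} {C : NNReal} (hW : LipschitzWith C W)
    (hF : MemLp (fun y => deriv W y * G y + W y * H y) 2 volume) :
    ∃ H', IsDensity (fun y : K => W y * u y) H' ∧
      ‖H'‖ ^ 2 ≤ ∫ y, (deriv W y * G y + W y * H y) ^ 2 := by
  refine exists_isDensity_of_deriv (G := fun y => W y * G y) (fun y => by simp [hGu])
    (fun a b => ((hW.lipschitzOnWith).absolutelyContinuousOnInterval).fun_mul
      (primitive_absolutelyContinuous hG a b)) hF ?_
  filter_upwards [primitive_ae_hasDerivAt hG, hW.ae_differentiableAt] with y h1 h2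
  exact (h2.hasDerivAt.mul h1).deriv

theorem lipschitzWith_clip (M : ℝ) : LipschitzWith 1 (fun t : ℝ => max (-M) (min M t)) := by
  have h1 : LipschitzWith 1 (fun t : ℝ => min M t) := by
    simpa using LipschitzWith.const_min LipschitzWith.id M
  simpa using h1.const_max (-M)

/-- Bounded functions with a density form an algebra. -/
theorem IsDensity.exists_mul {K : Set ℝ} {u v : K → ℝ} {H H' : LineL2} (hu : IsDensity u H)
    (hv : IsDensity v H') {M : ℝ} (hM : 0 ≤ M) (huM : ∀ y, |u y| ≤ M) (hvM : ∀ y, |v y| ≤ M) :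
    ∃ H'', IsDensity (u * v) H'' := by
  obtain ⟨G, hGu, hG⟩ := hu.exists_primitive
  obtain ⟨G', hGv, hG'⟩ := hv.exists_primitive
  -- The primitives are truncated at `M`, which does not change them on `K`.
  set φ : ℝ → ℝ := fun t => max (-M) (min M t) with hφdef
  have hφ : LipschitzWith 1 φ := lipschitzWith_clip M
  have hφM : ∀ t, |φ t| ≤ M := fun t => abs_le.2 ⟨le_max_left _ _, by simp [hφdef, hM]⟩
  have hφid : ∀ t, |t| ≤ M → φ t = t := fun t ht => by
    simp [hφdef, (abs_le.1 ht).1, (abs_le.1 ht).2]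
  have hAC := fun a b => absolutelyContinuous_comp_lipschitz hφ
    (primitive_absolutelyContinuous hG a b)
  have hAC' := fun a b => absolutelyContinuous_comp_lipschitz hφ
    (primitive_absolutelyContinuous hG' a b)
  have hF : MemLp (deriv (φ ∘ G)) 2 volume := by
    refine (Lp.memLp H).of_le (aestronglyMeasurable_deriv _ _) ?_
    filter_upwards [primitive_ae_hasDerivAt hG] with y hy using norm_deriv_comp_le hφ hy
  have hF' : MemLp (deriv (φ ∘ G')) 2 volume := by
    refine (Lp.memLp H').of_le (aestronglyMeasurable_deriv _ _) ?_
    filter_upwards [primitive_ae_hasDerivAt hG'] with y hy using norm_deriv_comp_le hφ hy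
  have hmeas : Continuous (φ ∘ G) := hφ.continuous.comp (primitive_continuous hG)
  have hmeas' : Continuous (φ ∘ G') := hφ.continuous.comp (primitive_continuous hG')
  have hP : MemLp (fun y => deriv (φ ∘ G) y * (φ ∘ G') y) 2 volume := by
    refine (hF.const_mul M).of_le (hF.1.mul hmeas'.aestronglyMeasurable)
      (Eventually.of_forall fun y => ?_)
    rw [norm_mul, norm_mul, mul_comm]
    gcongr
    rw [Real.norm_eq_abs, Real.norm_eq_abs, abs_of_nonneg hM]
    exact hφM _
  have hP' : MemLp (fun y => (φ ∘ G) y * deriv (φ ∘ G') y) 2 volume := by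
    refine (hF'.const_mul M).of_le (hmeas.aestronglyMeasurable.mul hF'.1)
      (Eventually.of_forall fun y => ?_)
    rw [norm_mul, norm_mul]
    gcongr
    rw [Real.norm_eq_abs, Real.norm_eq_abs, abs_of_nonneg hM]
    exact hφM _
  -- The product rule for absolutely continuous functions, in integrated form.
  obtain ⟨H'', h, -⟩ := exists_isDensity_of_integral (K := K) (u := u * v) (hP.add hP')
    fun a b hab => by
      have h := (hAC a b).integral_deriv_mul_eq_sub (hAC' a b)
      simp only [Function.comp_apply, hGu, hGv, hφid _ (huM _), hφid _ (hvM _)] at h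
      simpa using h.symm
  exact ⟨H'', h⟩

/-! ### The energy form on a subset of the line -/

theorem IsDensity.continuous {K : Set ℝ} {u : K → ℝ} {H : LineL2} (h : IsDensity u H) :
    Continuous u := by
  obtain ⟨G, hGu, hG⟩ := h.exists_primitive
  have h1 : u = fun y : K => G y := funext fun y => (hGu y).symm
  rw [h1]
  exact (primitive_continuous hG).comp continuous_subtype_val

theorem comap_val_neBot {K : Set ℝ} {j : ℝ} (hj : j ∈ closure K) :
    (comap (Subtype.val : K → ℝ) (𝓝 j)).NeBot :=
  mem_closure_iff_comap_neBot.1 hj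

/-- A function with a density has a limit at every point of the closure of `K`. -/
theorem IsDensity.tendsto {K : Set ℝ} {u : K → ℝ} {H : LineL2} (h : IsDensity u H) (a : K)
    (j : ℝ) : Tendsto u (comap Subtype.val (𝓝 j)) (𝓝 (u a + ∫ y in (a : ℝ)..j, H y)) := by
  obtain ⟨G, hGu, hG⟩ := h.exists_primitive
  have h1 : u = fun y : K => G y := funext fun y => (hGu y).symm
  rw [hG, hGu, add_sub_cancel, h1]
  exact ((primitive_continuous hG).tendsto j).comp tendsto_comap

/-- Integrals over bounded intervals are inner products with steps, hence continuous on `L²(ℝ)`. -/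
theorem tendsto_integral_of_tendsto {H : ℕ → LineL2} {H' : LineL2} (h : Tendsto H atTop (𝓝 H'))
    (a b : ℝ) : Tendsto (fun n => ∫ y in a..b, H n y) atTop (𝓝 (∫ y in a..b, H' y)) := by
  rcases le_total a b with hab | hab
  · simp only [← inner_stepL2 hab]
    exact tendsto_const_nhds.inner h
  · simp only [intervalIntegral.integral_symm b a, ← inner_stepL2 hab]
    exact (tendsto_const_nhds.inner h).neg

/-- The functions on `K` of finite energy that are square integrable and tend to `0` at those ends
of `K` which do not belong to `K`. -/
def energyDomain {K : Set ℝ} (ν : Measure K) : Set (K → ℝ) :=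
  {u | (∃ H, IsDensity u H) ∧ MemLp u 2 ν ∧
    ∀ j ∈ closure K \ K, Tendsto u (comap Subtype.val (𝓝 j)) (𝓝 0)}

/-- `a` is the form with domain `energyDomain ν` and energy `½ ∫ u' v'`, where `u'` and `v'` are
the densities of `u` and `v`. -/
structure IsEnergyForm {K : Set ℝ} {ν : Measure K} (a : L2Form ν) : Prop where
  mem_dom_iff : ∀ U, U ∈ a.dom ↔ ∃ u ∈ energyDomain ν, U =ᵐ[ν] u
  form_eq : ∀ (U V : Lp ℝ 2 ν) (u v : K → ℝ) (H H' : LineL2), u ∈ energyDomain ν →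
    v ∈ energyDomain ν → U =ᵐ[ν] u → V =ᵐ[ν] v → IsDensity u H → IsDensity v H' →
      a.form U V = (1 / 2 : ℝ) * inner ℝ H H'

section Domain

variable {K : Set ℝ} {ν : Measure K} {u v : K → ℝ}

theorem energyDomain_zero : (0 : K → ℝ) ∈ energyDomain ν :=
  ⟨⟨0, IsDensity.zero⟩, MemLp.zero, fun _ _ => tendsto_const_nhds⟩

theorem energyDomain_add (hu : u ∈ energyDomain ν) (hv : v ∈ energyDomain ν) :
    u + v ∈ energyDomain ν := by
  obtain ⟨⟨H, hH⟩, hu2, hu3⟩ := hu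
  obtain ⟨⟨H', hH'⟩, hv2, hv3⟩ := hv
  exact ⟨⟨_, hH.add hH'⟩, hu2.add hv2, fun j hj => by
    have h := (hu3 j hj).add (hv3 j hj)
    rwa [add_zero] at h⟩

theorem energyDomain_smul (c : ℝ) (hu : u ∈ energyDomain ν) : c • u ∈ energyDomain ν := by
  obtain ⟨⟨H, hH⟩, hu2, hu3⟩ := hu
  exact ⟨⟨_, hH.smul c⟩, hu2.const_smul c, fun j hj => by
    have h := (hu3 j hj).const_smul c
    rwa [smul_zero] at h⟩

theorem energyDomain_sub (hu : u ∈ energyDomain ν) (hv : v ∈ energyDomain ν) :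
    u - v ∈ energyDomain ν := by
  have h := energyDomain_add hu (energyDomain_smul (-1) hv)
  simpa only [neg_smul, one_smul, ← sub_eq_add_neg] using h

theorem energyDomain_comp {φ : ℝ → ℝ} (hφ : LipschitzWith 1 φ) (hφ0 : φ 0 = 0)
    (hu : u ∈ energyDomain ν) : φ ∘ u ∈ energyDomain ν := by
  obtain ⟨⟨H, hH⟩, hu2, hu3⟩ := hu
  obtain ⟨H', hH', -⟩ := hH.exists_comp hφ
  refine ⟨⟨H', hH'⟩, hφ.comp_memLp hφ0 hu2, fun j hj => ?_⟩
  have h := (hφ.continuous.tendsto 0).comp (hu3 j hj)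
  rwa [hφ0] at h

end Domain

/-- Every point of `K` has an order interval of `K` as a neighbourhood; at a least or greatest
element of `K` the interval ends there. -/
theorem exists_Icc_mem_nhds_subtype {K : Set ℝ} (y : K) : ∃ a b : K, Icc a b ∈ 𝓝 y := by
  have h1 : ∃ a : K, Ici a ∈ 𝓝 y := by
    by_cases h : ∃ a : K, a < y
    · obtain ⟨a, ha⟩ := h
      exact ⟨a, Ici_mem_nhds ha⟩
    · push Not at h
      exact ⟨y, by rw [show Ici y = univ from eq_univ_of_forall h]; exact univ_mem⟩
  have h2 : ∃ b : K, Iic b ∈ 𝓝 y := by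
    by_cases h : ∃ b : K, y < b
    · obtain ⟨b, hb⟩ := h
      exact ⟨b, Iic_mem_nhds hb⟩
    · push Not at h
      exact ⟨y, by rw [show Iic y = univ from eq_univ_of_forall h]; exact univ_mem⟩
  obtain ⟨a, ha⟩ := h1
  obtain ⟨b, hb⟩ := h2
  exact ⟨a, b, inter_mem ha hb⟩

section CompactIcc

variable {K : Set ℝ} [CompactIccSpace K]

/-- A subset of the line that has compact traces on the intervals between its points is locally
compact. -/
theorem locallyCompactSpace_of_compactIcc : LocallyCompactSpace K := by
  have : WeaklyLocallyCompactSpace K := ⟨fun y => by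
    obtain ⟨a, b, h⟩ := exists_Icc_mem_nhds_subtype y
    exact ⟨Icc a b, isCompact_Icc, h⟩⟩
  infer_instance

variable {ν : Measure K} [IsFiniteMeasureOnCompacts ν] [ν.IsOpenPosMeasure]

/-- Point evaluations are bounded for the `E₁`-norm: the value at `y₀` is compared with the mean
of `u²` over a neighbourhood, on which `u` oscillates by at most a multiple of `‖H‖`. -/
theorem exists_sq_le_energyOne (ν : Measure K) [IsFiniteMeasureOnCompacts ν] [ν.IsOpenPosMeasure]
    (y₀ : K) : ∃ C : ℝ, 0 < C ∧ ∀ u H, IsDensity u H → MemLp u 2 ν →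
      u y₀ ^ 2 ≤ C * (∫ y, u y ^ 2 ∂ν + ‖H‖ ^ 2) := by
  obtain ⟨a, b, hN⟩ := exists_Icc_mem_nhds_subtype y₀
  have hy₀ : y₀ ∈ Icc a b := mem_of_mem_nhds hN
  have hNlt : ν (Icc a b) < ∞ := isCompact_Icc.measure_lt_top
  have hm : 0 < ν.real (Icc a b) :=
    ENNReal.toReal_pos (Measure.measure_pos_of_mem_nhds ν hN).ne' hNlt.ne
  have hab : (a : ℝ) ≤ b := hy₀.1.trans hy₀.2
  set m := ν.real (Icc a b) with hmdef
  have hL : 0 ≤ (b : ℝ) - a := by linarith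
  refine ⟨2 / m + 2 * (b - a), by positivity, fun u H hu hu2 => ?_⟩
  have h1 : ∀ y ∈ Icc a b, u y₀ ^ 2 - 2 * (b - a) * ‖H‖ ^ 2 ≤ 2 * u y ^ 2 := by
    intro y hy
    have h2 := hu.sq_sub_le y y₀
    have h3 : |(y₀ : ℝ) - y| ≤ b - a := by
      rw [abs_le]; constructor <;> linarith [Subtype.coe_le_coe.2 hy.1, Subtype.coe_le_coe.2 hy.2,
        Subtype.coe_le_coe.2 hy₀.1, Subtype.coe_le_coe.2 hy₀.2]
    have h4 : |(y₀ : ℝ) - y| * ‖H‖ ^ 2 ≤ (b - a) * ‖H‖ ^ 2 := by gcongr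
    nlinarith [sq_nonneg (u y₀ - 2 * u y)]
  have hint : Integrable (fun y => u y ^ 2) ν := hu2.integrable_sq
  have h2 : m * (u y₀ ^ 2 - 2 * (b - a) * ‖H‖ ^ 2) ≤ 2 * ∫ y, u y ^ 2 ∂ν := by
    calc m * (u y₀ ^ 2 - 2 * (b - a) * ‖H‖ ^ 2)
        = ∫ y in Icc a b, (u y₀ ^ 2 - 2 * (b - a) * ‖H‖ ^ 2) ∂ν := by
          rw [setIntegral_const, smul_eq_mul]
      _ ≤ ∫ y in Icc a b, 2 * u y ^ 2 ∂ν :=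
          setIntegral_mono_on (integrableOn_const hNlt.ne) (hint.const_mul 2).integrableOn
            measurableSet_Icc h1
      _ = 2 * ∫ y in Icc a b, u y ^ 2 ∂ν := integral_const_mul _ _
      _ ≤ 2 * ∫ y, u y ^ 2 ∂ν := by
          gcongr
          · exact Eventually.of_forall fun y => sq_nonneg _
          · exact Measure.restrict_le_self
  have h3 : 0 ≤ ∫ y, u y ^ 2 ∂ν := integral_nonneg fun y => sq_nonneg _
  have h4 : u y₀ ^ 2 ≤ 2 * (b - a) * ‖H‖ ^ 2 + 2 / m * ∫ y, u y ^ 2 ∂ν := by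
    have : u y₀ ^ 2 - 2 * (b - a) * ‖H‖ ^ 2 ≤ (2 * ∫ y, u y ^ 2 ∂ν) / m := by
      rw [le_div_iff₀ hm, mul_comm]; exact h2
    rw [div_mul_eq_mul_div]; linarith
  have h5 : 0 ≤ 2 / m * ‖H‖ ^ 2 := by positivity
  have h6 : 0 ≤ 2 * (b - a) * ∫ y, u y ^ 2 ∂ν := by positivity
  nlinarith

end CompactIcc

namespace IsEnergyForm

variable {K : Set ℝ} {ν : Measure K} {a : L2Form ν}

theorem energyOne_eq (ha : IsEnergyForm a) {U : Lp ℝ 2 ν} {u : K → ℝ} {H : LineL2}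
    (hu : u ∈ energyDomain ν) (hU : U =ᵐ[ν] u) (hH : IsDensity u H) :
    a.energyOne U = (1 / 2 : ℝ) * ‖H‖ ^ 2 + ‖U‖ ^ 2 := by
  rw [L2Form.energyOne, ha.form_eq U U u u H H hu hu hU hU hH hH, real_inner_self_eq_norm_sq,
    real_inner_self_eq_norm_sq]

variable [CompactIccSpace K] [IsFiniteMeasureOnCompacts ν] [ν.IsOpenPosMeasure]

/-- Closedness. For an `E₁`-Cauchy sequence the densities converge in `L²(ℝ)` and the functions
converge pointwise, since point evaluations are bounded for the `E₁`-norm; the pointwise limit has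
the limit of the densities as its density and represents the limit in `L²(ν)`. -/
theorem closed (ha : IsEnergyForm a) (U : ℕ → Lp ℝ 2 ν) (hU : ∀ n, U n ∈ a.dom)
    (hC : ∀ ε > 0, ∃ N, ∀ p ≥ N, ∀ q ≥ N, a.energyOne (U p - U q) < ε) :
    ∃ V ∈ a.dom, Tendsto (fun n => a.energyOne (U n - V)) atTop (𝓝 0) := by
  choose u hu hUu using fun n => (ha.mem_dom_iff _).1 (hU n)
  choose H hH using fun n => (hu n).1
  have hsub : ∀ p q, (U p - U q : Lp ℝ 2 ν) =ᵐ[ν] u p - u q := fun p q =>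
    (Lp.coeFn_sub _ _).trans ((hUu p).sub (hUu q))
  have hE : ∀ p q, a.energyOne (U p - U q) = (1 / 2 : ℝ) * ‖H p - H q‖ ^ 2 + ‖U p - U q‖ ^ 2 :=
    fun p q => ha.energyOne_eq (energyDomain_sub (hu p) (hu q)) (hsub p q) ((hH p).sub (hH q))
  have hHc : CauchySeq H := by
    refine Metric.cauchySeq_iff.2 fun ε hε => ?_
    obtain ⟨N, hN⟩ := hC (ε ^ 2 / 2) (by positivity)
    refine ⟨N, fun p hp q hq => ?_⟩
    have h := hN p hp q hq
    rw [hE] at h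
    rw [dist_eq_norm]
    refine lt_of_pow_lt_pow_left₀ 2 hε.le ?_
    nlinarith [sq_nonneg ‖U p - U q‖]
  have hUc : CauchySeq U := by
    refine Metric.cauchySeq_iff.2 fun ε hε => ?_
    obtain ⟨N, hN⟩ := hC (ε ^ 2) (by positivity)
    refine ⟨N, fun p hp q hq => ?_⟩
    have h := hN p hp q hq
    rw [hE] at h
    rw [dist_eq_norm]
    refine lt_of_pow_lt_pow_left₀ 2 hε.le ?_
    nlinarith [sq_nonneg ‖H p - H q‖]
  obtain ⟨H', hH'⟩ := cauchySeq_tendsto_of_complete hHc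
  obtain ⟨V, hV⟩ := cauchySeq_tendsto_of_complete hUc
  -- Pointwise convergence, by the bound on point evaluations.
  have hpt : ∀ y, CauchySeq fun n => u n y := by
    intro y
    obtain ⟨C, hC0, hCy⟩ := exists_sq_le_energyOne ν y
    refine Metric.cauchySeq_iff.2 fun ε hε => ?_
    obtain ⟨N, hN⟩ := hC (ε ^ 2 / (2 * C)) (by positivity)
    refine ⟨N, fun p hp q hq => ?_⟩
    have h := hN p hp q hq
    rw [hE] at h
    have hmem := (energyDomain_sub (hu p) (hu q)).2.1
    have h1 := hCy _ _ ((hH p).sub (hH q)) hmem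
    have h2 : ‖U p - U q‖ ^ 2 = ∫ z, (u p - u q) z ^ 2 ∂ν := by
      rw [← norm_sq_toLp hmem]
      congr 2
      exact Lp.ext ((hsub p q).trans hmem.coeFn_toLp.symm)
    rw [← h2] at h1
    rw [lt_div_iff₀ (by positivity)] at h
    rw [Real.dist_eq]
    refine lt_of_pow_lt_pow_left₀ 2 hε.le ?_
    rw [sq_abs]
    refine lt_of_le_of_lt h1 (lt_of_le_of_lt ?_ h)
    nlinarith [sq_nonneg ‖U p - U q‖, sq_nonneg ‖H p - H q‖]
  choose v hv using fun y => cauchySeq_tendsto_of_complete (hpt y)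
  have hvH : IsDensity v H' :=
    ⟨(isClosed_densitySpace K).mem_of_tendsto hH' (Eventually.of_forall fun n => (hH n).mem),
      fun x y hxy => tendsto_nhds_unique ((hv y).sub (hv x)) <| by
        have h := tendsto_integral_of_tendsto hH' x y
        simpa only [← (hH _).sub_eq x y hxy] using h⟩
  -- The limit in `L²(ν)` agrees with the pointwise limit, along an a.e. convergent subsequence.
  have hVv : V =ᵐ[ν] v := by
    have hall : ∀ᵐ y ∂ν, ∀ n, U n y = u n y := ae_all_iff.2 hUu
    obtain ⟨ns, hmono, hns⟩ := (tendstoInMeasure_of_tendsto_Lp hV).exists_seq_tendsto_ae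
    filter_upwards [hns, hall] with y h1 h2
    refine tendsto_nhds_unique h1 ?_
    simp only [h2]
    exact (hv y).comp hmono.tendsto_atTop
  have hvdom : v ∈ energyDomain ν := by
    refine ⟨⟨H', hvH⟩, (memLp_congr_ae hVv).1 (Lp.memLp V), fun j hj => ?_⟩
    have := comap_val_neBot hj.1
    obtain ⟨x⟩ : Nonempty K := by
      by_contra hempty
      rw [not_nonempty_iff, isEmpty_coe_sort] at hempty
      simp [hempty] at hj
    -- The limit of `u n` at `j`, which vanishes, is a continuous function of `u n x` and `H n`.
    have h1 : ∀ n, u n x + ∫ y in (x : ℝ)..j, H n y = 0 := fun n =>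
      tendsto_nhds_unique ((hH n).tendsto x j) ((hu n).2.2 j hj)
    have h2 : v x + ∫ y in (x : ℝ)..j, H' y = 0 := by
      have h := (hv x).add (tendsto_integral_of_tendsto hH' x j)
      simp only [h1] at h
      exact tendsto_nhds_unique h tendsto_const_nhds
    rw [← h2]
    exact hvH.tendsto x j
  refine ⟨V, (ha.mem_dom_iff V).2 ⟨v, hvdom, hVv⟩, ?_⟩
  have hlim : ∀ n, a.energyOne (U n - V) = (1 / 2 : ℝ) * ‖H n - H'‖ ^ 2 + ‖U n - V‖ ^ 2 := fun n =>
    ha.energyOne_eq (energyDomain_sub (hu n) hvdom)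
      ((Lp.coeFn_sub _ _).trans ((hUu n).sub hVv)) ((hH n).sub hvH)
  simp only [hlim]
  have h1 := (tendsto_iff_norm_sub_tendsto_zero.1 hH').pow 2
  have h2 := (tendsto_iff_norm_sub_tendsto_zero.1 hV).pow 2
  simpa using (h1.const_mul (1 / 2 : ℝ)).add h2

theorem lipschitzWith_unitClip : LipschitzWith 1 (fun t : ℝ => min (max 0 t) 1) := by
  have h1 : LipschitzWith 1 (fun t : ℝ => max 0 t) := by
    simpa using LipschitzWith.const_max LipschitzWith.id (0 : ℝ)
  simpa using h1.min_const 1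

theorem isDirichletWide (ha : IsEnergyForm a) : a.IsDirichletWide where
  zero_mem := (ha.mem_dom_iff 0).2 ⟨0, energyDomain_zero, Lp.coeFn_zero _ _ _⟩
  add_mem U hU V hV := by
    obtain ⟨u, hu, hUu⟩ := (ha.mem_dom_iff U).1 hU
    obtain ⟨v, hv, hVv⟩ := (ha.mem_dom_iff V).1 hV
    exact (ha.mem_dom_iff _).2 ⟨u + v, energyDomain_add hu hv,
      (Lp.coeFn_add _ _).trans (hUu.add hVv)⟩
  smul_mem c U hU := by
    obtain ⟨u, hu, hUu⟩ := (ha.mem_dom_iff U).1 hU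
    exact (ha.mem_dom_iff _).2 ⟨c • u, energyDomain_smul c hu,
      (Lp.coeFn_smul _ _).trans (hUu.const_smul c)⟩
  add_left U hU V hV W hW := by
    obtain ⟨u, hu, hUu⟩ := (ha.mem_dom_iff U).1 hU
    obtain ⟨v, hv, hVv⟩ := (ha.mem_dom_iff V).1 hV
    obtain ⟨w, hw, hWw⟩ := (ha.mem_dom_iff W).1 hW
    obtain ⟨F, hF⟩ := hu.1
    obtain ⟨G, hG⟩ := hv.1
    obtain ⟨H, hH⟩ := hw.1
    rw [ha.form_eq (U + V) W (u + v) w _ _ (energyDomain_add hu hv) hw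
      ((Lp.coeFn_add _ _).trans (hUu.add hVv)) hWw (hF.add hG) hH,
      ha.form_eq U W u w _ _ hu hw hUu hWw hF hH, ha.form_eq V W v w _ _ hv hw hVv hWw hG hH,
      inner_add_left]
    ring
  smul_left c U hU V hV := by
    obtain ⟨u, hu, hUu⟩ := (ha.mem_dom_iff U).1 hU
    obtain ⟨v, hv, hVv⟩ := (ha.mem_dom_iff V).1 hV
    obtain ⟨F, hF⟩ := hu.1
    obtain ⟨G, hG⟩ := hv.1
    rw [ha.form_eq (c • U) V (c • u) v _ _ (energyDomain_smul c hu) hv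
      ((Lp.coeFn_smul _ _).trans (hUu.const_smul c)) hVv (hF.smul c) hG,
      ha.form_eq U V u v _ _ hu hv hUu hVv hF hG, real_inner_smul_left]
    ring
  symm U hU V hV := by
    obtain ⟨u, hu, hUu⟩ := (ha.mem_dom_iff U).1 hU
    obtain ⟨v, hv, hVv⟩ := (ha.mem_dom_iff V).1 hV
    obtain ⟨F, hF⟩ := hu.1
    obtain ⟨G, hG⟩ := hv.1
    rw [ha.form_eq U V u v _ _ hu hv hUu hVv hF hG, ha.form_eq V U v u _ _ hv hu hVv hUu hG hF,
      real_inner_comm]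
  nonneg U hU := by
    obtain ⟨u, hu, hUu⟩ := (ha.mem_dom_iff U).1 hU
    obtain ⟨F, hF⟩ := hu.1
    rw [ha.form_eq U U u u _ _ hu hu hUu hUu hF hF, real_inner_self_eq_norm_sq]
    positivity
  closed := ha.closed
  markov U hU := by
    obtain ⟨u, hu, hUu⟩ := (ha.mem_dom_iff U).1 hU
    obtain ⟨F, hF⟩ := hu.1
    have hmem := energyDomain_comp lipschitzWith_unitClip (by simp) hu
    obtain ⟨F', hF', hle⟩ := hF.exists_comp lipschitzWith_unitClip
    refine ⟨hmem.2.1.toLp _, (ha.mem_dom_iff _).2 ⟨_, hmem, hmem.2.1.coeFn_toLp⟩, ?_, ?_⟩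
    · filter_upwards [hmem.2.1.coeFn_toLp, hUu] with y h1 h2
      rw [h1, h2]; rfl
    · rw [ha.form_eq _ _ _ _ _ _ hmem hmem hmem.2.1.coeFn_toLp hmem.2.1.coeFn_toLp hF' hF',
        ha.form_eq U U u u _ _ hu hu hUu hUu hF hF, real_inner_self_eq_norm_sq,
        real_inner_self_eq_norm_sq]
      linarith

end IsEnergyForm

/-! ### Cutoff functions and density of the domain -/

theorem memLp_of_bounded_of_compact {f : ℝ → ℝ} (hf : AEStronglyMeasurable f volume) {S : Set ℝ}
    (hS : IsCompact S) {B : ℝ} (hB : ∀ y ∈ S, |f y| ≤ B) (h0 : ∀ y ∉ S, f y = 0) :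
    MemLp f 2 volume := by
  refine (memLp_indicator_const 2 hS.measurableSet B (Or.inr hS.measure_lt_top.ne)).of_le hf
    (Eventually.of_forall fun y => ?_)
  by_cases hy : y ∈ S
  · rw [indicator_of_mem hy, Real.norm_eq_abs, Real.norm_eq_abs]
    exact (hB y hy).trans (le_abs_self B)
  · rw [h0 y hy]; simp

/-- The product of a compactly supported Lipschitz function and a continuously differentiable
function has a density. -/
theorem exists_isDensity_of_lipschitz {K : Set ℝ} {W p : ℝ → ℝ} {C : NNReal}
    (hW : LipschitzWith C W) (hWc : HasCompactSupport W) (hp : ContDiff ℝ 1 p) :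
    ∃ H, IsDensity (fun y : K => W y * p y) H := by
  obtain ⟨B, hB⟩ := hWc.exists_bound_of_continuousOn hp.continuous.continuousOn
  obtain ⟨B', hB'⟩ := hWc.exists_bound_of_continuousOn (hp.continuous_deriv le_rfl).continuousOn
  obtain ⟨B'', hB''⟩ := hWc.exists_bound_of_continuousOn hW.continuous.continuousOn
  have hF : MemLp (fun y => deriv W y * p y + W y * deriv p y) 2 volume := by
    refine memLp_of_bounded_of_compact (S := tsupport W) (B := C * B + B'' * B') ?_ hWc ?_ ?_
    · exact ((aestronglyMeasurable_deriv _ _).mul hp.continuous.aestronglyMeasurable).add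
        (hW.continuous.aestronglyMeasurable.mul
          (hp.continuous_deriv le_rfl).aestronglyMeasurable)
    · intro y hy
      refine (abs_add_le _ _).trans ?_
      rw [abs_mul, abs_mul]
      have h1 : |deriv W y| ≤ C := norm_deriv_le_of_lipschitz hW
      have h2 := hB y hy
      have h3 := hB' y hy
      have h4 := hB'' y hy
      rw [Real.norm_eq_abs] at h2 h3 h4
      have h5 : 0 ≤ B'' := (abs_nonneg _).trans h4
      gcongr
    · intro y hy
      have h1 : deriv W y = 0 := by
        by_contra h
        exact hy (support_deriv_subset h)
      rw [h1, image_eq_zero_of_notMem_tsupport hy]; simp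
  obtain ⟨H, hH, -⟩ := exists_isDensity_of_deriv (K := K) (u := fun y : K => W y * p y)
    (G := fun y => W y * p y) (fun y => rfl)
    (fun a b => ((hW.lipschitzOnWith).absolutelyContinuousOnInterval).fun_mul
      (hp.contDiffOn.absolutelyContinuousOnInterval)) hF (by
      filter_upwards [hW.ae_differentiableAt] with y h2
      exact (h2.hasDerivAt.mul ((hp.differentiable one_ne_zero) y).hasDerivAt).deriv)
  exact ⟨H, hH⟩

/-- A function of finite energy that vanishes off a compact subset `N` of `K` belongs to the domain.
As `N` is closed in the line, the function vanishes near the points outside `K`. -/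
theorem mem_energyDomain_of_compact {K : Set ℝ} {ν : Measure K} [IsFiniteMeasureOnCompacts ν]
    {ψ : K → ℝ}
    (hψ : ∃ H, IsDensity ψ H) {N : Set K} (hN : IsCompact N) (h0 : ∀ y ∉ N, ψ y = 0) :
    ψ ∈ energyDomain ν := by
  obtain ⟨H, hH⟩ := hψ
  refine ⟨⟨H, hH⟩, hH.continuous.memLp_of_hasCompactSupport (HasCompactSupport.intro hN h0),
    fun j hj => ?_⟩
  have hcl : IsClosed (Subtype.val '' N : Set ℝ) := (hN.image continuous_subtype_val).isClosed
  have hjN : j ∉ (Subtype.val '' N : Set ℝ) := by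
    rintro ⟨y, -, rfl⟩
    exact hj.2 y.2
  refine tendsto_const_nhds.congr' ?_
  filter_upwards [preimage_mem_comap (hcl.isOpen_compl.mem_nhds hjN)] with y hy
  exact (h0 y fun hyN => hy (mem_image_of_mem _ hyN)).symm

section Cutoff

variable {K : Set ℝ} [CompactIccSpace K]

/-- Lipschitz cutoff functions around a compact subset of `K`. -/
theorem exists_cutoff {N : Set K} (hN : IsCompact N) : ∃ N' : Set K, IsCompact N' ∧
    ∃ (W : ℝ → ℝ) (C : NNReal), LipschitzWith C W ∧ HasCompactSupport W ∧ (∀ y, 0 ≤ W y) ∧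
      (∀ y, W y ≤ 1) ∧ (∀ y ∈ N, W y = 1) ∧ ∀ y : K, y ∉ N' → W y = 0 := by
  have := locallyCompactSpace_of_compactIcc (K := K)
  obtain ⟨N', hN', hsub⟩ := exists_compact_superset hN
  obtain ⟨O, hO, hON⟩ := isOpen_induced_iff.1 (isOpen_interior (s := N'))
  have hN0 : IsCompact (Subtype.val '' N : Set ℝ) := hN.image continuous_subtype_val
  obtain ⟨δ, hδ, hth⟩ := hN0.exists_thickening_subset_open hO (by
    rintro _ ⟨y, hy, rfl⟩
    have h := hsub hy
    rw [← hON] at h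
    exact h)
  refine ⟨N', hN', fun y => thickenedIndicator hδ (Subtype.val '' N) y, _,
    lipschitzWith_thickenedIndicator hδ _, ?_, fun y => NNReal.coe_nonneg _, fun y => ?_,
    fun y hy => ?_, fun y hy => ?_⟩
  · refine HasCompactSupport.intro (hN0.cthickening (r := δ)) fun y hy => ?_
    rw [thickenedIndicator_zero hδ _ fun h => hy (Metric.thickening_subset_cthickening _ _ h)]
    simp
  · exact_mod_cast thickenedIndicator_le_one hδ _ y
  · simp only
    rw [thickenedIndicator_one hδ _ (mem_image_of_mem _ hy)]; simp
  · simp only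
    rw [thickenedIndicator_zero hδ]
    · simp
    · intro h
      refine hy (interior_subset (s := N') ?_)
      rw [← hON]
      exact hth h

/-- Functions of finite energy approximate compactly supported continuous functions uniformly, with
supports in a fixed compact set: a continuous extension to the line is approximated by polynomials,
and these are multiplied by a cutoff function. -/
theorem exists_uniform_approx {φ : K → ℝ} (hφ : Continuous φ) (hφc : HasCompactSupport φ) :
    ∃ N : Set K, IsCompact N ∧ ∀ ε > 0, ∃ ψ : K → ℝ, (∃ H, IsDensity ψ H) ∧
      (∀ y ∉ N, ψ y = 0) ∧ ∀ y, |φ y - ψ y| < ε := by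
  obtain ⟨N, hN, W, C, hW, hWc, hW0, hW1, hWN, hWN'⟩ := exists_cutoff hφc
  refine ⟨N, hN, fun ε hε => ?_⟩
  have hN0 : IsCompact (Subtype.val '' N : Set ℝ) := hN.image continuous_subtype_val
  have he : IsClosedEmbedding (fun y : N => ((y : K) : ℝ)) := by
    have : CompactSpace N := isCompact_iff_compactSpace.1 hN
    exact (continuous_subtype_val.comp continuous_subtype_val).isClosedEmbedding
      (Subtype.val_injective.comp Subtype.val_injective)
  obtain ⟨Φ, hΦ⟩ := ContinuousMap.exists_extension he
    ⟨fun y : N => φ y, hφ.comp continuous_subtype_val⟩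
  obtain ⟨R, hR⟩ := hN0.isBounded.subset_closedBall 0
  obtain ⟨p, hp⟩ := exists_polynomial_near_of_continuousOn (-R) R Φ Φ.continuous.continuousOn ε hε
  obtain ⟨H, hH⟩ := exists_isDensity_of_lipschitz (K := K) hW hWc
    (p := fun y => p.eval y) (by simpa using p.contDiff_aeval (𝕜 := ℝ) (n := 1))
  refine ⟨_, ⟨H, hH⟩, fun y hy => by simp [hWN' y hy], fun y => ?_⟩
  by_cases hy : y ∈ N
  · have h1 : Φ y = φ y := DFunLike.congr_fun hΦ ⟨y, hy⟩
    have h2 : (y : ℝ) ∈ Icc (-R) R := by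
      have h := hR (mem_image_of_mem _ hy)
      simpa [Real.closedBall_eq_Icc] using h
    have h3 : φ y = W y * φ y := by
      by_cases hys : y ∈ tsupport φ
      · rw [hWN y hys, one_mul]
      · rw [image_eq_zero_of_notMem_tsupport hys, mul_zero]
    have h4 := hp y h2
    rw [h1, abs_sub_comm] at h4
    calc |φ y - W y * p.eval (y : ℝ)| = W y * |φ y - p.eval (y : ℝ)| := by
          nth_rw 1 [h3]
          rw [← mul_sub, abs_mul, abs_of_nonneg (hW0 y)]
      _ ≤ 1 * |φ y - p.eval (y : ℝ)| := by
          gcongr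
          exact hW1 y
      _ < ε := by rwa [one_mul]
  · have h1 : φ y = 0 := by
      by_contra hne
      have h2 := hWN y (subset_tsupport φ hne)
      rw [hWN' y hy] at h2
      exact zero_ne_one h2
    simp [h1, hWN' y hy, hε]

/-- The domain is dense in `L²(ν)`, because compactly supported continuous functions are, and they
are uniform limits of elements of the domain with supports in a common compact set. -/
theorem IsEnergyForm.dense {ν : Measure K} [IsFiniteMeasureOnCompacts ν] {a : L2Form ν}
    (ha : IsEnergyForm a) : Dense a.dom := by
  have := locallyCompactSpace_of_compactIcc (K := K)
  intro U
  rw [Metric.mem_closure_iff]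
  intro r hr
  set ε : ℝ≥0∞ := ENNReal.ofReal r with hεr
  have hε : 0 < ε := ENNReal.ofReal_pos.2 hr
  obtain ⟨φ, hφc, hUφ, hφ, hφ2⟩ := (Lp.memLp U).exists_hasCompactSupport_eLpNorm_sub_le
    (by norm_num) (ENNReal.half_pos hε.ne').ne'
  obtain ⟨N, hN, hψ⟩ := exists_uniform_approx hφ hφc
  have hM : (ν N) ^ (1 / (2 : ℝ≥0∞).toReal) ≠ ∞ :=
    (ENNReal.rpow_lt_top_of_nonneg (by positivity) hN.measure_lt_top.ne).ne
  obtain ⟨δ, hδ, hδM⟩ := ENNReal.exists_nnreal_pos_mul_lt hM (ENNReal.half_pos hε.ne').ne'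
  obtain ⟨ψ, hψd, hψ0, hψφ⟩ := hψ δ hδ
  have hdom := mem_energyDomain_of_compact (ν := ν) hψd hN hψ0
  -- Off `N` all approximations vanish, hence so does `φ`.
  have hφ0 : ∀ y ∉ N, φ y = 0 := by
    intro y hy
    by_contra hne
    obtain ⟨ψ', -, h0, h1⟩ := hψ |φ y| (abs_pos.2 hne)
    have h2 := h1 y
    rw [h0 y hy, sub_zero] at h2
    exact lt_irrefl _ h2
  refine ⟨hdom.2.1.toLp ψ, (ha.mem_dom_iff _).2 ⟨ψ, hdom, hdom.2.1.coeFn_toLp⟩, ?_⟩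
  have h1 : eLpNorm (φ - ψ) 2 ν < ε / 2 := by
    refine lt_of_le_of_lt ?_ hδM
    have h2 : eLpNorm (φ - ψ) 2 ν ≤ eLpNorm (N.indicator fun _ => (δ : ℝ)) 2 ν := by
      refine eLpNorm_mono fun y => ?_
      by_cases hy : y ∈ N
      · rw [indicator_of_mem hy]
        simpa using (hψφ y).le
      · simp [hφ0 y hy, hψ0 y hy]
    refine h2.trans ((eLpNorm_indicator_const_le _ _).trans (le_of_eq ?_))
    congr 1
    simp
  rw [← edist_lt_ofReal, Lp.edist_def]
  have h3 : eLpNorm (⇑U - ⇑(hdom.2.1.toLp ψ)) 2 ν = eLpNorm ((⇑U - φ) + (φ - ψ)) 2 ν := by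
    refine eLpNorm_congr_ae ?_
    filter_upwards [hdom.2.1.coeFn_toLp] with y hy
    simp [hy]
  rw [h3]
  refine (eLpNorm_add_le ((Lp.memLp U).1.sub hφ2.1) (hφ2.1.sub hdom.2.1.1) (by norm_num)).trans_lt ?_
  rw [← hεr, ← ENNReal.add_halves ε]
  exact ENNReal.add_lt_add_of_le_of_lt (hUφ.trans_lt (ENNReal.half_lt_self hε.ne'
    ENNReal.ofReal_ne_top |>.trans ENNReal.ofReal_lt_top)).ne hUφ h1

end Cutoff

/-! ### Cutoffs near the missing ends and regularity -/

/-- Elements of the density space vanish on every set that misses all intervals between points of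
`K`, being orthogonal to their own restriction to such a set. -/
theorem densitySpace_ae_eq_zero {K : Set ℝ} {H : LineL2} (hH : H ∈ densitySpace K) {S : Set ℝ}
    (hS : MeasurableSet S) (hKS : ∀ a ∈ K, ∀ b ∈ K, Disjoint (Ioc a b) S) :
    ∀ᵐ y, y ∈ S → H y = 0 := by
  have hm : MemLp (S.indicator H) 2 volume := (Lp.memLp H).indicator hS
  set F : LineL2 := hm.toLp _ with hF
  have hFae : F =ᵐ[volume] S.indicator H := hm.coeFn_toLp
  have h1 : densitySpace K ≤ (Submodule.span ℝ {F})ᗮ := by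
    refine Submodule.topologicalClosure_minimal _ ?_ (Submodule.isClosed_orthogonal _)
    rw [Submodule.span_le]
    rintro _ ⟨a, ha, b, hb, hab, rfl⟩
    rw [SetLike.mem_coe, Submodule.mem_orthogonal_singleton_iff_inner_left, inner_stepL2 hab,
      intervalIntegral.integral_of_le hab]
    refine setIntegral_eq_zero_of_ae_eq_zero ?_
    filter_upwards [hFae] with y hy hyab
    rw [hy, indicator_of_notMem]
    exact fun hyS => (hKS a ha b hb).le_bot ⟨hyab, hyS⟩
  have h2 := h1 hH
  rw [Submodule.mem_orthogonal_singleton_iff_inner_left] at h2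
  have h3 : inner ℝ F F = inner ℝ H F := by
    rw [L2.inner_def, L2.inner_def]
    refine integral_congr_ae ?_
    filter_upwards [hFae] with y hy
    rw [hy]
    by_cases hyS : y ∈ S
    · rw [indicator_of_mem hyS]
    · rw [indicator_of_notMem hyS]; simp
  rw [h2, inner_self_eq_zero] at h3
  have h4 := Lp.coeFn_zero ℝ 2 (volume : Measure ℝ)
  rw [← h3] at h4
  filter_upwards [hFae, h4] with y hy h5 hyS
  rw [h5, indicator_of_mem hyS] at hy
  simpa using hy.symm

/-- The Cauchy–Schwarz inequality on an interval. -/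
theorem sq_intervalIntegral_le {H : ℝ → ℝ} (hH : MemLp H 2 volume) {a b : ℝ} (hab : a ≤ b) :
    (∫ y in a..b, H y) ^ 2 ≤ (b - a) * ∫ y in a..b, H y ^ 2 := by
  have hm : MemLp ((Ioc a b).indicator H) 2 volume := hH.indicator measurableSet_Ioc
  have h := sq_integral_le hab (hm.toLp _)
  rw [norm_sq_toLp hm] at h
  have h1 : ∫ y in a..b, (hm.toLp _) y = ∫ y in a..b, H y := by
    rw [intervalIntegral.integral_of_le hab, intervalIntegral.integral_of_le hab]
    refine setIntegral_congr_ae measurableSet_Ioc ?_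
    filter_upwards [hm.coeFn_toLp] with y hy hyab
    rw [hy, indicator_of_mem hyab]
  have h2 : ∫ y, (Ioc a b).indicator H y ^ 2 = ∫ y in a..b, H y ^ 2 := by
    rw [intervalIntegral.integral_of_le hab, ← integral_indicator measurableSet_Ioc]
    congr 1
    funext y
    by_cases hy : y ∈ Ioc a b <;> simp [hy]
  rwa [h1, h2] at h

/-- A ramp from `1` at `b` to `0` at `b'` multiplies `G` by a function with slope `1 / (b' - b)`.
If `G` has finite energy, the contribution of this slope to the energy of the product can be made
small by moving the ramp towards the end `r`. If `r` is finite, `G` has to vanish there: then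
`G²` is at most `r - b` times the energy of `G` on `(b, r)`, which tends to `0`. If `r` is
infinite, ramps of length `R` starting at distance `R` from a point far out are used, on which `G²`
is at most a small multiple of `R`. -/
theorem exists_ramp {H G : ℝ → ℝ} (hH : MemLp H 2 volume)
    (hG : ∀ a b : ℝ, ∫ y in a..b, H y = G b - G a) (hGc : Continuous G) {r : EReal}
    (hr : ∀ r' : ℝ, r = r' → G r' = 0) {y₀ : ℝ} (hy₀ : (y₀ : EReal) < r) {ε : ℝ} (hε : 0 < ε) :
    ∃ b b' : ℝ, y₀ ≤ b ∧ b < b' ∧ (b' : EReal) < r ∧ ∫ y in b..b', (G y / (b' - b)) ^ 2 < ε := by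
  have hsq : Integrable (fun y => H y ^ 2) volume := hH.integrable_sq
  have hmain : ∀ b b' M : ℝ, b < b' → (∀ y ∈ Icc b b', G y ^ 2 ≤ M) →
      ∫ y in b..b', (G y / (b' - b)) ^ 2 ≤ M / (b' - b) := by
    intro b b' M hbb' hM
    have hpos : 0 < b' - b := sub_pos.2 hbb'
    have h1 : ∫ y in b..b', (G y / (b' - b)) ^ 2 ≤ ∫ y in b..b', M / (b' - b) ^ 2 := by
      refine intervalIntegral.integral_mono_on hbb'.le
        ((hGc.div_const _).pow 2).continuousOn.intervalIntegrable
        intervalIntegrable_const fun y hy => ?_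
      rw [div_pow]
      gcongr
      exact hM y hy
    refine h1.trans (le_of_eq ?_)
    rw [intervalIntegral.integral_const, smul_eq_mul]
    field_simp
  induction r using EReal.rec with
  | bot => simp at hy₀
  | coe r =>
    have hr0 : G r = 0 := hr r rfl
    have hy₀' : y₀ < r := EReal.coe_lt_coe_iff.1 hy₀
    have hcont : Continuous fun y => ∫ t in y..r, H t ^ 2 := by
      simp only [intervalIntegral.integral_symm r]
      exact (intervalIntegral.continuous_primitive (fun a b => hsq.intervalIntegrable) r).neg
    have h0 : Tendsto (fun y => ∫ t in y..r, H t ^ 2) (𝓝[<] r) (𝓝 0) := by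
      have h := hcont.tendsto r
      rw [intervalIntegral.integral_same] at h
      exact h.mono_left nhdsWithin_le_nhds
    have hev : ∀ᶠ y in 𝓝[<] r, (∫ t in y..r, H t ^ 2) < ε / 2 ∧ y₀ < y ∧ y < r :=
      ((tendsto_order.1 h0).2 _ (by positivity)).and
        ((eventually_nhdsWithin_of_eventually_nhds (lt_mem_nhds hy₀')).and
          eventually_mem_nhdsWithin)
    obtain ⟨b, hb1, hb2, hb3⟩ := hev.exists
    refine ⟨b, (b + r) / 2, hb2.le, by linarith, EReal.coe_lt_coe_iff.2 (by linarith), ?_⟩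
    refine (hmain b ((b + r) / 2) ((r - b) * ∫ t in b..r, H t ^ 2) (by linarith) ?_).trans_lt ?_
    · intro y hy
      have hyr : y ≤ r := hy.2.trans (by linarith)
      have h1 := sq_intervalIntegral_le hH hyr
      rw [hG, hr0, zero_sub, neg_sq] at h1
      refine h1.trans ?_
      have h2 : ∫ t in y..r, H t ^ 2 ≤ ∫ t in b..r, H t ^ 2 := by
        refine intervalIntegral.integral_mono_interval hy.1 hyr le_rfl
          (Eventually.of_forall fun t => sq_nonneg _) hsq.intervalIntegrable
      have h3 : 0 ≤ ∫ t in y..r, H t ^ 2 :=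
        intervalIntegral.integral_nonneg hyr fun t _ => sq_nonneg _
      have := hy.1
      gcongr
    · rw [div_lt_iff₀ (by linarith)]
      nlinarith
  | top =>
    have h1 : Tendsto (fun y : ℝ => ∫ t in Ioi y, H t ^ 2) atTop (𝓝 0) := by
      have h1 := intervalIntegral_tendsto_integral_Ioi 0 hsq.integrableOn
        (tendsto_id (α := ℝ) (x := atTop))
      have h3 := (tendsto_const_nhds (x := ∫ t in Ioi (0:ℝ), H t ^ 2)).sub h1
      rw [sub_self] at h3
      refine h3.congr' ?_
      filter_upwards [eventually_ge_atTop 0] with y hy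
      simp only [id]
      rw [← intervalIntegral.integral_interval_add_Ioi (b := y) hsq.integrableOn
        hsq.integrableOn]
      ring
    obtain ⟨y₁, hy₁, hy₁'⟩ := (((tendsto_order.1 h1).2 (ε / 16) (by positivity)).and
      (eventually_ge_atTop y₀)).exists
    -- On the ramp `G² ≤ 2 G(y₁)² + 2 · 2R · ε / 16`, so that its energy is at most
    -- `2 G(y₁)² / R + ε / 4`.
    obtain ⟨R, hR0, hR⟩ : ∃ R > 0, 2 * G y₁ ^ 2 / R < ε / 2 :=
      ⟨4 * G y₁ ^ 2 / ε + 1, by positivity, by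
        rw [div_lt_iff₀ (by positivity)]
        field_simp
        nlinarith [sq_nonneg (G y₁)]⟩
    refine ⟨y₁ + R, y₁ + 2 * R, by linarith, by linarith, EReal.coe_lt_top _, ?_⟩
    refine (hmain _ _ (2 * G y₁ ^ 2 + 4 * R * (ε / 16)) (by linarith) ?_).trans_lt ?_
    · intro y hy
      have hy1 : y₁ ≤ y := by linarith [hy.1]
      have h2 := sq_intervalIntegral_le hH hy1
      rw [hG] at h2
      have h3 : ∫ t in y₁..y, H t ^ 2 ≤ ∫ t in Ioi y₁, H t ^ 2 := by
        rw [intervalIntegral.integral_of_le hy1]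
        exact setIntegral_mono_set hsq.integrableOn (Eventually.of_forall fun t => sq_nonneg _)
          (Eventually.of_forall fun t ht => ht.1)
      have h4 : 0 ≤ ∫ t in y₁..y, H t ^ 2 :=
        intervalIntegral.integral_nonneg hy1 fun t _ => sq_nonneg _
      have h5 : (y - y₁) * ∫ t in y₁..y, H t ^ 2 ≤ (2 * R) * (ε / 16) := by
        have := hy.2
        gcongr <;> linarith
      nlinarith [sq_nonneg (G y - 2 * G y₁)]
    · have h2 : y₁ + 2 * R - (y₁ + R) = R := by ring
      rw [h2, add_div]
      have h3 : 4 * R * (ε / 16) / R = ε / 4 := by field_simp; norm_num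
      rw [h3]; linarith

/-- The ramp which is `1` to the left of `b` and `0` to the right of `b'`. -/
theorem lipschitzWith_rampFun {b b' : ℝ} (h : b < b') :
    LipschitzWith (Real.toNNReal (b' - b)⁻¹) fun y : ℝ => max 0 (min 1 ((b' - y) / (b' - b))) := by
  have h1 : LipschitzWith (Real.toNNReal (b' - b)⁻¹) fun y : ℝ => (b' - y) / (b' - b) := by
    refine LipschitzWith.of_dist_le_mul fun x y => ?_
    have hp : 0 < b' - b := sub_pos.2 h
    rw [Real.dist_eq, Real.dist_eq, ← sub_div, abs_div, abs_of_pos hp, Real.coe_toNNReal _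
      (by positivity), div_eq_inv_mul]
    refine le_of_eq ?_
    congr 1
    rw [← abs_neg]; congr 1; ring
  exact (h1.const_min 1).const_max 0

theorem rampFun_eq_one {b b' y : ℝ} (h : b < b') (hy : y ≤ b) :
    max 0 (min 1 ((b' - y) / (b' - b))) = 1 := by
  rw [min_eq_left ((one_le_div (sub_pos.2 h)).2 (by linarith)), max_eq_right zero_le_one]

theorem rampFun_eq_zero {b b' y : ℝ} (h : b < b') (hy : b' ≤ y) :
    max 0 (min 1 ((b' - y) / (b' - b))) = 0 := by
  rw [max_eq_left]
  exact (min_le_right _ _).trans (div_nonpos_of_nonpos_of_nonneg (by linarith) (by linarith))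

/-- The derivative of the ramp is at most `1 / (b' - b)` in modulus and vanishes off `[b, b']`. -/
theorem memLp_deriv_rampFun {G : ℝ → ℝ} (hGc : Continuous G) {b b' : ℝ} (h : b < b') :
    MemLp (fun y => deriv (fun y : ℝ => max 0 (min 1 ((b' - y) / (b' - b)))) y * G y) 2 volume ∧
    ∫ y, (deriv (fun y : ℝ => max 0 (min 1 ((b' - y) / (b' - b)))) y * G y) ^ 2 ≤
      ∫ y in b..b', (G y / (b' - b)) ^ 2 := by
  set W : ℝ → ℝ := fun y => max 0 (min 1 ((b' - y) / (b' - b))) with hW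
  have hp : 0 < b' - b := sub_pos.2 h
  have hb : ∀ y, |deriv W y| ≤ (b' - b)⁻¹ := fun y => by
    have h1 := norm_deriv_le_of_lipschitz (x₀ := y) (lipschitzWith_rampFun h)
    rwa [Real.coe_toNNReal _ (by positivity)] at h1
  have h0 : ∀ y, y ∉ Icc b b' → deriv W y = 0 := by
    intro y hy
    rw [mem_Icc, not_and_or, not_le, not_le] at hy
    rcases hy with hy | hy
    · have : W =ᶠ[𝓝 y] fun _ => 1 := by
        filter_upwards [gt_mem_nhds hy] with z hz using rampFun_eq_one h hz.le
      rw [this.deriv_eq, deriv_const]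
    · have : W =ᶠ[𝓝 y] fun _ => 0 := by
        filter_upwards [lt_mem_nhds hy] with z hz using rampFun_eq_zero h hz.le
      rw [this.deriv_eq, deriv_const]
  obtain ⟨B, hB⟩ := isCompact_Icc.exists_bound_of_continuousOn (s := Icc b b') hGc.continuousOn
  have hm : MemLp (fun y => deriv W y * G y) 2 volume := by
    refine memLp_of_bounded_of_compact (S := Icc b b') (B := (b' - b)⁻¹ * B)
      ((aestronglyMeasurable_deriv _ _).mul hGc.aestronglyMeasurable) isCompact_Icc ?_ ?_
    · intro y hy
      rw [abs_mul]
      have := hb y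
      have := hB y hy
      rw [Real.norm_eq_abs] at this
      gcongr
    · intro y hy
      rw [h0 y hy, zero_mul]
  refine ⟨hm, ?_⟩
  rw [intervalIntegral.integral_of_le h.le, ← integral_Icc_eq_integral_Ioc,
    ← integral_indicator measurableSet_Icc]
  refine integral_mono_ae hm.integrable_sq (IntegrableOn.integrable_indicator
    ((hGc.div_const _).pow 2).continuousOn.integrableOn_Icc measurableSet_Icc)
    (Eventually.of_forall fun y => ?_)
  by_cases hy : y ∈ Icc b b'
  · simp only [indicator_of_mem hy]
    rw [mul_pow, div_pow, div_eq_inv_mul]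
    gcongr
    rw [← sq_abs, ← inv_pow]
    gcongr
    exact hb y
  · simp only [indicator_of_notMem hy]
    rw [h0 y hy]; simp

/-- A function of the domain is approximated by its products with cutoff functions which remove
sets `T n` decreasing to a set that meets neither `K` nor its bounded gaps. If `W = 1` outside `T n`,
the error `(1 - W) u` has the density `-W' G + (1 - W) H`. The first term is small by assumption, and
the second because `T n` shrinks to a null set for `H`; the error in `L²` is at most the integral of
`u ^ 2` over `T n`. -/
theorem exists_approx_of_cutoffs {K : Set ℝ} {ν : Measure K} {u : K → ℝ}
    (hu : u ∈ energyDomain ν) {H : LineL2} {G : ℝ → ℝ} (hH : IsDensity u H)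
    (hGu : ∀ y : K, G y = u y) (hG : ∀ a b : ℝ, ∫ y in a..b, H y = G b - G a) {T : ℕ → Set ℝ}
    (hTm : ∀ n, MeasurableSet (T n)) (hTa : Antitone T)
    (hTI : ∀ a ∈ K, ∀ b ∈ K, Disjoint (Ioc a b) (⋂ n, T n)) (hTK : ∀ y ∈ K, y ∉ ⋂ n, T n)
    (hW : ∀ n, ∀ ε > 0, ∃ (W : ℝ → ℝ) (C : NNReal), LipschitzWith C W ∧ (∀ y, 0 ≤ W y) ∧
      (∀ y, W y ≤ 1) ∧ (∀ y ∉ T n, W y = 1) ∧ MemLp (fun y => deriv W y * G y) 2 volume ∧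
      ∫ y, (deriv W y * G y) ^ 2 < ε ∧ ∃ m, ∀ y ∈ T m, W y = 0) {ε : ℝ} (hε : 0 < ε) :
    ∃ v ∈ energyDomain ν, (∀ y, u y = 0 → v y = 0) ∧ (∃ m, ∀ y : K, (y : ℝ) ∈ T m → v y = 0) ∧
      ∃ H', IsDensity (u - v) H' ∧ ‖H'‖ ^ 2 + ∫ y, (u - v) y ^ 2 ∂ν < ε := by
  have hHsq : Integrable (fun y => H y ^ 2) volume := (Lp.memLp H).integrable_sq
  have husq : Integrable (fun y => u y ^ 2) ν := hu.2.1.integrable_sq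
  have h1 : Tendsto (fun n => ∫ y in T n, H y ^ 2) atTop (𝓝 0) := by
    have h := tendsto_setIntegral_of_antitone hTm hTa ⟨0, hHsq.integrableOn⟩
    have h0 : ∫ y in ⋂ n, T n, H y ^ 2 = 0 := by
      refine setIntegral_eq_zero_of_ae_eq_zero ?_
      filter_upwards [densitySpace_ae_eq_zero hH.mem (MeasurableSet.iInter hTm) hTI] with y hy hyT
      rw [hy hyT]; simp
    rwa [h0] at h
  have h2 : Tendsto (fun n => ∫ y in (Subtype.val ⁻¹' T n : Set K), u y ^ 2 ∂ν) atTop (𝓝 0) := by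
    have h := tendsto_setIntegral_of_antitone (μ := ν) (f := fun y => u y ^ 2)
      (s := fun n => (Subtype.val ⁻¹' T n : Set K)) (fun n => measurable_subtype_coe (hTm n))
      (fun m n hmn => preimage_mono (hTa hmn)) ⟨0, husq.integrableOn⟩
    have h0 : (⋂ n, (Subtype.val ⁻¹' T n : Set K)) = ∅ := by
      rw [← preimage_iInter]
      exact eq_empty_of_forall_notMem fun y hy => hTK y y.2 hy
    rwa [h0, setIntegral_empty] at h
  obtain ⟨n, hn1, hn2⟩ := (((tendsto_order.1 h1).2 (ε / 8) (by positivity)).and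
    ((tendsto_order.1 h2).2 (ε / 4) (by positivity))).exists
  obtain ⟨W, C, hWC, hW0, hW1, hWT, hWm, hWe, m, hm⟩ := hW n (ε / 8) (by positivity)
  have hW1' : ∀ y, |W y| ≤ 1 := fun y => by rw [abs_of_nonneg (hW0 y)]; exact hW1 y
  have hWH : MemLp (fun y => W y * H y) 2 volume := by
    refine (Lp.memLp H).of_le (hWC.continuous.aestronglyMeasurable.mul (Lp.memLp H).1)
      (Eventually.of_forall fun y => ?_)
    rw [norm_mul]
    exact mul_le_of_le_one_left (norm_nonneg _) (hW1' y)
  obtain ⟨Hv, hHv, -⟩ := IsDensity.exists_mul_lipschitz hGu hG hWC (hWm.add hWH)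
  have hWC' : LipschitzWith (0 + C) fun y => 1 - W y := (LipschitzWith.const 1).sub hWC
  have hd : ∀ y, deriv (fun y => 1 - W y) y = -deriv W y := fun y => by
    rw [deriv_const_sub]
  have hm1 : MemLp (fun y => deriv (fun y => 1 - W y) y * G y) 2 volume := by
    simp only [hd, neg_mul]
    exact hWm.neg
  have hm2 : MemLp (fun y => (1 - W y) * H y) 2 volume := by
    have h := (Lp.memLp H).sub hWH
    refine (memLp_congr_ae (Eventually.of_forall fun y => ?_)).1 h
    simp only [Pi.sub_apply]; ring
  obtain ⟨H', hH', hle⟩ := IsDensity.exists_mul_lipschitz hGu hG hWC' (hm1.add hm2)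
  have huv : u - (fun y : K => W y * u y) = fun y : K => (1 - W y) * u y := by
    funext y; simp only [Pi.sub_apply]; ring
  refine ⟨fun y : K => W y * u y, ⟨⟨Hv, hHv⟩, ?_, fun j hj => ?_⟩, fun y hy => by simp [hy],
    ⟨m, fun y hy => by simp [hm y hy]⟩, H', by rwa [huv], ?_⟩
  · refine hu.2.1.of_le ((hWC.continuous.comp continuous_subtype_val).aestronglyMeasurable.mul
      hu.2.1.1) (Eventually.of_forall fun y => ?_)
    rw [norm_mul]
    exact mul_le_of_le_one_left (norm_nonneg _) (hW1' y)
  · refine squeeze_zero_norm (fun y => ?_) (by simpa using (hu.2.2 j hj).norm)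
    rw [norm_mul]
    exact mul_le_of_le_one_left (norm_nonneg _) (hW1' y)
  · have h3 : ∫ y, (deriv (fun y => 1 - W y) y * G y + (1 - W y) * H y) ^ 2 ≤
        2 * (ε / 8) + 2 * (ε / 8) := by
      have h4 : ∫ y, ((1 - W y) * H y) ^ 2 ≤ ∫ y in T n, H y ^ 2 := by
        rw [← integral_indicator (hTm n)]
        refine integral_mono_ae hm2.integrable_sq (hHsq.indicator (hTm n))
          (Eventually.of_forall fun y => ?_)
        by_cases hy : y ∈ T n
        · simp only [indicator_of_mem hy, mul_pow]
          refine mul_le_of_le_one_left (sq_nonneg _) ?_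
          have := hW0 y; have := hW1 y
          nlinarith
        · simp [indicator_of_notMem hy, hWT y hy]
      calc ∫ y, (deriv (fun y => 1 - W y) y * G y + (1 - W y) * H y) ^ 2
          ≤ ∫ y, (2 * (deriv W y * G y) ^ 2 + 2 * ((1 - W y) * H y) ^ 2) := by
            refine integral_mono_ae (hm1.add hm2).integrable_sq
              ((hWm.integrable_sq.const_mul 2).add (hm2.integrable_sq.const_mul 2))
              (Eventually.of_forall fun y => ?_)
            simp only [hd]
            nlinarith [sq_nonneg (deriv W y * G y + (1 - W y) * H y)]
        _ = 2 * (∫ y, (deriv W y * G y) ^ 2) + 2 * ∫ y, ((1 - W y) * H y) ^ 2 := by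
            rw [integral_add (hWm.integrable_sq.const_mul 2) (hm2.integrable_sq.const_mul 2),
              integral_const_mul, integral_const_mul]
        _ ≤ _ := by linarith
    have h5 : ∫ y, (u - fun y : K => W y * u y) y ^ 2 ∂ν ≤
        ∫ y in (Subtype.val ⁻¹' T n : Set K), u y ^ 2 ∂ν := by
      rw [huv, ← integral_indicator (measurable_subtype_coe (hTm n))]
      refine integral_mono_of_nonneg (Eventually.of_forall fun y => sq_nonneg _)
        (husq.indicator (measurable_subtype_coe (hTm n))) (Eventually.of_forall fun y => ?_)
      by_cases hy : y ∈ (Subtype.val ⁻¹' T n : Set K)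
      · simp only [indicator_of_mem hy, mul_pow]
        refine mul_le_of_le_one_left (sq_nonneg _) ?_
        have := hW0 y; have := hW1 y
        nlinarith
      · have h6 : W y = 1 := hWT y hy
        simp [h6, indicator_of_notMem hy]
    have h7 := hle.trans h3
    linarith

section Ends

variable {K : Set ℝ} {ν : Measure K} {u : K → ℝ}

/-- Functions of the domain are approximated by those that vanish near the upper end of `K`. -/
theorem exists_approx_right [Nonempty K] (hu : u ∈ energyDomain ν) {ε : ℝ} (hε : 0 < ε) :
    ∃ v ∈ energyDomain ν, (∀ y, u y = 0 → v y = 0) ∧ (∃ b : K, ∀ y : K, b < y → v y = 0) ∧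
      ∃ H', IsDensity (u - v) H' ∧ ‖H'‖ ^ 2 + ∫ y, (u - v) y ^ 2 ∂ν < ε := by
  -- If `K` has a maximum, `u` itself will do.
  by_cases hmax : ∃ b : K, ∀ y : K, y ≤ b
  · obtain ⟨b, hb⟩ := hmax
    refine ⟨u, hu, fun _ h => h, ⟨b, fun y hy => absurd (hb y) (not_le.2 hy)⟩, 0, ?_, ?_⟩
    · rw [sub_self]; exact IsDensity.zero
    · simpa using hε
  push Not at hmax
  obtain ⟨H, hH⟩ := hu.1
  obtain ⟨G, hGu, hG⟩ := hH.exists_primitive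
  obtain ⟨x₀⟩ := (inferInstance : Nonempty K)
  -- Otherwise the supremum `r ∈ (-∞, ∞]` is approached by a sequence `κ` in `K` and not attained.
  set r : EReal := sSup ((fun y : ℝ => (y : EReal)) '' K) with hr
  have hle : ∀ y ∈ K, (y : EReal) ≤ r := fun y hy => le_sSup (mem_image_of_mem _ hy)
  have hlt : ∀ y ∈ K, (y : EReal) < r := by
    intro y hy
    obtain ⟨z, hz⟩ := hmax ⟨y, hy⟩
    exact (EReal.coe_lt_coe_iff.2 (Subtype.coe_lt_coe.2 hz)).trans_le (hle z z.2)
  obtain ⟨κ', hκm, hκt, hκK⟩ := exists_seq_tendsto_sSup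
    (S := (fun y : ℝ => (y : EReal)) '' K) ⟨_, mem_image_of_mem _ x₀.2⟩ (OrderTop.bddAbove _)
  choose κ hκ hκ' using hκK
  simp only at hκ'
  have hκlt : ∀ x : EReal, x < r → ∃ m, x < κ m := fun x hx => by
    obtain ⟨m, hm⟩ := ((tendsto_order.1 hκt).1 x hx).exists
    exact ⟨m, by rwa [hκ' m]⟩
  have hκmono : Monotone κ := fun m n hmn => by
    rw [← EReal.coe_le_coe_iff, hκ', hκ']; exact hκm hmn
  have hnot : ∀ y ∈ K, y ∉ ⋂ n, Ioi (κ n) := fun y hy h => by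
    obtain ⟨m, hm⟩ := hκlt y (hlt y hy)
    exact lt_asymm (EReal.coe_lt_coe_iff.1 hm) (mem_iInter.1 h m)
  obtain ⟨v, hv, hv0, ⟨m, hvm⟩, hvH⟩ := exists_approx_of_cutoffs hu hH hGu hG
    (T := fun n => Ioi (κ n)) (fun n => measurableSet_Ioi)
    (fun m n hmn => Ioi_subset_Ioi (hκmono hmn))
    (fun a _ b hb => disjoint_left.2 fun y hy hyT => by
      obtain ⟨m, hm⟩ := hκlt b (hlt b hb)
      have := EReal.coe_lt_coe_iff.1 hm
      have := mem_iInter.1 hyT m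
      simp only [mem_Ioi] at this
      linarith [hy.2]) hnot
    (fun n ε hε => by
      -- A finite `r` is a boundary point of `K` outside `K`, and there the primitive vanishes.
      obtain ⟨b, b', hb, hbb', hb'r, hE⟩ := exists_ramp (Lp.memLp H) hG (primitive_continuous hG)
        (r := r) (fun r' hr' => by
          have hr'K : r' ∉ K := fun h => absurd hr' (hlt r' h).ne'
          have hcl : r' ∈ closure K := by
            refine mem_closure_iff_nhds.2 fun t ht => ?_
            obtain ⟨l, hl, hlt'⟩ := exists_Ioc_subset_of_mem_nhds ht ⟨r' - 1, by linarith⟩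
            obtain ⟨m, hm⟩ := hκlt l (by rw [hr']; exact EReal.coe_lt_coe_iff.2 hl)
            refine ⟨κ m, hlt' ⟨EReal.coe_lt_coe_iff.1 hm, ?_⟩, hκ m⟩
            have := hle _ (hκ m)
            rw [hr'] at this
            exact EReal.coe_le_coe_iff.1 this
          have := comap_val_neBot hcl
          have h1 := tendsto_nhds_unique (hH.tendsto x₀ r') (hu.2.2 r' ⟨hcl, hr'K⟩)
          rwa [hG, hGu, add_sub_cancel] at h1) (hlt _ (hκ n)) hε
      obtain ⟨hm1, hm2⟩ := memLp_deriv_rampFun (primitive_continuous hG) hbb'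
      obtain ⟨m, hm⟩ := hκlt b' hb'r
      refine ⟨_, _, lipschitzWith_rampFun hbb', fun y => le_max_left _ _,
        fun y => max_le zero_le_one (min_le_left _ _), fun y hy => ?_, hm1, hm2.trans_lt hE, m,
        fun y hy => rampFun_eq_zero hbb' ((EReal.coe_lt_coe_iff.1 hm).trans hy).le⟩
      exact rampFun_eq_one hbb' ((not_lt.1 hy).trans hb)) hε
  exact ⟨v, hv, hv0, ⟨⟨κ m, hκ m⟩, fun y hy => hvm y hy⟩, hvH⟩

/-- Functions of the domain are approximated by those that vanish near the lower end of `K`. -/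
theorem exists_approx_left [Nonempty K] (hu : u ∈ energyDomain ν) {ε : ℝ} (hε : 0 < ε) :
    ∃ v ∈ energyDomain ν, (∀ y, u y = 0 → v y = 0) ∧ (∃ b : K, ∀ y : K, y < b → v y = 0) ∧
      ∃ H', IsDensity (u - v) H' ∧ ‖H'‖ ^ 2 + ∫ y, (u - v) y ^ 2 ∂ν < ε := by
  by_cases hmin : ∃ b : K, ∀ y : K, b ≤ y
  · obtain ⟨b, hb⟩ := hmin
    refine ⟨u, hu, fun _ h => h, ⟨b, fun y hy => absurd (hb y) (not_le.2 hy)⟩, 0, ?_, ?_⟩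
    · rw [sub_self]; exact IsDensity.zero
    · simpa using hε
  push Not at hmin
  obtain ⟨H, hH⟩ := hu.1
  obtain ⟨G, hGu, hG⟩ := hH.exists_primitive
  obtain ⟨x₀⟩ := (inferInstance : Nonempty K)
  set r : EReal := sInf ((fun y : ℝ => (y : EReal)) '' K) with hr
  have hle : ∀ y ∈ K, r ≤ (y : EReal) := fun y hy => sInf_le (mem_image_of_mem _ hy)
  have hlt : ∀ y ∈ K, r < (y : EReal) := by
    intro y hy
    obtain ⟨z, hz⟩ := hmin ⟨y, hy⟩
    exact (hle z z.2).trans_lt (EReal.coe_lt_coe_iff.2 (Subtype.coe_lt_coe.2 hz))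
  obtain ⟨κ', hκm, hκt, hκK⟩ := exists_seq_tendsto_sInf
    (S := (fun y : ℝ => (y : EReal)) '' K) ⟨_, mem_image_of_mem _ x₀.2⟩ (OrderBot.bddBelow _)
  choose κ hκ hκ' using hκK
  simp only at hκ'
  have hκlt : ∀ x : EReal, r < x → ∃ m, (κ m : EReal) < x := fun x hx => by
    obtain ⟨m, hm⟩ := ((tendsto_order.1 hκt).2 x hx).exists
    exact ⟨m, by rwa [hκ' m]⟩
  have hκmono : Antitone κ := fun m n hmn => by
    rw [← EReal.coe_le_coe_iff, hκ', hκ']; exact hκm hmn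
  have hnot : ∀ y ∈ K, y ∉ ⋂ n, Iio (κ n) := fun y hy h => by
    obtain ⟨m, hm⟩ := hκlt y (hlt y hy)
    exact lt_asymm (EReal.coe_lt_coe_iff.1 hm) (mem_iInter.1 h m)
  -- The ramp is obtained by reflection at the origin.
  have hneg : MeasurePreserving (Neg.neg : ℝ → ℝ) volume volume :=
    Measure.measurePreserving_neg volume
  have hHn : MemLp (fun y => -H (-y)) 2 volume :=
    ((Lp.memLp H).comp_measurePreserving hneg).neg
  have hGn : ∀ a b : ℝ, ∫ y in a..b, -H (-y) = G (-b) - G (-a) := fun a b => by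
    rw [intervalIntegral.integral_neg, intervalIntegral.integral_comp_neg (fun y => H y), hG]; ring
  have hGc : Continuous fun y => G (-y) := (primitive_continuous hG).comp continuous_neg
  obtain ⟨v, hv, hv0, ⟨m, hvm⟩, hvH⟩ := exists_approx_of_cutoffs hu hH hGu hG
    (T := fun n => Iio (κ n)) (fun n => measurableSet_Iio)
    (fun m n hmn => Iio_subset_Iio (hκmono hmn))
    (fun a ha b _ => disjoint_left.2 fun y hy hyT => by
      obtain ⟨m, hm⟩ := hκlt a (hlt a ha)
      have := EReal.coe_lt_coe_iff.1 hm
      have := mem_iInter.1 hyT m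
      simp only [mem_Iio] at this
      linarith [hy.1]) hnot
    (fun n ε hε => by
      obtain ⟨b, b', hb, hbb', hb'r, hE⟩ := exists_ramp hHn hGn hGc
        (r := -r) (fun r' hr' => by
          have hr'' : r = ((-r' : ℝ) : EReal) := by
            rw [EReal.coe_neg, ← hr', neg_neg]
          have hr'K : -r' ∉ K := fun h => absurd hr'' (hlt (-r') h).ne
          have hcl : -r' ∈ closure K := by
            refine mem_closure_iff_nhds.2 fun t ht => ?_
            obtain ⟨l, hl, hlt'⟩ := exists_Ico_subset_of_mem_nhds ht ⟨-r' + 1, by linarith⟩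
            obtain ⟨m, hm⟩ := hκlt l (by rw [hr'']; exact EReal.coe_lt_coe_iff.2 hl)
            refine ⟨κ m, hlt' ⟨?_, EReal.coe_lt_coe_iff.1 hm⟩, hκ m⟩
            have := hle _ (hκ m)
            rw [hr''] at this
            exact EReal.coe_le_coe_iff.1 this
          have := comap_val_neBot hcl
          have h1 := tendsto_nhds_unique (hH.tendsto x₀ (-r')) (hu.2.2 (-r') ⟨hcl, hr'K⟩)
          rwa [hG, hGu, add_sub_cancel] at h1) (y₀ := -κ n)
          (by rw [EReal.coe_neg]; exact EReal.neg_lt_neg_iff.2 (hlt _ (hκ n))) hε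
      obtain ⟨hm1, hm2⟩ := memLp_deriv_rampFun hGc hbb'
      obtain ⟨m, hm⟩ := hκlt ((-b' : ℝ) : EReal) (by
        rw [EReal.coe_neg]; exact EReal.lt_neg_comm.1 hb'r)
      set W : ℝ → ℝ := fun y => max 0 (min 1 ((b' - y) / (b' - b))) with hWdef
      have hWl := lipschitzWith_rampFun hbb'
      have heq : (fun y => deriv (fun y => W (-y)) y * G y) =
          fun y => -((fun y => deriv W y * G (-y)) (-y)) := by
        funext y
        rw [deriv_comp_neg]; simp
      refine ⟨fun y => W (-y), _, hWl.comp LipschitzWith.id.neg, fun y => le_max_left _ _,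
        fun y => max_le zero_le_one (min_le_left _ _), fun y hy => ?_, ?_, ?_, m,
        fun y hy => rampFun_eq_zero hbb' ?_⟩
      · refine rampFun_eq_one hbb' ?_
        have := notMem_Iio.1 hy
        linarith
      · rw [heq]
        exact (hm1.comp_measurePreserving hneg).neg
      · refine lt_of_eq_of_lt ?_ (hm2.trans_lt hE)
        rw [show (fun y => (deriv (fun y => W (-y)) y * G y) ^ 2) =
          fun y => (fun y => (deriv W y * G (-y)) ^ 2) (-y) from funext fun y => by
            rw [congrFun heq y, neg_sq]]
        exact integral_neg_eq_self (fun y => (deriv W y * G (-y)) ^ 2) volume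
      · have h1 := EReal.coe_lt_coe_iff.1 hm
        have h2 : y < κ m := hy
        linarith) hε
  exact ⟨v, hv, hv0, ⟨⟨κ m, hκ m⟩, fun y hy => hvm y hy⟩, hvH⟩

end Ends

/-- Density for the form norm follows by cutting off near both ends of `K`. Density for the uniform
norm is the density of the restrictions of polynomials, multiplied by a cutoff function. -/
theorem IsEnergyForm.isRegular {K : Set ℝ} [CompactIccSpace K] {ν : Measure K}
    [IsFiniteMeasureOnCompacts ν] [ν.IsOpenPosMeasure] {a : L2Form ν} (ha : IsEnergyForm a) :
    a.IsRegular where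
  locallyCompact := locallyCompactSpace_of_compactIcc
  separable := inferInstance
  metrizable := inferInstance
  radon := by
    have := locallyCompactSpace_of_compactIcc (K := K)
    infer_instance
  fullSupport := inferInstance
  dense_form U hU ε hε := by
    obtain ⟨u, hu, hUu⟩ := (ha.mem_dom_iff U).1 hU
    rcases isEmpty_or_nonempty K with hemp | hne
    · refine ⟨U, hU, ⟨u, hu.1.choose_spec.continuous, HasCompactSupport.of_compactSpace u, hUu⟩, ?_⟩
      rw [sub_self]
      rw [ha.energyOne_eq energyDomain_zero (Lp.coeFn_zero _ _ _) IsDensity.zero]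
      simpa using hε
    obtain ⟨v, hv, -, ⟨b, hb⟩, H₁, hH₁, h1⟩ := exists_approx_right hu (ε := ε / 4) (by positivity)
    obtain ⟨w, hw, hvw, ⟨c, hc⟩, H₂, hH₂, h2⟩ := exists_approx_left hv (ε := ε / 4) (by positivity)
    refine ⟨hw.2.1.toLp w, (ha.mem_dom_iff _).2 ⟨w, hw, hw.2.1.coeFn_toLp⟩,
      ⟨w, hw.1.choose_spec.continuous, ?_, hw.2.1.coeFn_toLp⟩, ?_⟩
    · refine HasCompactSupport.intro (K := Icc c b) isCompact_Icc fun y hy => ?_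
      rw [mem_Icc, not_and_or, not_le, not_le] at hy
      rcases hy with hy | hy
      · exact hc y hy
      · exact hvw y (hb y hy)
    · have huw := energyDomain_sub hu hw
      have hHH : IsDensity (u - w) (H₁ + H₂) := by
        have h := hH₁.add hH₂
        rwa [sub_add_sub_cancel] at h
      have hUw : (U - hw.2.1.toLp w : Lp ℝ 2 ν) =ᵐ[ν] u - w :=
        (Lp.coeFn_sub _ _).trans (hUu.sub hw.2.1.coeFn_toLp)
      rw [ha.energyOne_eq huw hUw hHH]
      have h3 : ‖U - hw.2.1.toLp w‖ ^ 2 = ∫ y, (u - w) y ^ 2 ∂ν := by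
        rw [← norm_sq_toLp huw.2.1]
        congr 2
        exact Lp.ext (hUw.trans huw.2.1.coeFn_toLp.symm)
      have hm1 := (energyDomain_sub hu hv).2.1.integrable_sq
      have hm2 := (energyDomain_sub hv hw).2.1.integrable_sq
      have h4 : ∫ y, (u - w) y ^ 2 ∂ν ≤ 2 * ∫ y, (u - v) y ^ 2 ∂ν + 2 * ∫ y, (v - w) y ^ 2 ∂ν := by
        rw [← integral_const_mul, ← integral_const_mul,
          ← integral_add (hm1.const_mul 2) (hm2.const_mul 2)]
        refine integral_mono huw.2.1.integrable_sq ((hm1.const_mul 2).add (hm2.const_mul 2))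
          fun y => ?_
        simp only [Pi.sub_apply]
        nlinarith [sq_nonneg ((u y - v y) - (v y - w y))]
      have h5 : ‖H₁ + H₂‖ ^ 2 ≤ 2 * ‖H₁‖ ^ 2 + 2 * ‖H₂‖ ^ 2 := by
        have := norm_add_le H₁ H₂
        nlinarith [sq_nonneg (‖H₁‖ - ‖H₂‖), norm_nonneg (H₁ + H₂), norm_nonneg H₁, norm_nonneg H₂]
      rw [h3]
      nlinarith [sq_nonneg ‖H₁‖, sq_nonneg ‖H₂‖]
  dense_unif φ hφ hφc ε hε := by
    obtain ⟨N, hN, h⟩ := exists_uniform_approx hφ hφc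
    obtain ⟨ψ, hψ, hψ0, hψφ⟩ := h ε hε
    have hdom := mem_energyDomain_of_compact (ν := ν) hψ hN hψ0
    exact ⟨ψ, hψ.choose_spec.continuous, HasCompactSupport.intro hN hψ0,
      ⟨hdom.2.1.toLp ψ, (ha.mem_dom_iff _).2 ⟨ψ, hdom, hdom.2.1.coeFn_toLp⟩,
        hdom.2.1.coeFn_toLp⟩, hψφ⟩

/-! ### Invariant sets and irreducibility -/

/-- The product of the indicator function of `A` with an element of `L²`. -/
noncomputable def indicatorL2 {X : Type*} [MeasurableSpace X] {μ : Measure X} {A : Set X}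
    (hA : MeasurableSet A) (U : Lp ℝ 2 μ) : Lp ℝ 2 μ :=
  ((Lp.memLp U).indicator hA).toLp _

section IndicatorL2

variable {X : Type*} [MeasurableSpace X] {μ : Measure X} {A : Set X} (hA : MeasurableSet A)

theorem indicatorL2_coeFn (U : Lp ℝ 2 μ) : indicatorL2 hA U =ᵐ[μ] A.indicator U :=
  MemLp.coeFn_toLp _

theorem indicatorL2_sub (U V : Lp ℝ 2 μ) :
    indicatorL2 hA (U - V) = indicatorL2 hA U - indicatorL2 hA V := by
  refine Lp.ext ?_
  filter_upwards [indicatorL2_coeFn hA (U - V), indicatorL2_coeFn hA U, indicatorL2_coeFn hA V,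
    Lp.coeFn_sub U V, Lp.coeFn_sub (indicatorL2 hA U) (indicatorL2 hA V)] with x h1 h2 h3 h4 h5
  rw [h1, h5, Pi.sub_apply, h2, h3]
  by_cases hx : x ∈ A
  · simp only [indicator_of_mem hx, h4, Pi.sub_apply]
  · simp only [indicator_of_notMem hx, sub_zero]

theorem indicatorL2_compl (U : Lp ℝ 2 μ) :
    indicatorL2 hA.compl U = U - indicatorL2 hA U := by
  refine Lp.ext ?_
  filter_upwards [indicatorL2_coeFn hA.compl U, indicatorL2_coeFn hA U,
    Lp.coeFn_sub U (indicatorL2 hA U)] with x h1 h2 h3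
  rw [h1, h3, Pi.sub_apply, h2]
  by_cases hx : x ∈ A <;> simp [hx]

theorem inner_indicatorL2 (U V : Lp ℝ 2 μ) :
    inner ℝ (indicatorL2 hA U) V = inner ℝ U (indicatorL2 hA V) := by
  rw [L2.inner_def, L2.inner_def]
  refine integral_congr_ae ?_
  filter_upwards [indicatorL2_coeFn hA U, indicatorL2_coeFn hA V] with x h1 h2
  rw [h1, h2]
  by_cases hx : x ∈ A <;> simp [hx]

theorem indicatorL2_idem (U : Lp ℝ 2 μ) :
    indicatorL2 hA (indicatorL2 hA U) = indicatorL2 hA U := by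
  refine Lp.ext ?_
  filter_upwards [indicatorL2_coeFn hA (indicatorL2 hA U), indicatorL2_coeFn hA U] with x h1 h2
  rw [h1, h2]
  by_cases hx : x ∈ A <;> simp [hx, h2]

theorem inner_indicatorL2_compl (U V : Lp ℝ 2 μ) :
    inner ℝ (indicatorL2 hA U) (indicatorL2 hA.compl V) = 0 := by
  rw [indicatorL2_compl hA, inner_sub_right, inner_indicatorL2 hA U V, ← inner_indicatorL2 hA,
    ← inner_indicatorL2 hA, indicatorL2_idem, sub_self]

end IndicatorL2

namespace L2Form

variable {X : Type*} [MeasurableSpace X] {μ : Measure X} {a : L2Form μ} {A : Set X}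

/-- An invariant set splits the form into two orthogonal parts. The form is the limit of
`t⁻¹ ⟨U - T t U, V⟩`, and `⟨U - T t U, U⟩` is the sum of the same expressions for `1_A U` and
`1_{Aᶜ} U`, which are nonnegative since `T t` is a contraction. -/
theorem IsSemigroup.split {T : ℝ → Lp ℝ 2 μ →L[ℝ] Lp ℝ 2 μ} (hT : a.IsSemigroup T)
    (hA : MeasurableSet A) (hTA : ∀ t > 0, ∀ U, T t (indicatorL2 hA U) = indicatorL2 hA (T t U)) :
    (∀ U ∈ a.dom, indicatorL2 hA U ∈ a.dom) ∧ ∀ U ∈ a.dom, ∀ V ∈ a.dom,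
      indicatorL2 hA U ∈ a.dom → indicatorL2 hA.compl V ∈ a.dom →
      a.form (indicatorL2 hA U) (indicatorL2 hA.compl V) = 0 := by
  have hTAc : ∀ t > 0, ∀ U, T t (indicatorL2 hA.compl U) = indicatorL2 hA.compl (T t U) := by
    intro t ht U
    rw [indicatorL2_compl hA, indicatorL2_compl hA, map_sub, hTA t ht]
  refine ⟨fun U hU => ?_, fun U _ V _ hU hV => ?_⟩
  · obtain ⟨C, hC⟩ := (hT.mem_dom_iff U).1 hU
    refine (hT.mem_dom_iff _).2 ⟨C, fun t ht => (le_trans ?_ (hC t ht))⟩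
    have h1 : inner ℝ (indicatorL2 hA U - T t (indicatorL2 hA U)) (indicatorL2 hA U) =
        inner ℝ (U - T t U) (indicatorL2 hA U) := by
      rw [hTA t ht, ← indicatorL2_sub, inner_indicatorL2, indicatorL2_idem]
    have h2 : inner ℝ (U - T t U) (indicatorL2 hA.compl U) = inner ℝ (indicatorL2 hA.compl U -
        T t (indicatorL2 hA.compl U)) (indicatorL2 hA.compl U) := by
      rw [hTAc t ht, ← indicatorL2_sub, inner_indicatorL2, indicatorL2_idem]
    have h3 : 0 ≤ inner ℝ (U - T t U) (indicatorL2 hA.compl U) := by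
      rw [h2, inner_sub_left, sub_nonneg]
      refine (real_inner_le_norm _ _).trans ?_
      rw [real_inner_self_eq_norm_mul_norm]
      exact mul_le_mul_of_nonneg_right (hT.contraction t ht _) (norm_nonneg _)
    have h4 : inner ℝ (U - T t U) U = inner ℝ (U - T t U) (indicatorL2 hA U) +
        inner ℝ (U - T t U) (indicatorL2 hA.compl U) := by
      rw [← inner_add_right, indicatorL2_compl hA, add_sub_cancel]
    have ht' : 0 ≤ t := le_of_lt ht
    rw [h1, h4]
    gcongr
    linarith
  · refine tendsto_nhds_unique (hT.form_eq _ hU _ hV) (tendsto_const_nhds.congr' ?_)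
    filter_upwards [eventually_mem_nhdsWithin] with t ht
    rw [hTA t ht, ← indicatorL2_sub, inner_indicatorL2_compl, zero_div]

end L2Form

theorem isDensity_const {K : Set ℝ} (c : ℝ) : IsDensity (fun _ : K => c) 0 where
  mem := Submodule.zero_mem _
  sub_eq a b hab := by rw [← inner_stepL2 hab]; simp

/-- The coordinate function, stopped at `a` and at `b`, has the density `1_{(a, b]}`. -/
theorem isDensity_clip {K : Set ℝ} {a b : K} (hab : a ≤ b) :
    IsDensity (fun y : K => max (a : ℝ) (min b y)) (stepL2 a b) where
  mem := stepL2_mem_densitySpace a.2 b.2 hab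
  sub_eq c d hcd := by
    have hab' : (a : ℝ) ≤ b := hab
    rw [← inner_stepL2 hcd, stepL2, stepL2,
      L2.real_inner_indicatorConstLp_one_indicatorConstLp_one _ _ measure_Ioc_lt_top.ne
      measure_Ioc_lt_top.ne, Ioc_inter_Ioc, Real.volume_real_Ioc]
    grind

/-- A point of `K` right of `b` beyond which there is only a short piece of `K`. -/
theorem exists_right_node {K : Set ℝ} [CompactIccSpace K] {b : K} (hb : ∃ z : K, b < z) {δ : ℝ}
    (hδ : 0 < δ) : ∃ b' : K, b < b' ∧ ∀ y : K, b < y → y < b' → (y : ℝ) < b + δ := by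
  by_cases h : ∃ y : K, b < y ∧ (y : ℝ) < b + δ
  · obtain ⟨y, hy, hyδ⟩ := h
    exact ⟨y, hy, fun z _ hzy => (Subtype.coe_lt_coe.2 hzy).trans hyδ⟩
  · push Not at h
    obtain ⟨z, hz⟩ := hb
    have hc : IsCompact (Icc b z ∩ {y : K | (b : ℝ) + δ ≤ y}) :=
      isCompact_Icc.inter_right (isClosed_le continuous_const continuous_subtype_val)
    obtain ⟨b', hb', hb'min⟩ := hc.exists_isLeast ⟨z, ⟨hz.le, le_rfl⟩, h z hz⟩
    refine ⟨b', Subtype.coe_lt_coe.1 (lt_of_lt_of_le (by linarith) hb'.2), fun y hy hyb' => ?_⟩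
    by_contra hcon
    exact absurd (hb'min ⟨⟨hy.le, hyb'.le.trans hb'.1.2⟩, not_lt.1 hcon⟩) (not_le.2 hyb')

section Irreducible

variable {K : Set ℝ} [CompactIccSpace K] {ν : Measure K} [IsFiniteMeasureOnCompacts ν]
  {a : L2Form ν}

/-- A tent at `b` to the right of a gap `(p, b)`. Its energy relative to a function `w ≥ 0` with
`w p = 1` and `w b = 0` is negative: the slope of `w` is negative on the gap, and `w` cannot decrease
from `b` to the foot `b'` of the tent. -/
theorem exists_tent {p b : K} (hpb : p < b) (hgap : ∀ y : K, p < y → b ≤ y) {δ : ℝ} (hδ : 0 < δ) :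
    ∃ v ∈ energyDomain ν, (∀ y, v y ≠ 0 → b ≤ y ∧ (y : ℝ) < b + δ) ∧ ∃ Hv, IsDensity v Hv ∧
      ∀ w H, IsDensity w H → (∀ y, 0 ≤ w y) → w p = 1 → w b = 0 → inner ℝ H Hv < 0 := by
  have hpb' : (p : ℝ) < b := hpb
  have hs : (0 : ℝ) < b - p := sub_pos.2 hpb'
  set e : K → ℝ := fun y => max (p : ℝ) (min b y) with he
  have hclip : IsDensity e (stepL2 p b) := isDensity_clip hpb.le
  have h1 : ∀ y : K, b ≤ y → e y = b := fun y hy => by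
    have : (b : ℝ) ≤ y := hy
    simp [he, this, hpb'.le]
  have h2 : ∀ y : K, y ≤ p → e y = p := fun y hy => by
    have : (y : ℝ) ≤ p := hy
    simp [he, this]
  have hinner : ∀ w H, IsDensity w H → w p = 1 → w b = 0 → inner ℝ H (stepL2 p b) = -1 := by
    intro w H hw hp hb
    rw [real_inner_comm, inner_stepL2 hpb'.le, ← hw.sub_eq p b hpb'.le, hp, hb]; ring
  by_cases hmax : ∃ z : K, b < z
  · obtain ⟨b', hbb', hb'⟩ := exists_right_node hmax hδ
    have hbb'' : (b : ℝ) < b' := hbb'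
    have ht : (0 : ℝ) < b' - b := sub_pos.2 hbb''
    set e' : K → ℝ := fun y => max (b : ℝ) (min b' y) with he'
    have hclip' : IsDensity e' (stepL2 b b') := isDensity_clip hbb'.le
    have h3 : ∀ y : K, b' ≤ y → e' y = b' := fun y hy => by
      have : (b' : ℝ) ≤ y := hy
      simp [he', this, hbb''.le]
    have h4 : ∀ y : K, y ≤ b → e' y = b := fun y hy => by
      have : (y : ℝ) ≤ b := hy
      simp [he', this]
    -- `v` increases from `0` to `1` across the gap and decreases from `1` to `0` on `[b, b']`.
    set v : K → ℝ := ((b - p : ℝ)⁻¹ • (e - fun _ => (p : ℝ))) -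
      ((b' - b : ℝ)⁻¹ • (e' - fun _ => (b : ℝ))) with hv
    have hvd : IsDensity v
        ((b - p : ℝ)⁻¹ • (stepL2 p b - 0) - (b' - b : ℝ)⁻¹ • (stepL2 b b' - 0)) :=
      ((hclip.sub (isDensity_const _)).smul _).sub ((hclip'.sub (isDensity_const _)).smul _)
    have hv0 : ∀ y, v y ≠ 0 → b ≤ y ∧ y < b' := by
      intro y hy
      constructor
      · refine hgap y (not_le.1 fun hyp => hy ?_)
        simp [hv, h2 y hyp, h4 y (hyp.trans hpb.le)]
      · refine not_le.1 fun hyb' => hy ?_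
        simp only [hv, Pi.sub_apply, Pi.smul_apply, smul_eq_mul, h1 y (hbb'.le.trans hyb'),
          h3 y hyb']
        rw [inv_mul_cancel₀ hs.ne', inv_mul_cancel₀ ht.ne', sub_self]
    refine ⟨v, mem_energyDomain_of_compact ⟨_, hvd⟩ (N := Icc b b') isCompact_Icc fun y hy => ?_,
      fun y hy => ⟨(hv0 y hy).1, ?_⟩, _, hvd, fun w H hw hw0 hwp hwb => ?_⟩
    · by_contra hne
      exact hy ⟨(hv0 y hne).1, (hv0 y hne).2.le⟩
    · rcases (hv0 y hy).1.eq_or_lt with h | h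
      · rw [← h]; linarith
      · exact hb' y h (hv0 y hy).2
    · rw [sub_zero, sub_zero, inner_sub_right, inner_smul_right, inner_smul_right,
        hinner w H hw hwp hwb, real_inner_comm, inner_stepL2 hbb''.le, ← hw.sub_eq b b' hbb''.le,
        hwb, sub_zero]
      have h5 : 0 < (b - p : ℝ)⁻¹ := inv_pos.2 hs
      have h6 : 0 ≤ (b' - b : ℝ)⁻¹ * w b' := mul_nonneg (inv_pos.2 ht).le (hw0 b')
      linarith
  · -- `b` is the maximum of `K`, and the descending side of the tent is absent.
    push Not at hmax
    set v : K → ℝ := (b - p : ℝ)⁻¹ • (e - fun _ => (p : ℝ)) with hv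
    have hvd : IsDensity v ((b - p : ℝ)⁻¹ • (stepL2 p b - 0)) :=
      (hclip.sub (isDensity_const _)).smul _
    have hv0 : ∀ y, v y ≠ 0 → b ≤ y := by
      intro y hy
      refine hgap y (not_le.1 fun hyp => hy ?_)
      simp [hv, h2 y hyp]
    refine ⟨v, mem_energyDomain_of_compact ⟨_, hvd⟩ (N := Icc b b) isCompact_Icc fun y hy => ?_,
      fun y hy => ⟨hv0 y hy, ?_⟩, _, hvd, fun w H hw hw0 hwp hwb => ?_⟩
    · by_contra hne
      exact hy ⟨hv0 y hne, hmax y⟩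
    · have : (y : ℝ) ≤ b := hmax y
      linarith
    · rw [sub_zero, inner_smul_right, hinner w H hw hwp hwb]
      have h5 : 0 < (b - p : ℝ)⁻¹ := inv_pos.2 hs
      linarith

variable [ν.IsOpenPosMeasure]

/-- The indicator of a set `B` which splits the form cannot jump down along `K`. The continuous
function `w₁` takes at each point the value `0` or that of `w`, so its last value `1` and the first
zero `b` after it are at the ends of a gap. A tent at `b` which is narrow enough is supported off
`B`, so its energy relative to `w₁` vanishes; but that energy is negative. -/
theorem IsEnergyForm.not_switch (ha : IsEnergyForm a) {B : Set K} (hB : MeasurableSet B)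
    (ho : ∀ U ∈ a.dom, ∀ V ∈ a.dom, a.form (indicatorL2 hB U) (indicatorL2 hB.compl V) = 0)
    {w w₁ : K → ℝ} (hw : w ∈ energyDomain ν) (hw₁ : w₁ ∈ energyDomain ν)
    (hww₁ : w₁ =ᵐ[ν] B.indicator w) (hw0 : ∀ y, 0 ≤ w y) {p q : K} (hpq : p < q)
    (hw1 : ∀ y ∈ Icc p q, w y = 1) (hp : w₁ p = 1) (hq : w₁ q = 0) : False := by
  obtain ⟨H, hH⟩ := hw.1
  obtain ⟨H₁, hH₁⟩ := hw₁.1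
  have hdich : ∀ y, w₁ y = 0 ∨ w₁ y = w y := by
    have h : (fun y => w₁ y * (w₁ y - w y)) = fun _ => 0 := by
      refine Continuous.ae_eq_iff_eq ν (hH₁.continuous.mul (hH₁.continuous.sub hH.continuous))
        continuous_const |>.1 ?_
      filter_upwards [hww₁] with y hy
      simp only [Pi.mul_apply, Pi.sub_apply]
      rw [hy]
      by_cases hyB : y ∈ B <;> simp [hyB]
    intro y
    rcases mul_eq_zero.1 (congrFun h y) with h1 | h1
    · exact Or.inl h1
    · exact Or.inr (sub_eq_zero.1 h1)
  have hw₁0 : ∀ y, 0 ≤ w₁ y := fun y => by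
    rcases hdich y with h | h <;> rw [h]
    exact hw0 y
  -- The gap at which `w₁` jumps from `1` to `0`.
  have hc1 : IsCompact (Icc p q ∩ {y | w₁ y = 1}) :=
    isCompact_Icc.inter_right (isClosed_eq hH₁.continuous continuous_const)
  obtain ⟨s, ⟨hs, hs1⟩, hsmax⟩ := hc1.exists_isGreatest ⟨p, ⟨le_rfl, hpq.le⟩, hp⟩
  have hc0 : IsCompact (Icc s q ∩ {y | w₁ y = 0}) :=
    isCompact_Icc.inter_right (isClosed_eq hH₁.continuous continuous_const)
  obtain ⟨b, ⟨hb, hb0⟩, hbmin⟩ := hc0.exists_isLeast ⟨q, ⟨hs.2, le_rfl⟩, hq⟩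
  simp only [mem_ofPred_eq] at hs1 hb0
  have hsb : s < b := lt_of_le_of_ne hb.1 fun h => by rw [h, hb0] at hs1; exact zero_ne_one hs1
  have hgap : ∀ y : K, s < y → b ≤ y := by
    intro y hy
    by_contra hyb
    rw [not_le] at hyb
    have hyI : y ∈ Icc p q := ⟨hs.1.trans hy.le, hyb.le.trans hb.2⟩
    rcases hdich y with h | h
    · exact absurd (hbmin ⟨⟨hy.le, hyI.2⟩, h⟩) (not_le.2 hyb)
    · rw [hw1 y hyI] at h
      exact absurd (hsmax ⟨hyI, h⟩) (not_le.2 hy)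
  have hbw : w b = 1 := hw1 b ⟨hs.1.trans hb.1, hb.2⟩
  have hnear : ∀ᶠ y in 𝓝 b, w₁ y < 1 / 2 ∧ 1 / 2 < w y :=
    ((tendsto_order.1 (hH₁.continuous.tendsto b)).2 _ (by rw [hb0]; norm_num)).and
      ((tendsto_order.1 (hH.continuous.tendsto b)).1 _ (by rw [hbw]; norm_num))
  obtain ⟨δ, hδ, hball⟩ := Metric.eventually_nhds_iff.1 hnear
  obtain ⟨v, hv, hv0, Hv, hHv, hneg⟩ := exists_tent (ν := ν) hsb hgap hδ
  set W : Lp ℝ 2 ν := hw.2.1.toLp w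
  set V : Lp ℝ 2 ν := hv.2.1.toLp v
  have hW : W ∈ a.dom := (ha.mem_dom_iff _).2 ⟨w, hw, hw.2.1.coeFn_toLp⟩
  have hV : V ∈ a.dom := (ha.mem_dom_iff _).2 ⟨v, hv, hv.2.1.coeFn_toLp⟩
  have h1 : indicatorL2 hB W =ᵐ[ν] w₁ := by
    filter_upwards [indicatorL2_coeFn hB W, hww₁, hw.2.1.coeFn_toLp] with y h1 h2 h3
    rw [h1, h2]
    by_cases hy : y ∈ B <;> simp [hy, h3, W]
  have h2 : indicatorL2 hB.compl V =ᵐ[ν] v := by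
    filter_upwards [indicatorL2_coeFn hB.compl V, hww₁, hv.2.1.coeFn_toLp] with y h1 h2 h3
    rw [h1]
    by_cases hy : y ∈ B
    · have hvy : v y = 0 := by
        by_contra hne
        obtain ⟨h4, h5⟩ := hv0 y hne
        have h4' : (b : ℝ) ≤ y := h4
        have h6 := hball (y := y) (by
          rw [Subtype.dist_eq, Real.dist_eq, abs_of_nonneg (by linarith)]; linarith)
        rw [h2, indicator_of_mem hy] at h6
        linarith
      simp [hy, hvy]
    · rw [indicator_of_mem hy]
      exact h3
  have h3 := ho W hW V hV
  rw [ha.form_eq _ _ _ _ _ _ hw₁ hv h1 h2 hH₁ hHv] at h3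
  have h4 := hneg w₁ H₁ hH₁ hw₁0 hs1 hb0
  linarith

/-- If `w` is a cutoff function equal to `1` on `[p, q]` and `A` is invariant, then `1_A w` and
`1_{Aᶜ} w` are represented by continuous functions in the domain with sum `w` and product `0`. Neither
of them switches between `1` and `0` on `[p, q]`, so `A` or its complement is null there. -/
theorem IsEnergyForm.isIrreducible (ha : IsEnergyForm a) : a.IsIrreducible := by
  rintro A ⟨hA, T, hT, hTA⟩
  have hinv : ∀ t > 0, ∀ U, T t (indicatorL2 hA U) = indicatorL2 hA (T t U) := fun t ht U =>
    Lp.ext ((hTA t ht U _ (indicatorL2_coeFn hA U)).trans (indicatorL2_coeFn hA _).symm)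
  have hinv' : ∀ t > 0, ∀ U, T t (indicatorL2 hA.compl U) = indicatorL2 hA.compl (T t U) := by
    intro t ht U
    rw [indicatorL2_compl hA, indicatorL2_compl hA, map_sub, hinv t ht]
  obtain ⟨hd, ho⟩ := hT.split hA hinv
  obtain ⟨hd', ho'⟩ := hT.split hA.compl hinv'
  have hd'' : ∀ U ∈ a.dom, indicatorL2 hA.compl.compl U ∈ a.dom := by
    simpa only [compl_compl] using hd
  have hlocal : ∀ p q : K, ν (A ∩ Icc p q) = 0 ∨ ν (Aᶜ ∩ Icc p q) = 0 := by
    intro p q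
    obtain ⟨N, hN, W, C, hWl, hWc, hW0, hW1, hWI, hWN⟩ :=
      exists_cutoff (isCompact_Icc (a := p) (b := q))
    set w : K → ℝ := fun y => W y with hwdef
    have hw : w ∈ energyDomain ν := by
      obtain ⟨H, hH⟩ := exists_isDensity_of_lipschitz (K := K) hWl hWc (p := fun _ => 1)
        contDiff_const
      simp only [mul_one] at hH
      exact mem_energyDomain_of_compact ⟨H, hH⟩ hN hWN
    have hWdom : hw.2.1.toLp w ∈ a.dom := (ha.mem_dom_iff _).2 ⟨w, hw, hw.2.1.coeFn_toLp⟩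
    have key : ∀ {B : Set K} (hB : MeasurableSet B), indicatorL2 hB (hw.2.1.toLp w) ∈ a.dom →
        ∃ w₁ ∈ energyDomain ν, w₁ =ᵐ[ν] B.indicator w := by
      intro B hB h
      obtain ⟨w₁, hw₁, h1⟩ := (ha.mem_dom_iff _).1 h
      refine ⟨w₁, hw₁, ?_⟩
      filter_upwards [h1, indicatorL2_coeFn hB (hw.2.1.toLp w), hw.2.1.coeFn_toLp] with y h1 h2 h3
      rw [← h1, h2]
      by_cases hy : y ∈ B <;> simp [hy, h3]
    obtain ⟨w₁, hw₁, hww₁⟩ := key hA (hd _ hWdom)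
    obtain ⟨w₂, hw₂, hww₂⟩ := key hA.compl (hd' _ hWdom)
    obtain ⟨H, hH⟩ := hw.1
    obtain ⟨H₁, hH₁⟩ := hw₁.1
    obtain ⟨H₂, hH₂⟩ := hw₂.1
    have hsum : ∀ y, w₁ y + w₂ y = w y := by
      refine congrFun (Continuous.ae_eq_iff_eq ν (hH₁.continuous.add hH₂.continuous)
        hH.continuous |>.1 ?_)
      filter_upwards [hww₁, hww₂] with y h1 h2
      simp only [Pi.add_apply]
      rw [h1, h2]
      by_cases hy : y ∈ A <;> simp [hy]
    have hprod : ∀ y, w₁ y * w₂ y = 0 := by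
      refine congrFun (Continuous.ae_eq_iff_eq ν (hH₁.continuous.mul hH₂.continuous)
        continuous_const |>.1 ?_)
      filter_upwards [hww₁, hww₂] with y h1 h2
      simp only [Pi.mul_apply]
      rw [h1, h2]
      by_cases hy : y ∈ A <;> simp [hy]
    -- `w₁` is constant on `[p, q]`.
    have hmono : ∀ x ∈ Icc p q, ∀ y ∈ Icc p q, x < y → w₁ x = w₁ y := by
      intro x hx y hy hxy
      have hwI : ∀ z ∈ Icc x y, w z = 1 := fun z hz => hWI z ⟨hx.1.trans hz.1, hz.2.trans hy.2⟩
      have hx1 := hsum x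
      have hy1 := hsum y
      rw [hwI x ⟨le_rfl, hxy.le⟩] at hx1
      rw [hwI y ⟨hxy.le, le_rfl⟩] at hy1
      rcases mul_eq_zero.1 (hprod x) with h1 | h1 <;> rcases mul_eq_zero.1 (hprod y) with h2 | h2
      · rw [h1, h2]
      · exfalso
        rw [h1, zero_add] at hx1
        refine ha.not_switch hA.compl (fun U hU V hV =>
          ho' U hU V hV (hd' U hU) (hd'' V hV)) hw hw₂ hww₂ (fun z => hW0 z) hxy hwI hx1 h2
      · exfalso
        rw [h1, add_zero] at hx1
        exact ha.not_switch hA (fun U hU V hV =>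
          ho U hU V hV (hd U hU) (hd' V hV)) hw hw₁ hww₁ (fun z => hW0 z) hxy hwI hx1 h2
      · rw [h1, add_zero] at hx1
        rw [h2, add_zero] at hy1
        rw [hx1, hy1]
    by_cases hne : (Icc p q).Nonempty
    · obtain ⟨x, hx⟩ := hne
      have hconst : ∀ y ∈ Icc p q, w₁ y = w₁ x := by
        intro y hy
        rcases lt_trichotomy x y with h | h | h
        · exact (hmono x hx y hy h).symm
        · rw [h]
        · exact hmono y hy x hx h
      have hx1 := hsum x
      rw [show w x = 1 from hWI x hx] at hx1
      rcases mul_eq_zero.1 (hprod x) with h1 | h1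
      · left
        have hnull : ∀ᵐ y ∂ν, y ∉ A ∩ Icc p q := by
          filter_upwards [hww₁] with y hy hyA
          rw [hconst y hyA.2, h1, indicator_of_mem hyA.1] at hy
          exact zero_ne_one (hy.trans (hWI y hyA.2))
        exact measure_eq_zero_iff_ae_notMem.2 hnull
      · right
        rw [h1, add_zero] at hx1
        have hnull : ∀ᵐ y ∂ν, y ∉ Aᶜ ∩ Icc p q := by
          filter_upwards [hww₁] with y hy hyA
          rw [hconst y hyA.2, hx1, indicator_of_notMem hyA.1] at hy
          exact zero_ne_one hy.symm
        exact measure_eq_zero_iff_ae_notMem.2 hnull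
    · left
      rw [not_nonempty_iff_eq_empty.1 hne, inter_empty, measure_empty]
  have hexh : ∀ B : Set K, ν B ≠ 0 → ∃ p q : K, ν (B ∩ Icc p q) ≠ 0 := by
    intro B hB
    by_contra hcon
    push Not at hcon
    refine hB (measure_null_of_locally_null B fun x _ => ?_)
    obtain ⟨c, d, hcd⟩ := exists_Icc_mem_nhds_subtype x
    exact ⟨B ∩ Icc c d, inter_mem self_mem_nhdsWithin (mem_nhdsWithin_of_mem_nhds hcd), hcon c d⟩
  by_contra hcon
  push Not at hcon
  obtain ⟨p, q, hpq⟩ := hexh A hcon.1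
  obtain ⟨p', q', hpq'⟩ := hexh Aᶜ hcon.2
  rcases hlocal (min p p') (max q q') with h | h
  · exact hpq (measure_mono_null (inter_subset_inter_right A
      (Icc_subset_Icc (min_le_left _ _) (le_max_left _ _))) h)
  · exact hpq' (measure_mono_null (inter_subset_inter_right Aᶜ
      (Icc_subset_Icc (min_le_right _ _) (le_max_right _ _))) h)

end Irreducible

/-! ### The algebra of bounded functions and transport of forms -/

/-- For a measure of full support, an essential bound of a continuous function is a bound. -/
theorem exists_bound_of_eLpNorm_top_lt {K : Set ℝ} {ν : Measure K} [ν.IsOpenPosMeasure] {u : K → ℝ}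
    (hu : Continuous u) (h : eLpNorm u ∞ ν < ∞) : ∃ M : ℝ, 0 ≤ M ∧ ∀ y, |u y| ≤ M := by
  refine ⟨(eLpNorm u ∞ ν).toReal, ENNReal.toReal_nonneg, fun y => ?_⟩
  have hae : ∀ᵐ z ∂ν, |u z| ≤ (eLpNorm u ∞ ν).toReal := by
    filter_upwards [ae_le_eLpNormEssSup (f := u) (μ := ν)] with z hz
    rw [← eLpNorm_exponent_top] at hz
    have h1 := ENNReal.toReal_mono h.ne hz
    simpa using h1
  have hcl : IsClosed {z | |u z| ≤ (eLpNorm u ∞ ν).toReal} :=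
    isClosed_le hu.abs continuous_const
  have hd : Dense {z | |u z| ≤ (eLpNorm u ∞ ν).toReal} := Measure.dense_of_ae hae
  have h1 := hd y
  rw [hcl.closure_eq] at h1
  exact h1

/-- The bounded functions of the domain form an algebra. -/
theorem IsEnergyForm.exists_mul {K : Set ℝ} {ν : Measure K} [ν.IsOpenPosMeasure] {a : L2Form ν}
    (ha : IsEnergyForm a) {U V : Lp ℝ 2 ν} (hU : U ∈ a.bddDom) (hV : V ∈ a.bddDom) :
    ∃ W ∈ a.bddDom, ∀ᵐ y ∂ν, W y = U y * V y := by
  obtain ⟨u, hu, hUu⟩ := (ha.mem_dom_iff U).1 hU.1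
  obtain ⟨v, hv, hVv⟩ := (ha.mem_dom_iff V).1 hV.1
  obtain ⟨H, hH⟩ := hu.1
  obtain ⟨H', hH'⟩ := hv.1
  obtain ⟨M, hM0, hM⟩ := exists_bound_of_eLpNorm_top_lt hH.continuous (by
    rw [← eLpNorm_congr_ae hUu]; exact hU.2)
  obtain ⟨M', hM'0, hM'⟩ := exists_bound_of_eLpNorm_top_lt hH'.continuous (by
    rw [← eLpNorm_congr_ae hVv]; exact hV.2)
  obtain ⟨H'', hH''⟩ := hH.exists_mul hH' (hM0.trans (le_max_left M M'))
    (fun y => (hM y).trans (le_max_left _ _)) (fun y => (hM' y).trans (le_max_right _ _))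
  have hmem : MemLp (u * v) 2 ν := by
    refine (hv.2.1.const_mul M).of_le (hu.2.1.1.mul hv.2.1.1) (Eventually.of_forall fun y => ?_)
    rw [Pi.mul_apply, norm_mul, norm_mul]
    gcongr
    rw [Real.norm_eq_abs, Real.norm_eq_abs, abs_of_nonneg hM0]
    exact hM y
  have hdom : u * v ∈ energyDomain ν := ⟨⟨H'', hH''⟩, hmem, fun j hj => by
    have h := (hu.2.2 j hj).mul (hv.2.2 j hj)
    rwa [mul_zero] at h⟩
  refine ⟨hmem.toLp _, ⟨(ha.mem_dom_iff _).2 ⟨_, hdom, hmem.coeFn_toLp⟩, ?_⟩, ?_⟩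
  · rw [eLpNorm_congr_ae hmem.coeFn_toLp, eLpNorm_exponent_top]
    refine lt_of_le_of_lt (eLpNormEssSup_le_of_ae_bound (C := M * M') (Eventually.of_forall
      fun y => ?_)) ENNReal.ofReal_lt_top
    rw [Pi.mul_apply, norm_mul]
    have h1 : ‖u y‖ ≤ M := hM y
    have h2 : ‖v y‖ ≤ M' := hM' y
    gcongr
  · filter_upwards [hmem.coeFn_toLp, hUu, hVv] with y h1 h2 h3
    rw [h1, h2, h3]; rfl

section Pull

variable {X Y : Type*} [MeasurableSpace X] [MeasurableSpace Y] {μ : Measure X} {ν : Measure Y}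
  {S : Set X} {q : X → Y}

theorem memLp_indicator_comp (hS : MeasurableSet S) (hq : Measurable q)
    (hν : ν = (μ.restrict S).map q) {u : Y → ℝ} (hu : MemLp u 2 ν) :
    MemLp (S.indicator (u ∘ q)) 2 μ := by
  rw [memLp_indicator_iff_restrict hS]
  subst hν
  exact hu.comp_of_map hq.aemeasurable

/-- The isometry of `L²(ν)` into `L²(μ)` given by composition with `q` on `S` and by `0` outside
`S`, where `ν` is the image under `q` of the restriction of `μ` to `S`. -/
noncomputable def pullL2 (hS : MeasurableSet S) (hq : Measurable q)
    (hν : ν = (μ.restrict S).map q) (U : Lp ℝ 2 ν) : Lp ℝ 2 μ :=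
  (memLp_indicator_comp hS hq hν (Lp.memLp U)).toLp _

theorem ae_pull (hS : MeasurableSet S) (hq : Measurable q)
    (hν : ν = (μ.restrict S).map q) {p : Y → Prop} (h : ∀ᵐ y ∂ν, p y) :
    ∀ᵐ x ∂μ, x ∈ S → p (q x) := by
  rw [← ae_restrict_iff' hS]
  subst hν
  exact ae_of_ae_map hq.aemeasurable h

variable (hS : MeasurableSet S) (hq : Measurable q) (hν : ν = (μ.restrict S).map q)

theorem pullL2_coeFn {U : Lp ℝ 2 ν} {u : Y → ℝ} (h : U =ᵐ[ν] u) :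
    pullL2 hS hq hν U =ᵐ[μ] S.indicator (u ∘ q) := by
  filter_upwards [(memLp_indicator_comp hS hq hν (Lp.memLp U)).coeFn_toLp,
    ae_pull hS hq hν h] with x h1 h2
  rw [pullL2, h1]
  by_cases hx : x ∈ S
  · simp [hx, h2 hx]
  · simp [hx]

theorem pullL2_add (U V : Lp ℝ 2 ν) :
    pullL2 hS hq hν (U + V) = pullL2 hS hq hν U + pullL2 hS hq hν V := by
  refine Lp.ext ((pullL2_coeFn hS hq hν (Lp.coeFn_add U V)).trans ?_)
  filter_upwards [pullL2_coeFn hS hq hν (EventuallyEq.refl _ U),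
    pullL2_coeFn hS hq hν (EventuallyEq.refl _ V),
    Lp.coeFn_add (pullL2 hS hq hν U) (pullL2 hS hq hν V)] with x h1 h2 h3
  rw [h3, Pi.add_apply, h1, h2]
  by_cases hx : x ∈ S <;> simp [hx]

theorem pullL2_smul (c : ℝ) (U : Lp ℝ 2 ν) :
    pullL2 hS hq hν (c • U) = c • pullL2 hS hq hν U := by
  refine Lp.ext ((pullL2_coeFn hS hq hν (Lp.coeFn_smul c U)).trans ?_)
  filter_upwards [pullL2_coeFn hS hq hν (EventuallyEq.refl _ U),
    Lp.coeFn_smul c (pullL2 hS hq hν U)] with x h1 h3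
  rw [h3, Pi.smul_apply, h1]
  by_cases hx : x ∈ S <;> simp [hx]

theorem inner_pullL2 (U V : Lp ℝ 2 ν) :
    (inner ℝ (pullL2 hS hq hν U) (pullL2 hS hq hν V) : ℝ) = inner ℝ U V := by
  rw [L2.inner_def, L2.inner_def]
  have h1 : ∫ y, inner ℝ (U y) (V y) ∂ν = ∫ x in S, inner ℝ (U (q x)) (V (q x)) ∂μ := by
    have hm : AEStronglyMeasurable (fun y => (inner ℝ (U y) (V y) : ℝ)) ν :=
      (Lp.aestronglyMeasurable U).inner (Lp.aestronglyMeasurable V)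
    have h := integral_map (μ := μ.restrict S) hq.aemeasurable (by rwa [← hν])
    rw [← hν] at h
    exact h
  rw [h1, ← integral_indicator hS]
  refine integral_congr_ae ?_
  filter_upwards [pullL2_coeFn hS hq hν (EventuallyEq.refl _ U),
    pullL2_coeFn hS hq hν (EventuallyEq.refl _ V)] with x h1 h2
  rw [h1, h2]
  by_cases hx : x ∈ S <;> simp [hx]

theorem pullL2_sub (U V : Lp ℝ 2 ν) :
    pullL2 hS hq hν (U - V) = pullL2 hS hq hν U - pullL2 hS hq hν V := by
  have h := pullL2_add hS hq hν (U - V) V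
  rw [sub_add_cancel] at h
  rw [h, add_sub_cancel_right]

theorem pullL2_injective : Function.Injective (pullL2 hS hq hν) := by
  intro U V h
  rw [← sub_eq_zero, ← inner_self_eq_zero (𝕜 := ℝ), ← inner_pullL2 hS hq hν, pullL2_sub, h,
    sub_self, inner_zero_left]

theorem eLpNorm_top_pullL2 (U : Lp ℝ 2 ν) :
    eLpNorm (pullL2 hS hq hν U) ∞ μ = eLpNorm U ∞ ν := by
  rw [eLpNorm_congr_ae (pullL2_coeFn hS hq hν (EventuallyEq.refl _ U)),
    eLpNorm_indicator_eq_eLpNorm_restrict hS]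
  have h := eLpNorm_map_measure (p := ∞) (f := q) (μ := μ.restrict S) (g := ⇑U)
    (by rw [← hν]; exact Lp.aestronglyMeasurable U) hq.aemeasurable
  rw [← hν] at h
  exact h.symm

variable {a : L2Form μ} {b : L2Form ν}

/-- The properties of a Dirichlet form in the wide sense are inherited by its image under
`pullL2`. The image need not be dense, even if the domain of `b` is. -/
theorem L2Form.IsDirichletWide.pull (hb : b.IsDirichletWide)
    (hdom : a.dom = pullL2 hS hq hν '' b.dom)
    (hform : ∀ U ∈ b.dom, ∀ V ∈ b.dom,
      a.form (pullL2 hS hq hν U) (pullL2 hS hq hν V) = b.form U V) : a.IsDirichletWide := by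
  have hsub : ∀ U ∈ b.dom, ∀ V ∈ b.dom, U - V ∈ b.dom := fun U hU V hV => by
    have h := hb.add_mem U hU _ (hb.smul_mem (-1) V hV)
    rwa [neg_smul, one_smul, ← sub_eq_add_neg] at h
  have hE : ∀ U ∈ b.dom, a.energyOne (pullL2 hS hq hν U) = b.energyOne U := fun U hU => by
    rw [L2Form.energyOne, L2Form.energyOne, hform U hU U hU, inner_pullL2]
  have hzero : pullL2 hS hq hν 0 = 0 := by
    have h := pullL2_smul hS hq hν 0 0
    rwa [zero_smul, zero_smul] at h
  refine ⟨?_, ?_, ?_, ?_, ?_, ?_, ?_, ?_, ?_⟩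
  · rw [hdom]; exact ⟨0, hb.zero_mem, hzero⟩
  · rw [hdom]; rintro _ ⟨U, hU, rfl⟩ _ ⟨V, hV, rfl⟩
    exact ⟨U + V, hb.add_mem U hU V hV, pullL2_add hS hq hν U V⟩
  · rw [hdom]; rintro c _ ⟨U, hU, rfl⟩
    exact ⟨c • U, hb.smul_mem c U hU, pullL2_smul hS hq hν c U⟩
  · rw [hdom]; rintro _ ⟨U, hU, rfl⟩ _ ⟨V, hV, rfl⟩ _ ⟨W, hW, rfl⟩
    rw [← pullL2_add, hform _ (hb.add_mem U hU V hV) W hW, hform U hU W hW, hform V hV W hW,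
      hb.add_left U hU V hV W hW]
  · rw [hdom]; rintro c _ ⟨U, hU, rfl⟩ _ ⟨V, hV, rfl⟩
    rw [← pullL2_smul, hform _ (hb.smul_mem c U hU) V hV, hform U hU V hV,
      hb.smul_left c U hU V hV]
  · rw [hdom]; rintro _ ⟨U, hU, rfl⟩ _ ⟨V, hV, rfl⟩
    rw [hform U hU V hV, hform V hV U hU, hb.symm U hU V hV]
  · rw [hdom]; rintro _ ⟨U, hU, rfl⟩
    rw [hform U hU U hU]; exact hb.nonneg U hU
  · intro u hu hC
    rw [hdom] at hu
    choose U hU hUu using hu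
    obtain rfl : (fun n => pullL2 hS hq hν (U n)) = u := funext hUu
    simp only [← pullL2_sub] at hC
    obtain ⟨V, hV, hlim⟩ := hb.closed U hU fun ε hε => by
      obtain ⟨N, hN⟩ := hC ε hε
      refine ⟨N, fun p hp r hr => ?_⟩
      rw [← hE _ (hsub _ (hU p) _ (hU r))]
      exact hN p hp r hr
    refine ⟨pullL2 hS hq hν V, hdom ▸ ⟨V, hV, rfl⟩, ?_⟩
    simp only [← pullL2_sub]
    exact hlim.congr fun n => (hE _ (hsub _ (hU n) V hV)).symm
  · rw [hdom]; rintro _ ⟨U, hU, rfl⟩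
    obtain ⟨V, hV, hVU, hle⟩ := hb.markov U hU
    refine ⟨_, ⟨V, hV, rfl⟩, ?_, by rwa [hform V hV V hV, hform U hU U hU]⟩
    filter_upwards [pullL2_coeFn hS hq hν hVU,
      pullL2_coeFn hS hq hν (EventuallyEq.refl _ U)] with x h1 h2
    rw [h1, h2]
    by_cases hx : x ∈ S <;> simp [hx]

/-- The isometry `pullL2` is an equivalence of Dirichlet spaces onto its image. -/
theorem L2Form.IsDirichletWide.equivalent_pull (hb : b.IsDirichletWide)
    (hdom : a.dom = pullL2 hS hq hν '' b.dom)
    (hform : ∀ U ∈ b.dom, ∀ V ∈ b.dom,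
      a.form (pullL2 hS hq hν U) (pullL2 hS hq hν V) = b.form U V)
    (hmul : ∀ U ∈ b.bddDom, ∀ V ∈ b.bddDom, ∃ W ∈ b.bddDom, ∀ᵐ y ∂ν, W y = U y * V y) :
    a.Equivalent b := by
  have hinj := pullL2_injective hS hq hν
  have hinv : ∀ U, Function.invFun (pullL2 hS hq hν) (pullL2 hS hq hν U) = U :=
    Function.leftInverse_invFun hinj
  have hbdd : a.bddDom = pullL2 hS hq hν '' b.bddDom := by
    ext u
    constructor
    · rintro ⟨h1, h2⟩
      rw [hdom] at h1
      obtain ⟨U, hU, rfl⟩ := h1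
      rw [eLpNorm_top_pullL2] at h2
      exact ⟨U, ⟨hU, h2⟩, rfl⟩
    · rintro ⟨U, ⟨hU, h2⟩, rfl⟩
      rw [← eLpNorm_top_pullL2 hS hq hν] at h2
      exact ⟨hdom ▸ ⟨U, hU, rfl⟩, h2⟩
  refine ⟨hb.pull hS hq hν hdom hform, hb, Function.invFun (pullL2 hS hq hν), ?_, ?_, ?_, ?_, ?_⟩
  · rw [hbdd]
    refine ⟨?_, ?_, ?_⟩
    · rintro _ ⟨U, hU, rfl⟩
      rwa [hinv]
    · rintro _ ⟨U, -, rfl⟩ _ ⟨V, -, rfl⟩ h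
      rw [hinv, hinv] at h
      rw [h]
    · intro U hU
      exact ⟨_, ⟨U, hU, rfl⟩, hinv U⟩
  · rw [hbdd]
    rintro _ ⟨U, -, rfl⟩ _ ⟨V, -, rfl⟩
    rw [← pullL2_add, hinv, hinv, hinv]
  · rw [hbdd]
    rintro c _ ⟨U, -, rfl⟩
    rw [← pullL2_smul, hinv, hinv]
  · rw [hbdd]
    rintro _ ⟨U, hU, rfl⟩ _ ⟨V, hV, rfl⟩
    obtain ⟨W, hW, hWUV⟩ := hmul U hU V hV
    refine ⟨_, ⟨W, hW, rfl⟩, ?_, by rwa [hinv, hinv, hinv]⟩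
    filter_upwards [pullL2_coeFn hS hq hν hWUV, pullL2_coeFn hS hq hν (EventuallyEq.refl _ U),
      pullL2_coeFn hS hq hν (EventuallyEq.refl _ V)] with x h1 h2 h3
    rw [h1, h2, h3]
    by_cases hx : x ∈ S <;> simp [hx]
  · rw [hbdd]
    rintro _ ⟨U, hU, rfl⟩
    rw [hinv, eLpNorm_top_pullL2, inner_pullL2, hform U hU.1 U hU.1]
    exact ⟨rfl, rfl, rfl⟩

end Pull

/-! ### Gaps and the description of the density space -/

/-- The pairs of consecutive points of `K`: the ends of the bounded gaps of `K`. -/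
def gapPairs (K : Set ℝ) : Set (K × K) :=
  {p | p.1 < p.2 ∧ ∀ z : K, z ≤ p.1 ∨ p.2 ≤ z}

/-- The union of the gaps of `K`. -/
def gapUnion (K : Set ℝ) : Set ℝ := ⋃ p : gapPairs K, Ioo (p.1.1 : ℝ) p.1.2

section Gaps

variable {K : Set ℝ}

theorem gapPairs_disjoint :
    Pairwise (Function.onFun Disjoint fun p : gapPairs K => Ioo (p.1.1 : ℝ) p.1.2) := by
  rintro ⟨⟨a, b⟩, hab, h⟩ ⟨⟨c, d⟩, hcd, h'⟩ hne
  refine Set.disjoint_left.2 fun y hy hy' => hne ?_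
  change a < b at hab
  change c < d at hcd
  change ∀ z : K, z ≤ a ∨ b ≤ z at h
  change ∀ z : K, z ≤ c ∨ d ≤ z at h'
  change y ∈ Ioo (a : ℝ) b at hy
  change y ∈ Ioo (c : ℝ) d at hy'
  have hmk : ∀ {u v : K}, (u : ℝ) < v → ¬ v ≤ u := fun h => not_le.2 h
  have h1 : c ≤ a := (h c).resolve_right (hmk (hy'.1.trans hy.2))
  have h2 : a ≤ c := (h' a).resolve_right (hmk (hy.1.trans hy'.2))
  have h3 : b ≤ d := (h d).resolve_left (hmk (hy.1.trans hy'.2))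
  have h4 : d ≤ b := (h' b).resolve_left (hmk (hy'.1.trans hy.2))
  exact Subtype.ext (Prod.ext (le_antisymm h2 h1) (le_antisymm h3 h4))

instance : Countable (gapPairs K) :=
  gapPairs_disjoint.countable_of_isOpen_disjoint (fun _ => isOpen_Ioo) fun p => nonempty_Ioo.2 p.2.1

theorem isOpen_gapUnion : IsOpen (gapUnion K) := isOpen_iUnion fun _ => isOpen_Ioo

theorem disjoint_gapUnion : Disjoint K (gapUnion K) := by
  refine Set.disjoint_left.2 fun y hy hy' => ?_
  obtain ⟨⟨p, hp⟩, hyp⟩ := mem_iUnion.1 hy'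
  rcases hp.2 ⟨y, hy⟩ with h | h
  · exact not_le.2 hyp.1 h
  · exact not_le.2 hyp.2 h

/-- A point outside `K` between two points of `K` lies in a gap: `K` has a last point before it and
a first point after it by the compactness of its intervals. -/
theorem mem_gapUnion [CompactIccSpace K] {a b : K} {y : ℝ} (hy : y ∉ K) (hay : (a : ℝ) < y)
    (hyb : y < b) : y ∈ gapUnion K := by
  have hc : IsCompact (Icc a b ∩ {z : K | (z : ℝ) ≤ y}) :=
    isCompact_Icc.inter_right (isClosed_le continuous_subtype_val continuous_const)
  have hd : IsCompact (Icc a b ∩ {z : K | y ≤ (z : ℝ)}) :=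
    isCompact_Icc.inter_right (isClosed_le continuous_const continuous_subtype_val)
  have hab : a ≤ b := (hay.trans hyb).le
  obtain ⟨p, hp, hpmax⟩ := hc.exists_isGreatest ⟨a, ⟨le_rfl, hab⟩, hay.le⟩
  obtain ⟨q, hq, hqmin⟩ := hd.exists_isLeast ⟨b, ⟨hab, le_rfl⟩, hyb.le⟩
  have hpy : (p : ℝ) < y := lt_of_le_of_ne hp.2 fun h => hy (h ▸ p.2)
  have hyq : y < q := lt_of_le_of_ne hq.2 fun h => hy (h ▸ q.2)
  refine mem_iUnion.2 ⟨⟨(p, q), hpy.trans hyq, fun z => ?_⟩, hpy, hyq⟩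
  rcases le_total (z : ℝ) y with h | h
  · refine Or.inl ?_
    rcases le_total z a with hz | hz
    · exact hz.trans hp.1.1
    · exact hpmax ⟨⟨hz, (h.trans hyb.le : (z : ℝ) ≤ b)⟩, h⟩
  · refine Or.inr ?_
    rcases le_total b z with hz | hz
    · exact hq.1.2.trans hz
    · exact hqmin ⟨⟨(hay.le.trans h : (a : ℝ) ≤ z), hz⟩, h⟩

theorem measurableSet_of_compactIcc [CompactIccSpace K] : MeasurableSet K := by
  have h1 : LocallyCompactSpace K := locallyCompactSpace_of_compactIcc
  have h2 : IsSigmaCompact (univ : Set K) := isSigmaCompact_univ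
  obtain ⟨C, hC, hCu⟩ := h2.image continuous_subtype_val
  rw [image_univ, Subtype.range_coe] at hCu
  rw [← hCu]
  exact MeasurableSet.iUnion fun n => (hC n).measurableSet

theorem disjoint_Ioc_compl_gapUnion [CompactIccSpace K] :
    ∀ a ∈ K, ∀ b ∈ K, Disjoint (Ioc a b) (K ∪ gapUnion K)ᶜ := by
  intro a ha b hb
  refine Set.disjoint_left.2 fun y hy hy' => hy' ?_
  by_cases h : y ∈ K
  · exact Or.inl h
  · exact Or.inr (mem_gapUnion (a := ⟨a, ha⟩) (b := ⟨b, hb⟩) h hy.1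
      (lt_of_le_of_ne hy.2 fun h' => h (h' ▸ hb)))

/-- All but countably many points of `K` are accumulation points of `K`. -/
theorem ae_accPt : ∀ᵐ y : ℝ, y ∈ K → AccPt y (𝓟 K) := by
  have h := (countable_setOfPred_isolated_right_within (s := K)).measure_zero volume
  filter_upwards [compl_mem_ae_iff.2 h] with y hy hyK
  rw [accPt_principal_iff_nhdsWithin]
  by_contra hcon
  refine hy ⟨hyK, ?_⟩
  rw [not_neBot] at hcon
  exact bot_unique (hcon ▸ nhdsWithin_mono y fun z hz => ⟨hz.1, ne_of_gt hz.2⟩)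

/-- Elements `H` of the density space are constant on gaps: the difference on the gap of `H` and its
mean, extended by `0`, is orthogonal to all steps between points of `K`, hence to `H` and to itself,
so it vanishes. -/
theorem densitySpace_ae_const {H : LineL2} (hH : H ∈ densitySpace K) {a b : ℝ} (hab : a < b)
    (hgap : ∀ z ∈ K, z ≤ a ∨ b ≤ z) :
    ∃ c : ℝ, ∀ᵐ y, y ∈ Ioo a b → H y = c := by
  have hA : MeasurableSet (Ioc a b) := measurableSet_Ioc
  have hw : ⇑(stepL2 a b) =ᵐ[volume] (Ioc a b).indicator fun _ => (1 : ℝ) :=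
    indicatorConstLp_coeFn
  have hwn : inner ℝ (stepL2 a b) (stepL2 a b) = b - a := by
    rw [real_inner_self_eq_norm_sq, norm_stepL2_sq hab.le]
  set c : ℝ := inner ℝ (stepL2 a b) H / (b - a) with hc
  set H' : LineL2 := indicatorL2 hA H - c • stepL2 a b with hH'
  have hAw : indicatorL2 hA (stepL2 a b) = stepL2 a b := by
    refine Lp.ext ?_
    filter_upwards [hw, indicatorL2_coeFn hA (stepL2 a b)] with y h1 h2
    rw [h2]
    by_cases hy : y ∈ Ioc a b <;> simp [h1, hy]
  have hstep : ∀ x ∈ K, ∀ y ∈ K, x ≤ y →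
      indicatorL2 hA (stepL2 x y) = stepL2 a b ∨ indicatorL2 hA (stepL2 x y) = 0 := by
    intro x hx y hy _
    have hs : ⇑(stepL2 x y) =ᵐ[volume] (Ioc x y).indicator fun _ => (1 : ℝ) :=
      indicatorConstLp_coeFn
    by_cases hin : x ≤ a ∧ b ≤ y
    · left
      refine Lp.ext ?_
      filter_upwards [hw, hs, indicatorL2_coeFn hA (stepL2 x y)] with z h1 h2 h3
      rw [h3, h1]
      by_cases hz : z ∈ Ioc a b
      · have : z ∈ Ioc x y := ⟨hin.1.trans_lt hz.1, hz.2.trans hin.2⟩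
        rw [indicator_of_mem hz, h2, indicator_of_mem this, indicator_of_mem hz]
      · rw [indicator_of_notMem hz, indicator_of_notMem hz]
    · right
      refine Lp.ext ?_
      filter_upwards [hs, indicatorL2_coeFn hA (stepL2 x y), Lp.coeFn_zero ℝ 2 volume]
        with z h2 h3 h4
      rw [h3, h4]
      by_cases hz : z ∈ Ioc a b
      · have : z ∉ Ioc x y := fun h => by
          refine hin ⟨(hgap x hx).resolve_right fun h' => ?_, (hgap y hy).resolve_left fun h' => ?_⟩
          · linarith [h.1, hz.2]
          · linarith [h.2, hz.1]
        rw [indicator_of_mem hz, h2, indicator_of_notMem this, Pi.zero_apply]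
      · rw [indicator_of_notMem hz, Pi.zero_apply]
  have hba : b - a ≠ 0 := (sub_pos.2 hab).ne'
  have horth : inner ℝ H' H = (0 : ℝ) := by
    have h1 : densitySpace K ≤ (Submodule.span ℝ {H'})ᗮ := by
      refine Submodule.topologicalClosure_minimal _ ?_ (Submodule.isClosed_orthogonal _)
      rw [Submodule.span_le]
      rintro _ ⟨x, hx, y, hy, hxy, rfl⟩
      rw [SetLike.mem_coe, Submodule.mem_orthogonal_singleton_iff_inner_left, hH',
        inner_sub_right, inner_smul_right, ← inner_indicatorL2, ← hAw, ← inner_indicatorL2]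
      rcases hstep x hx y hy hxy with h | h
      · rw [h, hwn, hc]; field_simp; ring
      · rw [h]; simp
    exact (Submodule.mem_orthogonal_singleton_iff_inner_right.1 (h1 hH))
  have hAH' : indicatorL2 hA H' = H' := by
    have : indicatorL2 hA (c • stepL2 a b) = c • stepL2 a b := by
      refine Lp.ext ?_
      filter_upwards [hw, indicatorL2_coeFn hA (c • stepL2 a b), Lp.coeFn_smul c (stepL2 a b)]
        with y h1 h2 h3
      rw [h2]
      by_cases hy : y ∈ Ioc a b <;> simp [h3, h1, hy]
    rw [hH', indicatorL2_sub, indicatorL2_idem, this]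
  have hzero : H' = 0 := by
    rw [← inner_self_eq_zero (𝕜 := ℝ)]
    nth_rewrite 2 [hH']
    rw [inner_sub_right, ← inner_indicatorL2, hAH', horth, inner_smul_right, zero_sub,
      real_inner_comm, hH', inner_sub_right, inner_smul_right, hwn, ← inner_indicatorL2, hAw, hc]
    field_simp; ring
  refine ⟨c, ?_⟩
  rw [hH', sub_eq_zero] at hzero
  have h5 := indicatorL2_coeFn hA H
  rw [hzero] at h5
  filter_upwards [h5, Lp.coeFn_smul c (stepL2 a b), hw] with y h1 h2 h3 hy
  have hy' : y ∈ Ioc a b := Ioo_subset_Ioc_self hy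
  rw [indicator_of_mem hy'] at h1
  rw [← h1, h2, Pi.smul_apply, h3, indicator_of_mem hy', smul_eq_mul, mul_one]

/-- Square integrable functions which vanish outside the convex hull of `K` and are constant on
the gaps of `K` belong to the density space: the difference to the projection onto the density space
has integral `0` between any two points of `K`. So it vanishes on gaps, where it is constant, and
almost everywhere on `K`, by differentiation of its primitive along `K`. -/
theorem mem_densitySpace_of_const [CompactIccSpace K] {h : LineL2}
    (hoff : ∀ᵐ y, y ∉ K → y ∉ gapUnion K → h y = 0)
    (hgap : ∀ p ∈ gapPairs K, ∃ c : ℝ, ∀ᵐ y, y ∈ Ioo (p.1 : ℝ) p.2 → h y = c) :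
    h ∈ densitySpace K := by
  set P : LineL2 := (densitySpace K).starProjection h with hP
  have hPm : P ∈ densitySpace K := Submodule.starProjection_apply_mem _ _
  set d : LineL2 := h - P with hd
  have hdae : ⇑d =ᵐ[volume] fun y => h y - P y := Lp.coeFn_sub h P
  have hint : ∀ a b : K, a ≤ b → ∫ y in (a : ℝ)..b, d y = 0 := fun a b hab => by
    have hab' : (a : ℝ) ≤ b := hab
    rw [← inner_stepL2 hab', hd, hP]
    exact Submodule.inner_right_of_mem_orthogonal (stepL2_mem_densitySpace a.2 b.2 hab')
      (Submodule.sub_starProjection_mem_orthogonal h)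
  have hKm : MeasurableSet K := measurableSet_of_compactIcc
  have hoffP := densitySpace_ae_eq_zero hPm
    (hKm.union isOpen_gapUnion.measurableSet).compl disjoint_Ioc_compl_gapUnion
  have hg : ∀ p : gapPairs K, ∀ᵐ y, y ∈ Ioo (p.1.1 : ℝ) p.1.2 → d y = 0 := by
    rintro ⟨p, hp⟩
    obtain ⟨c, hc⟩ := hgap p hp
    obtain ⟨c', hc'⟩ := densitySpace_ae_const hPm hp.1 fun z hz => hp.2 ⟨z, hz⟩
    have hdc : ∀ᵐ y, y ∈ Ioo (p.1 : ℝ) p.2 → d y = c - c' := by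
      filter_upwards [hdae, hc, hc'] with y h1 h2 h3 hy
      rw [h1, h2 hy, h3 hy]
    have hlt : (p.1 : ℝ) < p.2 := hp.1
    have h0 := hint p.1 p.2 hp.1.le
    rw [intervalIntegral.integral_of_le hlt.le, integral_Ioc_eq_integral_Ioo,
      setIntegral_congr_ae measurableSet_Ioo hdc, setIntegral_const] at h0
    have h2 : c - c' = 0 := by
      rcases smul_eq_zero.1 h0 with h | h
      · simp only [Measure.real, Real.volume_Ioo] at h
        rw [ENNReal.toReal_ofReal (by linarith)] at h
        linarith
      · exact h
    filter_upwards [hdc] with y hy hy'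
    rw [hy hy', h2]
  have hd0 : d = 0 := by
    refine Lp.ext ?_
    rcases isEmpty_or_nonempty K with hK | ⟨⟨y₀⟩⟩
    · filter_upwards [hoff, hoffP, hdae, Lp.coeFn_zero ℝ 2 volume] with y h1 h2 h3 h4
      have hy : y ∉ K := fun h => hK.elim ⟨y, h⟩
      have hy' : y ∉ gapUnion K := fun h => by
        obtain ⟨p, _⟩ := mem_iUnion.1 h; exact hK.elim p.1.1
      rw [h3, h4, h1 hy hy', h2 (by simp [hy, hy']), sub_zero, Pi.zero_apply]
    set G : ℝ → ℝ := fun y => ∫ t in (y₀ : ℝ)..y, d t with hG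
    have hGK : ∀ z ∈ K, G z = 0 := fun z hz => by
      rcases le_total (y₀ : ℝ) z with h | h
      · exact hint y₀ ⟨z, hz⟩ h
      · rw [hG]; simp only
        rw [intervalIntegral.integral_symm, hint ⟨z, hz⟩ y₀ h, neg_zero]
    filter_upwards [hoff, hoffP, hdae, Lp.coeFn_zero ℝ 2 volume, ae_all_iff.2 hg, ae_accPt (K := K),
      LocallyIntegrable.ae_hasDerivAt_integral (lineL2_locallyIntegrable d)]
      with y h1 h2 h3 h4 h5 h6 h7
    rw [h4, Pi.zero_apply]
    by_cases hy : y ∈ K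
    · have h8 : HasDerivWithinAt G (d y) K y := (h7 y₀).hasDerivWithinAt
      have h9 : HasDerivWithinAt G 0 K y :=
        (hasDerivWithinAt_const y K (0 : ℝ)).congr_of_mem hGK hy
      exact (h6 hy).uniqueDiffWithinAt.eq_deriv _ h8 h9
    · by_cases hy' : y ∈ gapUnion K
      · obtain ⟨p, hp⟩ := mem_iUnion.1 hy'
        exact h5 p hp
      · rw [h3, h1 hy hy', h2 (by simp [hy, hy']), sub_zero]
  rw [hd, sub_eq_zero] at hd0
  rw [hd0]; exact hPm

end Gaps

/-- A function with density `H` is differentiable along `K` at almost every point of `K`, and the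
norm of `H` splits into the contributions of `K` and of the gaps of `K`. -/
theorem IsDensity.norm_sq_eq {K : Set ℝ} [CompactIccSpace K] {u : K → ℝ} {H : LineL2}
    (h : IsDensity u H) :
    (∀ᵐ x ∂volume.restrict K, DifferentiableWithinAt ℝ (Function.extend Subtype.val u 0) K x) ∧
    IntegrableOn (fun x => derivWithin (Function.extend Subtype.val u 0) K x ^ 2) K ∧
    Summable (fun p : gapPairs K => (u p.1.1 - u p.1.2) ^ 2 / |(p.1.2 : ℝ) - p.1.1|) ∧
    ‖H‖ ^ 2 = (∫ x in K, derivWithin (Function.extend Subtype.val u 0) K x ^ 2) +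
      ∑' p : gapPairs K, (u p.1.1 - u p.1.2) ^ 2 / |(p.1.2 : ℝ) - p.1.1| := by
  have hKm : MeasurableSet K := measurableSet_of_compactIcc
  obtain ⟨G, hGu, hG⟩ := h.exists_primitive
  have hGext : ∀ z ∈ K, Function.extend Subtype.val u 0 z = G z := fun z hz => by
    rw [hGu ⟨z, hz⟩]; exact Subtype.val_injective.extend_apply u 0 ⟨z, hz⟩
  have hder : ∀ᵐ x ∂volume.restrict K,
      HasDerivWithinAt (Function.extend Subtype.val u 0) (H x) K x ∧ AccPt x (𝓟 K) := by
    rw [ae_restrict_iff' hKm]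
    filter_upwards [primitive_ae_hasDerivAt hG, ae_accPt (K := K)] with x h1 h2 hx
    exact ⟨h1.hasDerivWithinAt.congr_of_mem hGext hx, h2 hx⟩
  have hdw : (fun x => derivWithin (Function.extend Subtype.val u 0) K x ^ 2)
      =ᵐ[volume.restrict K] fun x => H x ^ 2 := by
    filter_upwards [hder] with x hx
    rw [hx.1.derivWithin hx.2.uniqueDiffWithinAt]
  have hint : Integrable (fun x => H x ^ 2) volume := (Lp.memLp H).integrable_sq
  have hgap : ∀ p : gapPairs K, ∫ y in Ioo (p.1.1 : ℝ) p.1.2, H y ^ 2 =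
      (u p.1.1 - u p.1.2) ^ 2 / |(p.1.2 : ℝ) - p.1.1| := by
    rintro ⟨⟨a, b⟩, hp⟩
    have hlt : (a : ℝ) < b := hp.1
    obtain ⟨c, hc⟩ := densitySpace_ae_const h.mem hlt fun z hz => hp.2 ⟨z, hz⟩
    have h1 : u b - u a = (b - a) * c := by
      rw [h.sub_eq a b hlt.le, intervalIntegral.integral_of_le hlt.le, integral_Ioc_eq_integral_Ioo,
        setIntegral_congr_ae measurableSet_Ioo hc, setIntegral_const, Measure.real,
        Real.volume_Ioo, ENNReal.toReal_ofReal (by linarith), smul_eq_mul]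
    have h2 : ∀ᵐ y, y ∈ Ioo (a : ℝ) b → H y ^ 2 = c ^ 2 := by
      filter_upwards [hc] with y hy hy'
      rw [hy hy']
    rw [setIntegral_congr_ae measurableSet_Ioo h2, setIntegral_const, Measure.real,
      Real.volume_Ioo, ENNReal.toReal_ofReal (by linarith), smul_eq_mul,
      abs_of_pos (sub_pos.2 hlt), show u a - u b = -((b - a) * c) by rw [← h1]; ring, neg_sq]
    have : (b : ℝ) - a ≠ 0 := (sub_pos.2 hlt).ne'
    field_simp
  have hsum := hasSum_integral_iUnion (μ := volume) (f := fun y => H y ^ 2)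
    (fun p : gapPairs K => measurableSet_Ioo (a := (p.1.1 : ℝ)) (b := p.1.2)) gapPairs_disjoint
    hint.integrableOn
  simp_rw [hgap] at hsum
  refine ⟨hder.mono fun x hx => hx.1.differentiableWithinAt, ?_, hsum.summable, ?_⟩
  · exact (hint.integrableOn (s := K)).congr hdw.symm
  · rw [hsum.tsum_eq, integral_congr_ae hdw, ← real_inner_self_eq_norm_sq, L2.inner_def]
    have hoff := densitySpace_ae_eq_zero h.mem
      (hKm.union isOpen_gapUnion.measurableSet).compl disjoint_Ioc_compl_gapUnion
    have h1 : ∫ y in (K ∪ gapUnion K), H y ^ 2 = ∫ y, H y ^ 2 :=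
      setIntegral_eq_integral_of_ae_compl_eq_zero (by
        filter_upwards [hoff] with y hy hy'
        rw [hy hy']; norm_num)
    rw [show (∫ a, inner ℝ (H a) (H a)) = ∫ y, H y ^ 2 from
      integral_congr_ae (Eventually.of_forall fun y => by simp [pow_two]), ← h1]
    exact setIntegral_union disjoint_gapUnion isOpen_gapUnion.measurableSet hint.integrableOn
      hint.integrableOn

/-! ### The scale function -/

namespace ScaleSpeed

variable (T : ScaleSpeed)

theorem l_lt_r : T.l < T.r := T.l_neg.trans T.r_pos

theorem coe_toReal_of_mem {x : EReal} (hl : T.l < x) (hr : x < T.r) : (x.toReal : EReal) = x :=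
  EReal.coe_toReal (ne_top_of_lt hr) (ne_bot_of_gt hl)

theorem scale_of_mem {x : EReal} (hl : T.l < x) (hr : x < T.r) :
    T.scale x = (T.s x.toReal : EReal) := by
  rw [scale, if_neg (not_le.2 hl), if_neg (not_le.2 hr)]

theorem scale_of_le_l {x : EReal} (h : x ≤ T.l) : T.scale x = T.scale T.l := by
  rw [scale, if_pos h, scale, if_pos le_rfl]

theorem scale_of_r_le {x : EReal} (h : T.r ≤ x) : T.scale x = T.scale T.r := by
  rw [scale, if_neg (not_le.2 (T.l_lt_r.trans_le h)), if_pos h, scale,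
    if_neg (not_le.2 T.l_lt_r), if_pos le_rfl]

theorem scale_l : T.scale T.l =
    ⨅ y : {y : ℝ // T.l < (y : EReal) ∧ (y : EReal) < T.r}, (T.s y : EReal) := by
  rw [scale, if_pos le_rfl]

theorem scale_r : T.scale T.r =
    ⨆ y : {y : ℝ // T.l < (y : EReal) ∧ (y : EReal) < T.r}, (T.s y : EReal) := by
  rw [scale, if_neg (not_le.2 T.l_lt_r), if_pos le_rfl]

theorem scale_zero : T.scale 0 = 0 := by
  rw [T.scale_of_mem T.l_neg T.r_pos, EReal.toReal_zero, T.s_zero, EReal.coe_zero]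

theorem scale_l_le_of_mem {x : EReal} (hl : T.l < x) (hr : x < T.r) :
    T.scale T.l ≤ T.scale x := by
  rw [T.scale_of_mem hl hr, scale_l]
  have hx := T.coe_toReal_of_mem hl hr
  exact iInf_le (fun y : {y : ℝ // T.l < (y : EReal) ∧ (y : EReal) < T.r} => (T.s y : EReal))
    ⟨x.toReal, by rw [hx]; exact ⟨hl, hr⟩⟩

theorem le_scale_r_of_mem {x : EReal} (hl : T.l < x) (hr : x < T.r) :
    T.scale x ≤ T.scale T.r := by
  rw [T.scale_of_mem hl hr, scale_r]
  have hx := T.coe_toReal_of_mem hl hr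
  exact le_iSup (fun y : {y : ℝ // T.l < (y : EReal) ∧ (y : EReal) < T.r} => (T.s y : EReal))
    ⟨x.toReal, by rw [hx]; exact ⟨hl, hr⟩⟩

theorem scale_mono : Monotone T.scale := by
  intro x y hxy
  have hlr : T.scale T.l ≤ T.scale T.r :=
    (T.scale_l_le_of_mem T.l_neg T.r_pos).trans (T.le_scale_r_of_mem T.l_neg T.r_pos)
  rcases le_or_gt x T.l with hx | hx
  · rw [T.scale_of_le_l hx]
    rcases le_or_gt y T.l with hy | hy
    · rw [T.scale_of_le_l hy]
    · rcases le_or_gt T.r y with hy' | hy'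
      · rwa [T.scale_of_r_le hy']
      · exact T.scale_l_le_of_mem hy hy'
  · rcases le_or_gt T.r y with hy | hy
    · rw [T.scale_of_r_le hy]
      rcases le_or_gt T.r x with hx' | hx'
      · rw [T.scale_of_r_le hx']
      · exact T.le_scale_r_of_mem hx hx'
    · have hxr := hxy.trans_lt hy
      have hly := hx.trans_le hxy
      rw [T.scale_of_mem hx hxr, T.scale_of_mem hly hy, EReal.coe_le_coe_iff]
      have h1 := T.coe_toReal_of_mem hx hxr
      have h2 := T.coe_toReal_of_mem hly hy
      refine T.s_mono ?_ ?_ ?_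
      · change T.l < (x.toReal : EReal) ∧ (x.toReal : EReal) < T.r
        rw [h1]; exact ⟨hx, hxr⟩
      · change T.l < (y.toReal : EReal) ∧ (y.toReal : EReal) < T.r
        rw [h2]; exact ⟨hly, hy⟩
      · exact EReal.toReal_le_toReal hxy (ne_bot_of_gt hx) (ne_top_of_lt hy)

theorem scale_l_le (x : EReal) : T.scale T.l ≤ T.scale x := by
  rw [← T.scale_of_le_l bot_le]; exact T.scale_mono bot_le

theorem le_scale_r (x : EReal) : T.scale x ≤ T.scale T.r := by
  rw [← T.scale_of_r_le le_top]; exact T.scale_mono le_top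

theorem scale_l_le_zero : T.scale T.l ≤ 0 := by rw [← T.scale_zero]; exact T.scale_l_le 0

theorem zero_le_scale_r : 0 ≤ T.scale T.r := by rw [← T.scale_zero]; exact T.le_scale_r 0

theorem scale_l_lt_scale_r : T.scale T.l < T.scale T.r := by
  refine lt_of_le_of_ne (T.scale_l_le _) fun h => ?_
  obtain ⟨x, y, h1, h2, h3, h4, hne⟩ := T.s_nonconst
  have key : ∀ z : EReal, T.scale z = T.scale T.l := fun z =>
    le_antisymm (h ▸ T.le_scale_r z) (T.scale_l_le z)
  have h5 := (key x).trans (key y).symm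
  rw [T.scale_of_mem h1 h2, T.scale_of_mem h3 h4, EReal.toReal_coe, EReal.toReal_coe,
    EReal.coe_eq_coe_iff] at h5
  exact hne h5

theorem exists_scale_lt {y : EReal} (h : T.scale T.l < y) :
    ∃ x, T.l < x ∧ x < T.r ∧ T.scale x < y := by
  rw [scale_l, iInf_lt_iff] at h
  obtain ⟨⟨x, h1, h2⟩, h3⟩ := h
  exact ⟨x, h1, h2, by rwa [T.scale_of_mem h1 h2, EReal.toReal_coe]⟩

theorem exists_lt_scale {y : EReal} (h : y < T.scale T.r) :
    ∃ x, T.l < x ∧ x < T.r ∧ y < T.scale x := by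
  rw [scale_r, lt_iSup_iff] at h
  obtain ⟨⟨x, h1, h2⟩, h3⟩ := h
  exact ⟨x, h1, h2, by rwa [T.scale_of_mem h1 h2, EReal.toReal_coe]⟩

theorem scale_le_scaleR (x : EReal) : T.scale x ≤ T.scaleR x := T.scale_mono.le_rightLim le_rfl

theorem scaleL_le_scale (x : EReal) : T.scaleL x ≤ T.scale x := T.scale_mono.leftLim_le le_rfl

theorem scaleR_le {x y : EReal} (h : x < y) : T.scaleR x ≤ T.scale y := T.scale_mono.rightLim_le h

theorem le_scaleL {x y : EReal} (h : x < y) : T.scale x ≤ T.scaleL y := T.scale_mono.le_leftLim h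

theorem scaleR_mono : Monotone T.scaleR := T.scale_mono.rightLim

theorem scaleL_mono : Monotone T.scaleL := T.scale_mono.leftLim

theorem scaleR_eq_of_le_l {x : EReal} (h : x ≤ T.l) : T.scaleR x = T.scale x := by
  refine le_antisymm (le_of_forall_gt fun y hy => ?_) (T.scale_le_scaleR x)
  rw [T.scale_of_le_l h] at hy
  obtain ⟨z, hz, -, hz'⟩ := T.exists_scale_lt hy
  exact (T.scaleR_le (h.trans_lt hz)).trans_lt hz'

theorem scaleR_eq_of_r_le {x : EReal} (h : T.r ≤ x) : T.scaleR x = T.scale x := by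
  rcases eq_top_or_lt_top x with rfl | hx
  · exact rightLim_eq_of_isTop isTop_top
  · refine le_antisymm ((T.scaleR_le hx).trans ?_) (T.scale_le_scaleR x)
    rw [T.scale_of_r_le h, T.scale_of_r_le le_top]

theorem scaleL_eq_of_r_le {x : EReal} (h : T.r ≤ x) : T.scaleL x = T.scale x := by
  refine le_antisymm (T.scaleL_le_scale x) (le_of_forall_lt fun y hy => ?_)
  rw [T.scale_of_r_le h] at hy
  obtain ⟨z, -, hz, hz'⟩ := T.exists_lt_scale hy
  exact hz'.trans_le (T.le_scaleL (hz.trans_le h))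

theorem scaleL_eq_of_le_l {x : EReal} (h : x ≤ T.l) : T.scaleL x = T.scale x := by
  rcases eq_bot_or_bot_lt x with rfl | hx
  · exact leftLim_eq_of_isBot isBot_bot
  · refine le_antisymm (T.scaleL_le_scale x) (le_trans ?_ (T.le_scaleL hx))
    rw [T.scale_of_le_l h, T.scale_of_le_l bot_le]

theorem continuousAt_scale_zero : ContinuousAt T.scale 0 := by
  have h1 : T.scale =ᶠ[𝓝 0] fun x => (T.s x.toReal : EReal) := by
    filter_upwards [Ioo_mem_nhds T.l_neg T.r_pos] with x hx
    exact T.scale_of_mem hx.1 hx.2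
  refine ContinuousAt.congr ?_ h1.symm
  have h2 : ContinuousAt EReal.toReal 0 := EReal.tendsto_toReal (by simp) (by simp)
  have h3 : ContinuousAt T.s (EReal.toReal 0) := by rw [EReal.toReal_zero]; exact T.s_cont_zero
  exact continuous_coe_real_ereal.continuousAt.comp (h3.comp h2)

theorem scaleR_zero : T.scaleR 0 = T.scale 0 :=
  T.scale_mono.continuousWithinAt_Ioi_iff_rightLim_eq.1
    T.continuousAt_scale_zero.continuousWithinAt

theorem scaleL_zero : T.scaleL 0 = T.scale 0 :=
  T.scale_mono.continuousWithinAt_Iio_iff_leftLim_eq.1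
    T.continuousAt_scale_zero.continuousWithinAt

theorem mem_DR_iff {x : EReal} : x ∈ T.DR ↔ T.scale x < T.scaleR x := by
  refine ⟨fun h => lt_of_le_of_ne (T.scale_le_scaleR x) h.2, fun h => ⟨⟨?_, ?_⟩, h.ne⟩⟩
  · by_contra hx
    exact h.ne (T.scaleR_eq_of_le_l (not_le.1 hx).le).symm
  · by_contra hx
    exact h.ne (T.scaleR_eq_of_r_le (not_le.1 hx).le).symm

theorem mem_DL_iff {x : EReal} : x ∈ T.DL ↔ T.scaleL x < T.scale x := by
  refine ⟨fun h => lt_of_le_of_ne (T.scaleL_le_scale x) (Ne.symm h.2), fun h => ⟨⟨?_, ?_⟩, h.ne'⟩⟩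
  · by_contra hx
    exact h.ne (T.scaleL_eq_of_le_l (not_le.1 hx).le)
  · by_contra hx
    exact h.ne (T.scaleL_eq_of_r_le (not_le.1 hx).le)

theorem mem_Ioo_of_mem_DR {x : EReal} (h : x ∈ T.DR) : x ∈ Ioo T.l T.r := by
  rw [mem_DR_iff] at h
  constructor <;> by_contra hx
  · exact h.ne (T.scaleR_eq_of_le_l (not_lt.1 hx)).symm
  · exact h.ne (T.scaleR_eq_of_r_le (not_lt.1 hx)).symm

theorem mem_Ioo_of_mem_DL {x : EReal} (h : x ∈ T.DL) : x ∈ Ioo T.l T.r := by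
  rw [mem_DL_iff] at h
  constructor <;> by_contra hx
  · exact h.ne (T.scaleL_eq_of_le_l (not_lt.1 hx))
  · exact h.ne (T.scaleL_eq_of_r_le (not_lt.1 hx))

/-! ### The scale function on the state space as a real function

On `I` the scale function is finite, since an end of the interval belongs to `I` only if it is
reflecting, hence approachable. -/

theorem mem_I_of_mem {x : EReal} (hl : T.l < x) (hr : x < T.r) : x ∈ T.I :=
  ⟨⟨hl.le, hr.le⟩, fun h => absurd h hl.ne', fun h => absurd h hr.ne⟩

theorem zero_mem_I : (0 : EReal) ∈ T.I := T.mem_I_of_mem T.l_neg T.r_pos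

/-- The reference point `0` of the state space. -/
noncomputable def origin : T.I := ⟨0, T.zero_mem_I⟩

instance ordConnected_I : OrdConnected T.I := by
  refine ⟨fun x hx y hy z hz => ⟨⟨hx.1.1.trans hz.1, hz.2.trans hy.1.2⟩, fun h => ?_, fun h => ?_⟩⟩
  · exact hx.2.1 (le_antisymm (h ▸ hz.1) hx.1.1)
  · exact hy.2.2 (le_antisymm hy.1.2 (h ▸ hz.2))

theorem measurableSet_I : MeasurableSet T.I := T.ordConnected_I.measurableSet

theorem scale_ne_bot (x : T.I) : T.scale x ≠ ⊥ := by
  rcases (x.2.1.1).eq_or_lt with h | h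
  · rw [← h]; exact (x.2.2.1 h.symm).1
  · rcases (x.2.1.2).eq_or_lt with h' | h'
    · rw [h']; exact ne_bot_of_le_ne_bot (by simp) T.zero_le_scale_r
    · rw [T.scale_of_mem h h']; exact EReal.coe_ne_bot _

theorem scale_ne_top (x : T.I) : T.scale x ≠ ⊤ := by
  rcases (x.2.1.1).eq_or_lt with h | h
  · rw [← h]; exact ne_top_of_le_ne_top (by simp) T.scale_l_le_zero
  · rcases (x.2.1.2).eq_or_lt with h' | h'
    · rw [h']; exact (x.2.2.2 h').1
    · rw [T.scale_of_mem h h']; exact EReal.coe_ne_top _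

/-- The scale function on the state space, with real values. -/
noncomputable def scaleI (x : T.I) : ℝ := (T.scale x).toReal

/-- The right limits of the scale function, with real values. -/
noncomputable def scaleRI (x : T.I) : ℝ := (T.scaleR x).toReal

/-- The left limits of the scale function, with real values. -/
noncomputable def scaleLI (x : T.I) : ℝ := (T.scaleL x).toReal

theorem coe_scaleI (x : T.I) : (T.scaleI x : EReal) = T.scale x :=
  EReal.coe_toReal (T.scale_ne_top x) (T.scale_ne_bot x)

theorem scaleR_ne_top (x : T.I) : T.scaleR x ≠ ⊤ := by
  rcases le_or_gt T.r x with h | h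
  · rw [T.scaleR_eq_of_r_le h]; exact T.scale_ne_top x
  · obtain ⟨y, hxy, hyr⟩ := exists_between h
    exact ne_top_of_le_ne_top (T.scale_ne_top ⟨y, T.mem_I_of_mem (x.2.1.1.trans_lt hxy) hyr⟩)
      (T.scaleR_le hxy)

theorem scaleL_ne_bot (x : T.I) : T.scaleL x ≠ ⊥ := by
  rcases le_or_gt (x : EReal) T.l with h | h
  · rw [T.scaleL_eq_of_le_l h]; exact T.scale_ne_bot x
  · obtain ⟨y, hly, hyx⟩ := exists_between h
    exact ne_bot_of_le_ne_bot (T.scale_ne_bot ⟨y, T.mem_I_of_mem hly (hyx.trans_le x.2.1.2)⟩)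
      (T.le_scaleL hyx)

theorem coe_scaleRI (x : T.I) : (T.scaleRI x : EReal) = T.scaleR x :=
  EReal.coe_toReal (T.scaleR_ne_top x)
    (ne_bot_of_le_ne_bot (T.scale_ne_bot x) (T.scale_le_scaleR x))

theorem coe_scaleLI (x : T.I) : (T.scaleLI x : EReal) = T.scaleL x :=
  EReal.coe_toReal (ne_top_of_le_ne_top (T.scale_ne_top x) (T.scaleL_le_scale x))
    (T.scaleL_ne_bot x)

theorem scaleI_le_scaleRI (x : T.I) : T.scaleI x ≤ T.scaleRI x := by
  rw [← EReal.coe_le_coe_iff, coe_scaleI, coe_scaleRI]; exact T.scale_le_scaleR x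

theorem scaleLI_le_scaleI (x : T.I) : T.scaleLI x ≤ T.scaleI x := by
  rw [← EReal.coe_le_coe_iff, coe_scaleI, coe_scaleLI]; exact T.scaleL_le_scale x

theorem scaleRI_le {x y : T.I} (h : x < y) : T.scaleRI x ≤ T.scaleI y := by
  rw [← EReal.coe_le_coe_iff, coe_scaleI, coe_scaleRI]; exact T.scaleR_le h

theorem le_scaleLI {x y : T.I} (h : x < y) : T.scaleI x ≤ T.scaleLI y := by
  rw [← EReal.coe_le_coe_iff, coe_scaleI, coe_scaleLI]; exact T.le_scaleL h

theorem scaleI_mono : Monotone T.scaleI := fun x y h => by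
  rw [← EReal.coe_le_coe_iff, coe_scaleI, coe_scaleI]; exact T.scale_mono h

theorem scaleRI_mono : Monotone T.scaleRI := fun x y h => by
  rw [← EReal.coe_le_coe_iff, coe_scaleRI, coe_scaleRI]; exact T.scaleR_mono h

theorem scaleLI_mono : Monotone T.scaleLI := fun x y h => by
  rw [← EReal.coe_le_coe_iff, coe_scaleLI, coe_scaleLI]; exact T.scaleL_mono h

theorem scaleI_origin : T.scaleI T.origin = 0 := by
  rw [← EReal.coe_eq_coe_iff, coe_scaleI, EReal.coe_zero]; exact T.scale_zero

theorem scaleRI_origin : T.scaleRI T.origin = 0 := by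
  rw [← EReal.coe_eq_coe_iff, coe_scaleRI, EReal.coe_zero, ← T.scale_zero]; exact T.scaleR_zero

theorem scaleLI_origin : T.scaleLI T.origin = 0 := by
  rw [← EReal.coe_eq_coe_iff, coe_scaleLI, EReal.coe_zero, ← T.scale_zero]; exact T.scaleL_zero

theorem mem_DR_iff' {x : T.I} : (x : EReal) ∈ T.DR ↔ T.scaleI x < T.scaleRI x := by
  rw [mem_DR_iff, ← EReal.coe_lt_coe_iff, coe_scaleI, coe_scaleRI]

theorem mem_DL_iff' {x : T.I} : (x : EReal) ∈ T.DL ↔ T.scaleLI x < T.scaleI x := by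
  rw [mem_DL_iff, ← EReal.coe_lt_coe_iff, coe_scaleI, coe_scaleLI]

theorem tendsto_val_nhdsLT (x : T.I) :
    Tendsto (Subtype.val : T.I → EReal) (𝓝[<] x) (𝓝[<] (x : EReal)) :=
  continuous_subtype_val.continuousWithinAt.tendsto_nhdsWithin fun _ h => h

theorem tendsto_val_nhdsGT (x : T.I) :
    Tendsto (Subtype.val : T.I → EReal) (𝓝[>] x) (𝓝[>] (x : EReal)) :=
  continuous_subtype_val.continuousWithinAt.tendsto_nhdsWithin fun _ h => h

theorem tendsto_scaleI_nhdsLT (x : T.I) : Tendsto T.scaleI (𝓝[<] x) (𝓝 (T.scaleLI x)) := by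
  have h := (T.scale_mono.tendsto_leftLim (x : EReal)).comp (T.tendsto_val_nhdsLT x)
  change Tendsto _ _ (𝓝 (T.scaleL x)) at h
  exact (EReal.tendsto_toReal (by rw [← coe_scaleLI]; simp) (T.scaleL_ne_bot x)).comp h

theorem tendsto_scaleI_nhdsGT (x : T.I) : Tendsto T.scaleI (𝓝[>] x) (𝓝 (T.scaleRI x)) := by
  have h := (T.scale_mono.tendsto_rightLim (x : EReal)).comp (T.tendsto_val_nhdsGT x)
  change Tendsto _ _ (𝓝 (T.scaleR x)) at h
  exact (EReal.tendsto_toReal (T.scaleR_ne_top x) (by rw [← coe_scaleRI]; simp)).comp h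

/-! ### Functions of the form `G ∘ s` with `G` continuous -/

theorem leftLim_comp_scaleI {G : ℝ → ℝ} (hG : Continuous G) (x : T.I) :
    Function.leftLim (fun x => G (T.scaleI x)) x = G (T.scaleLI x) := by
  rcases eq_or_neBot (𝓝[<] x) with h | h
  · rw [leftLim_eq_of_eq_bot _ h]
    rcases le_or_gt (x : EReal) T.l with hx | hx
    · rw [scaleI, scaleLI, T.scaleL_eq_of_le_l hx]
    · exfalso
      obtain ⟨y, hly, hyx⟩ := exists_between hx
      have hlt : (⟨y, T.mem_I_of_mem hly (hyx.trans_le x.2.1.2)⟩ : T.I) < x := hyx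
      exact (nhdsLT_neBot_of_exists_lt ⟨_, hlt⟩).ne h
  · exact leftLim_eq_of_tendsto ((hG.tendsto _).comp (T.tendsto_scaleI_nhdsLT x))

theorem rightLim_comp_scaleI {G : ℝ → ℝ} (hG : Continuous G) (x : T.I) :
    Function.rightLim (fun x => G (T.scaleI x)) x = G (T.scaleRI x) := by
  rcases eq_or_neBot (𝓝[>] x) with h | h
  · rw [rightLim_eq_of_eq_bot _ h]
    rcases le_or_gt T.r x with hx | hx
    · rw [scaleI, scaleRI, T.scaleR_eq_of_r_le hx]
    · exfalso
      obtain ⟨y, hxy, hyr⟩ := exists_between hx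
      have hlt : x < (⟨y, T.mem_I_of_mem (x.2.1.1.trans_lt hxy) hyr⟩ : T.I) := hxy
      exact (nhdsGT_neBot_of_exists_gt ⟨_, hlt⟩).ne h
  · exact rightLim_eq_of_tendsto ((hG.tendsto _).comp (T.tendsto_scaleI_nhdsGT x))

theorem sCont_comp_scaleI {G : ℝ → ℝ} (hG : Continuous G) : T.SCont fun x => G (T.scaleI x) := by
  refine fun x => ⟨⟨_, (hG.tendsto _).comp (T.tendsto_scaleI_nhdsLT x)⟩,
    ⟨_, (hG.tendsto _).comp (T.tendsto_scaleI_nhdsGT x)⟩, fun h => ?_, fun h => ?_⟩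
  · rw [mem_DL_iff', not_lt] at h
    have := (hG.tendsto _).comp (T.tendsto_scaleI_nhdsLT x)
    rwa [le_antisymm (T.scaleLI_le_scaleI x) h] at this
  · rw [mem_DR_iff', not_lt] at h
    have := (hG.tendsto _).comp (T.tendsto_scaleI_nhdsGT x)
    rwa [← le_antisymm (T.scaleI_le_scaleRI x) h] at this

end ScaleSpeed

/-! ### The generalized inverse of the scale function -/

namespace ScaleSpeed

variable (T : ScaleSpeed)

/-- The open interval `(s(l), s(r))` of real numbers. -/
def hull : Set ℝ := {y | T.scale T.l < y ∧ (y : EReal) < T.scale T.r}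

/-- The right-continuous generalized inverse of the scale function. -/
noncomputable def inverseE (y : ℝ) : EReal := sSup {x | T.scale x ≤ y}

theorem inverseE_mono : Monotone T.inverseE := fun _ _ h =>
  sSup_le_sSup fun x (hx : T.scale x ≤ _) => hx.trans (EReal.coe_le_coe_iff.2 h)

theorem le_inverseE {x : EReal} {y : ℝ} (h : T.scale x ≤ y) : x ≤ T.inverseE y := le_sSup h

theorem inverseE_le {x : EReal} {y : ℝ} (h : (y : EReal) < T.scale x) : T.inverseE y ≤ x :=
  sSup_le fun z (hz : T.scale z ≤ y) =>
    le_of_lt (lt_of_not_ge fun hxz => not_le.2 h ((T.scale_mono hxz).trans hz))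

theorem inverseE_mem {y : ℝ} (hy : y ∈ T.hull) : T.inverseE y ∈ Ioo T.l T.r := by
  obtain ⟨x, hx, -, hxy⟩ := T.exists_scale_lt hy.1
  obtain ⟨x', -, hx', hxy'⟩ := T.exists_lt_scale hy.2
  exact ⟨hx.trans_le (T.le_inverseE hxy.le), (T.inverseE_le hxy').trans_lt hx'⟩

open Classical in
/-- The generalized inverse of the scale function as a map to the state space; outside of
`(s(l), s(r))` it may take the irrelevant value `0`. -/
noncomputable def inverse (y : ℝ) : T.I :=
  if h : T.inverseE y ∈ T.I then ⟨T.inverseE y, h⟩ else T.origin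

theorem coe_inverse {y : ℝ} (hy : y ∈ T.hull) : (T.inverse y : EReal) = T.inverseE y := by
  rw [inverse, dif_pos (T.mem_I_of_mem (T.inverseE_mem hy).1 (T.inverseE_mem hy).2)]

theorem measurable_inverse : Measurable T.inverse := by
  classical
  have h1 : Measurable fun y => if T.inverseE y ∈ T.I then T.inverseE y else 0 :=
    Measurable.ite (T.inverseE_mono.measurable T.measurableSet_I) T.inverseE_mono.measurable
      measurable_const
  have h2 : ∀ y, (if T.inverseE y ∈ T.I then T.inverseE y else 0) ∈ T.I := fun y => by
    split_ifs with h
    · exact h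
    · exact T.zero_mem_I
  have h3 : T.inverse = fun y => ⟨_, h2 y⟩ := by
    funext y
    refine Subtype.ext ?_
    simp only [inverse]
    split_ifs with h
    · rfl
    · rfl
  rw [h3]
  exact h1.subtype_mk

theorem le_inverse {x : T.I} {y : ℝ} (hy : y ∈ T.hull) (h : T.scaleI x ≤ y) : x ≤ T.inverse y := by
  change (x : EReal) ≤ T.inverse y
  rw [T.coe_inverse hy]
  exact T.le_inverseE (by rw [← coe_scaleI]; exact EReal.coe_le_coe_iff.2 h)

theorem inverse_le {x : T.I} {y : ℝ} (hy : y ∈ T.hull) (h : y < T.scaleI x) : T.inverse y ≤ x := by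
  change (T.inverse y : EReal) ≤ x
  rw [T.coe_inverse hy]
  exact T.inverseE_le (by rw [← coe_scaleI]; exact EReal.coe_lt_coe_iff.2 h)

theorem le_scaleRI_inverse {y : ℝ} (hy : y ∈ T.hull) : y ≤ T.scaleRI (T.inverse y) := by
  rw [← EReal.coe_le_coe_iff, coe_scaleRI, T.coe_inverse hy]
  by_contra h
  have hr := (T.inverseE_mem hy).2
  have : (𝓝[>] T.inverseE y).NeBot := nhdsGT_neBot_of_exists_gt ⟨_, hr⟩
  have h1 := (T.scale_mono.tendsto_rightLim (T.inverseE y)).eventually (Iio_mem_nhds (not_le.1 h))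
  obtain ⟨z, hz, hz'⟩ := (h1.and self_mem_nhdsWithin).exists
  exact not_le.2 hz' (T.le_inverseE hz.le)

theorem scaleLI_inverse_le {y : ℝ} (hy : y ∈ T.hull) : T.scaleLI (T.inverse y) ≤ y := by
  rw [← EReal.coe_le_coe_iff, coe_scaleLI, T.coe_inverse hy]
  by_contra h
  have hl := (T.inverseE_mem hy).1
  have : (𝓝[<] T.inverseE y).NeBot := nhdsLT_neBot_of_exists_lt ⟨_, hl⟩
  have h1 := (T.scale_mono.tendsto_leftLim (T.inverseE y)).eventually (Ioi_mem_nhds (not_le.1 h))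
  obtain ⟨z, hz, hz'⟩ := (h1.and self_mem_nhdsWithin).exists
  exact not_le.2 hz' (T.inverseE_le hz)

/-! ### Jumps and the continuous part of the scale function -/

/-- The union of the jump intervals `(s(x), s(x+))`. -/
def jumpR : Set ℝ := ⋃ x : {x : T.I // (x : EReal) ∈ T.DR}, Ioo (T.scaleI x.1) (T.scaleRI x.1)

/-- The union of the jump intervals `(s(x-), s(x))`. -/
def jumpL : Set ℝ := ⋃ x : {x : T.I // (x : EReal) ∈ T.DL}, Ioo (T.scaleLI x.1) (T.scaleI x.1)

/-- The complement of the jump intervals. -/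
def noJump : Set ℝ := (T.jumpR ∪ T.jumpL)ᶜ

theorem isOpen_jumpR : IsOpen T.jumpR := isOpen_iUnion fun _ => isOpen_Ioo

theorem isOpen_jumpL : IsOpen T.jumpL := isOpen_iUnion fun _ => isOpen_Ioo

theorem measurableSet_noJump : MeasurableSet T.noJump :=
  (T.isOpen_jumpR.measurableSet.union T.isOpen_jumpL.measurableSet).compl

theorem mem_hull_of_lt {x x' : T.I} {y : ℝ} (h : T.scaleLI x < y) (h' : y < T.scaleRI x') :
    y ∈ T.hull := by
  rw [← EReal.coe_lt_coe_iff, coe_scaleLI] at h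
  rw [← EReal.coe_lt_coe_iff, coe_scaleRI] at h'
  refine ⟨lt_of_le_of_lt ?_ h, h'.trans_le ?_⟩
  · rw [← T.scaleL_eq_of_le_l le_rfl]; exact T.scaleL_mono x.2.1.1
  · rw [← T.scaleR_eq_of_r_le le_rfl]; exact T.scaleR_mono x'.2.1.2

theorem inverse_eq_of_mem_R {x : T.I} {y : ℝ} (h : y ∈ Ioo (T.scaleI x) (T.scaleRI x)) :
    T.inverse y = x := by
  have hy : y ∈ T.hull := T.mem_hull_of_lt ((T.scaleLI_le_scaleI x).trans_lt h.1) h.2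
  refine le_antisymm ?_ (T.le_inverse hy h.1.le)
  by_contra hlt
  obtain ⟨z, hz, hz'⟩ := exists_between (not_le.1 hlt)
  exact not_le.2 h.2 (((T.scaleRI_le hz).trans (T.le_scaleLI hz')).trans (T.scaleLI_inverse_le hy))

theorem inverse_eq_of_mem_L {x : T.I} {y : ℝ} (h : y ∈ Ioo (T.scaleLI x) (T.scaleI x)) :
    T.inverse y = x := by
  have hy : y ∈ T.hull := T.mem_hull_of_lt h.1 (h.2.trans_le (T.scaleI_le_scaleRI x))
  refine le_antisymm (T.inverse_le hy h.2) ?_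
  by_contra hlt
  obtain ⟨z, hz, hz'⟩ := exists_between (not_le.1 hlt)
  exact not_lt.2 (((T.le_scaleRI_inverse hy).trans (T.scaleRI_le hz)).trans (T.le_scaleLI hz')) h.1

theorem mem_jumpR {y : ℝ} : y ∈ T.jumpR ↔
    y ∈ T.hull ∧ y ∈ Ioo (T.scaleI (T.inverse y)) (T.scaleRI (T.inverse y)) := by
  constructor
  · intro h
    obtain ⟨x, hx⟩ := mem_iUnion.1 h
    rw [T.inverse_eq_of_mem_R hx]
    exact ⟨T.mem_hull_of_lt ((T.scaleLI_le_scaleI x.1).trans_lt hx.1) hx.2, hx⟩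
  · rintro ⟨-, h⟩
    exact mem_iUnion.2 ⟨⟨T.inverse y, T.mem_DR_iff'.2 (h.1.trans h.2)⟩, h⟩

theorem mem_jumpL {y : ℝ} : y ∈ T.jumpL ↔
    y ∈ T.hull ∧ y ∈ Ioo (T.scaleLI (T.inverse y)) (T.scaleI (T.inverse y)) := by
  constructor
  · intro h
    obtain ⟨x, hx⟩ := mem_iUnion.1 h
    rw [T.inverse_eq_of_mem_L hx]
    exact ⟨T.mem_hull_of_lt hx.1 (hx.2.trans_le (T.scaleI_le_scaleRI x.1)), hx⟩
  · rintro ⟨-, h⟩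
    exact mem_iUnion.2 ⟨⟨T.inverse y, T.mem_DL_iff'.2 (h.1.trans h.2)⟩, h⟩

theorem disjoint_jump : Disjoint T.jumpR T.jumpL :=
  Set.disjoint_left.2 fun y h h' => by
    rw [mem_jumpR] at h
    rw [mem_jumpL] at h'
    exact lt_asymm h.2.1 h'.2.2

theorem inverse_lt_iff_of_jumpR {x : T.I} {y : ℝ} (hy : y ∈ T.jumpR) :
    T.inverse y < x ↔ y ≤ T.scaleI x := by
  rw [mem_jumpR] at hy
  refine ⟨fun h => hy.2.2.le.trans (T.scaleRI_le h), fun h => lt_of_not_ge fun h' => ?_⟩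
  exact not_le.2 hy.2.1 (h.trans (T.scaleI_mono h'))

theorem inverse_le_iff_of_jumpL {x : T.I} {y : ℝ} (hy : y ∈ T.jumpL) :
    T.inverse y ≤ x ↔ y ≤ T.scaleI x := by
  rw [mem_jumpL] at hy
  refine ⟨fun h => hy.2.2.le.trans (T.scaleI_mono h), fun h => not_lt.1 fun h' => ?_⟩
  exact not_le.2 hy.2.1 (h.trans (T.le_scaleLI h'))

theorem origin_lt_iff_of_jumpR {y : ℝ} (hy : y ∈ T.jumpR) : T.origin < T.inverse y ↔ 0 < y := by
  rw [mem_jumpR] at hy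
  refine ⟨fun h => ?_, fun h => lt_of_not_ge fun h' => ?_⟩
  · rw [← T.scaleI_origin]; exact (T.scaleI_mono h.le).trans_lt hy.2.1
  · have := T.scaleRI_mono h'
    rw [scaleRI_origin] at this
    linarith [hy.2.2]

theorem inverse_lt_origin_iff_of_jumpL {y : ℝ} (hy : y ∈ T.jumpL) :
    T.inverse y < T.origin ↔ y ≤ 0 := by
  rw [← T.scaleI_origin, ← T.inverse_le_iff_of_jumpL hy]
  refine ⟨le_of_lt, fun h => lt_of_le_of_ne h fun h' => ?_⟩
  rw [mem_jumpL, h', scaleI_origin, scaleLI_origin] at hy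
  exact lt_asymm hy.2.1 hy.2.2

instance : Countable {x : T.I // (x : EReal) ∈ T.DR} := by
  refine Pairwise.countable_of_isOpen_disjoint (α := ℝ)
    (s := fun x => Ioo (T.scaleI x.1) (T.scaleRI x.1)) (fun x x' hne => ?_) (fun _ => isOpen_Ioo)
    fun x => nonempty_Ioo.2 (T.mem_DR_iff'.1 x.2)
  exact Set.disjoint_left.2 fun y h h' =>
    hne (Subtype.ext ((T.inverse_eq_of_mem_R h).symm.trans (T.inverse_eq_of_mem_R h')))

instance : Countable {x : T.I // (x : EReal) ∈ T.DL} := by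
  refine Pairwise.countable_of_isOpen_disjoint (α := ℝ)
    (s := fun x => Ioo (T.scaleLI x.1) (T.scaleI x.1)) (fun x x' hne => ?_) (fun _ => isOpen_Ioo)
    fun x => nonempty_Ioo.2 (T.mem_DL_iff'.1 x.2)
  exact Set.disjoint_left.2 fun y h h' =>
    hne (Subtype.ext ((T.inverse_eq_of_mem_L h).symm.trans (T.inverse_eq_of_mem_L h')))

theorem map_restrict_Ioo {x : T.I} {a b : ℝ} (h : ∀ y ∈ Ioo a b, T.inverse y = x) :
    (volume.restrict (Ioo a b)).map T.inverse = ENNReal.ofReal (b - a) • Measure.dirac x := by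
  have h1 : T.inverse =ᵐ[volume.restrict (Ioo a b)] fun _ => x := by
    filter_upwards [ae_restrict_mem measurableSet_Ioo] with y hy using h y hy
  rw [Measure.map_congr h1, Measure.map_const, Measure.restrict_apply_univ, Real.volume_Ioo]

/-- The jump measures are images of Lebesgue measure on the jump intervals. -/
theorem muR_eq : T.muR = (volume.restrict T.jumpR).map T.inverse := by
  rw [jumpR, Measure.restrict_iUnion _ fun _ => measurableSet_Ioo,
    Measure.map_sum T.measurable_inverse.aemeasurable, muR]
  · congr 1
    funext x
    rw [T.map_restrict_Ioo fun y hy => T.inverse_eq_of_mem_R hy]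
    rfl
  · intro x x' hne
    exact Set.disjoint_left.2 fun y h h' =>
      hne (Subtype.ext ((T.inverse_eq_of_mem_R h).symm.trans (T.inverse_eq_of_mem_R h')))

theorem muL_eq : T.muL = (volume.restrict T.jumpL).map T.inverse := by
  rw [jumpL, Measure.restrict_iUnion _ fun _ => measurableSet_Ioo,
    Measure.map_sum T.measurable_inverse.aemeasurable, muL]
  · congr 1
    funext x
    rw [T.map_restrict_Ioo fun y hy => T.inverse_eq_of_mem_L hy]
    rfl
  · intro x x' hne
    exact Set.disjoint_left.2 fun y h h' =>
      hne (Subtype.ext ((T.inverse_eq_of_mem_L h).symm.trans (T.inverse_eq_of_mem_L h')))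

/-- Integration over `A` against the image of Lebesgue measure on `V` amounts to integration over
`V ∩ (a, b]`, if this is the part of `V` that the inverse maps to `A`. -/
theorem setIntegral_map_inverse {V : Set ℝ} (hV : MeasurableSet V) {A : Set T.I}
    (hA : MeasurableSet A) {a b : ℝ} (hab : a ≤ b) (h : ∀ y ∈ V, T.inverse y ∈ A ↔ y ∈ Ioc a b)
    {g : T.I → ℝ} (hg : AEStronglyMeasurable g ((volume.restrict V).map T.inverse)) :
    ∫ x in A, g x ∂((volume.restrict V).map T.inverse) =
      ∫ y in a..b, V.indicator (g ∘ T.inverse) y := by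
  rw [setIntegral_map hA hg T.measurable_inverse.aemeasurable,
    Measure.restrict_restrict (T.measurable_inverse hA), intervalIntegral.integral_of_le hab,
    setIntegral_indicator hV]
  have : T.inverse ⁻¹' A ∩ V = Ioc a b ∩ V := by
    ext y
    exact ⟨fun hy => ⟨(h y hy.2).1 hy.1, hy.2⟩, fun hy => ⟨(h y hy.2).2 hy.1, hy.2⟩⟩
  rw [this]
  rfl

/-- The integral over `(0, x)` against `μ_d⁺`, with the sign convention for `x < 0`, is an integral
over the jump intervals between `0` and `s(x)`: the jump to the right of `y` lies below `s(x)` exactly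
if `y < x`. -/
theorem intOpen_muR {g : T.I → ℝ} (hg : AEStronglyMeasurable g T.muR) (x : T.I) :
    T.intOpen T.muR g x = ∫ y in 0..T.scaleI x, T.jumpR.indicator (g ∘ T.inverse) y := by
  rw [muR_eq] at hg
  rw [intOpen, muR_eq]
  split_ifs with h
  · have hx : 0 ≤ T.scaleI x := by
      rw [← T.scaleI_origin]; exact T.scaleI_mono (show T.origin ≤ x from h)
    refine T.setIntegral_map_inverse T.isOpen_jumpR.measurableSet
      (measurableSet_Ioo (a := T.origin) (b := x)) hx (fun y hy => ?_) hg
    exact and_congr (T.origin_lt_iff_of_jumpR hy) (T.inverse_lt_iff_of_jumpR hy)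
  · have hx : T.scaleI x ≤ 0 := by
      rw [← T.scaleI_origin]; exact T.scaleI_mono (show x ≤ T.origin from (not_le.1 h).le)
    rw [intervalIntegral.integral_symm, neg_inj]
    refine T.setIntegral_map_inverse T.isOpen_jumpR.measurableSet
      (measurableSet_Ico (a := x) (b := T.origin)) hx (fun y hy => ?_) hg
    refine and_congr ?_ ?_
    · rw [← not_lt, T.inverse_lt_iff_of_jumpR hy, not_le]
    · have := T.inverse_lt_iff_of_jumpR (x := T.origin) hy
      rwa [T.scaleI_origin] at this

/-- The integral over `(0, x]` against `μ_d⁻`, with the sign convention for `x < 0`, is an integral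
over the jump intervals between `0` and `s(x)`: the jump to the left of `y` lies below `s(x)` exactly
if `y ≤ x`. -/
theorem intClosed_muL {g : T.I → ℝ} (hg : AEStronglyMeasurable g T.muL) (x : T.I) :
    T.intClosed T.muL g x = ∫ y in 0..T.scaleI x, T.jumpL.indicator (g ∘ T.inverse) y := by
  rw [muL_eq] at hg
  rw [intClosed, muL_eq]
  split_ifs with h
  · have hx : 0 ≤ T.scaleI x := by
      rw [← T.scaleI_origin]; exact T.scaleI_mono (show T.origin ≤ x from h)
    refine T.setIntegral_map_inverse T.isOpen_jumpL.measurableSet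
      (measurableSet_Ioc (a := T.origin) (b := x)) hx (fun y hy => ?_) hg
    refine and_congr ?_ (T.inverse_le_iff_of_jumpL hy)
    have := (T.inverse_le_iff_of_jumpL (x := T.origin) hy).not
    rwa [T.scaleI_origin, not_le, not_le] at this
  · have hx : T.scaleI x ≤ 0 := by
      rw [← T.scaleI_origin]; exact T.scaleI_mono (show x ≤ T.origin from (not_le.1 h).le)
    rw [intervalIntegral.integral_symm, neg_inj]
    refine T.setIntegral_map_inverse T.isOpen_jumpL.measurableSet
      (measurableSet_Ioo (a := x) (b := T.origin)) hx (fun y hy => ?_) hg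
    refine and_congr ?_ (T.inverse_lt_origin_iff_of_jumpL hy)
    rw [← not_le, T.inverse_le_iff_of_jumpL hy, not_le]

end ScaleSpeed

/-! ### The distribution function of Lebesgue measure on a set -/

/-- `y ↦ ∫_0^y 1_C`. -/
noncomputable def distFun (C : Set ℝ) (y : ℝ) : ℝ := ∫ t in (0 : ℝ)..y, C.indicator (fun _ => 1) t

section DistFun

variable {C : Set ℝ}

theorem intervalIntegrable_indicator {V : Set ℝ} (hV : MeasurableSet V) {g : ℝ → ℝ} {a b : ℝ}
    (hg : IntervalIntegrable g volume a b) : IntervalIntegrable (V.indicator g) volume a b :=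
  ⟨hg.1.indicator hV, hg.2.indicator hV⟩

theorem intervalIntegrable_indicator_one (hC : MeasurableSet C) (a b : ℝ) :
    IntervalIntegrable (C.indicator fun _ => (1 : ℝ)) volume a b :=
  intervalIntegrable_indicator hC intervalIntegrable_const

theorem distFun_sub (hC : MeasurableSet C) (a b : ℝ) :
    distFun C b - distFun C a = ∫ t in a..b, C.indicator (fun _ => 1) t :=
  intervalIntegral.integral_interval_sub_left (intervalIntegrable_indicator_one hC _ _)
    (intervalIntegrable_indicator_one hC _ _)

theorem volume_inter_Ioc (hC : MeasurableSet C) {a b : ℝ} (hab : a ≤ b) :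
    volume (C ∩ Ioc a b) = ENNReal.ofReal (distFun C b - distFun C a) := by
  rw [distFun_sub hC, intervalIntegral.integral_of_le hab,
    show (∫ t in Ioc a b, C.indicator (fun _ => (1 : ℝ)) t) = _ from integral_indicator_one hC,
    Measure.real,
    Measure.restrict_apply hC, ENNReal.ofReal_toReal]
  exact ((measure_mono inter_subset_right).trans_lt measure_Ioc_lt_top).ne

theorem distFun_mono (hC : MeasurableSet C) : Monotone (distFun C) := fun a b hab => by
  rw [← sub_nonneg, distFun_sub hC]
  exact intervalIntegral.integral_nonneg hab fun t _ => indicator_nonneg (fun _ _ => zero_le_one) t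

theorem distFun_continuous (hC : MeasurableSet C) : Continuous (distFun C) :=
  intervalIntegral.continuous_primitive (fun a b => intervalIntegrable_indicator_one hC a b) 0

end DistFun

namespace ScaleSpeed

variable (T : ScaleSpeed)

theorem indicator_decomp (y : ℝ) : (1 : ℝ) = T.noJump.indicator (fun _ => 1) y +
    T.jumpR.indicator ((fun _ => 1) ∘ T.inverse) y +
      T.jumpL.indicator ((fun _ => 1) ∘ T.inverse) y := by
  by_cases h : y ∈ T.jumpR
  · have h' : y ∉ T.jumpL := Set.disjoint_left.1 T.disjoint_jump h
    simp [noJump, h, h']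
  · by_cases h' : y ∈ T.jumpL <;> simp [noJump, h, h']

/-- `s_c(x)` is the Lebesgue measure of the part between `0` and `s(x)` of the complement of the
jump intervals. -/
theorem sC_eq (x : T.I) : T.sC x = distFun T.noJump (T.scaleI x) := by
  have hR : IntervalIntegrable (T.jumpR.indicator ((fun _ => (1 : ℝ)) ∘ T.inverse)) volume 0
      (T.scaleI x) := intervalIntegrable_indicator_one T.isOpen_jumpR.measurableSet _ _
  have hL : IntervalIntegrable (T.jumpL.indicator ((fun _ => (1 : ℝ)) ∘ T.inverse)) volume 0
      (T.scaleI x) := intervalIntegrable_indicator_one T.isOpen_jumpL.measurableSet _ _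
  have hC := intervalIntegrable_indicator_one T.measurableSet_noJump 0 (T.scaleI x)
  have h1 : T.scaleI x = ∫ y in 0..T.scaleI x, (1 : ℝ) := by simp
  rw [sC, T.intOpen_muR aestronglyMeasurable_const, T.intClosed_muL aestronglyMeasurable_const,
    distFun, ← scaleI]
  conv_lhs => enter [1, 1]; rw [h1]
  rw [intervalIntegral.integral_congr fun y _ => T.indicator_decomp y,
    intervalIntegral.integral_add (hC.add hR) hL, intervalIntegral.integral_add hC hR]
  ring

/-- Up to finitely many points, the points off the jump intervals which the inverse maps to `[a, b]`
are those between `s(a)` and `s(b)`: the jumps of `s` at `a` to the left and at `b` to the right are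
excluded. -/
theorem restrict_noJump_Icc {a b : T.I} (hab : a ≤ b) :
    (volume.restrict (T.noJump ∩ T.hull)).map T.inverse (Icc a b) =
      ENNReal.ofReal (T.sC b - T.sC a) := by
  rw [Measure.map_apply T.measurable_inverse measurableSet_Icc,
    Measure.restrict_apply (T.measurable_inverse measurableSet_Icc), sC_eq, sC_eq,
    ← volume_inter_Ioc T.measurableSet_noJump (T.scaleI_mono hab)]
  refine measure_congr ?_
  have hne : ∀ c : ℝ, ∀ᵐ y : ℝ, y ≠ c := fun c => by simp [ae_iff]
  filter_upwards [hne (T.scaleI a), hne (T.scaleI b), hne (T.scaleLI a), hne (T.scaleRI b)]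
    with y h1 h2 h3 h4
  refine propext ⟨fun ⟨⟨hy1, hy2⟩, hyC, hy⟩ => ⟨hyC, ?_, ?_⟩, fun ⟨hyC, hy1, hy2⟩ => ?_⟩
  · by_contra hlt
    have hlt := lt_of_le_of_ne (not_lt.1 hlt) h1
    have h5 : T.scaleLI a < y :=
      lt_of_le_of_ne ((T.scaleLI_mono hy1).trans (T.scaleLI_inverse_le hy)) (Ne.symm h3)
    exact hyC (Or.inr (mem_iUnion.2 ⟨⟨a, T.mem_DL_iff'.2 (h5.trans hlt)⟩, h5, hlt⟩))
  · by_contra hlt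
    have hlt := not_le.1 hlt
    have h5 : y < T.scaleRI b :=
      lt_of_le_of_ne ((T.le_scaleRI_inverse hy).trans (T.scaleRI_mono hy2)) h4
    exact hyC (Or.inl (mem_iUnion.2 ⟨⟨b, T.mem_DR_iff'.2 (hlt.trans h5)⟩, hlt, h5⟩))
  · have hy2 := lt_of_le_of_ne hy2 h2
    have hy : y ∈ T.hull := T.mem_hull_of_lt ((T.scaleLI_le_scaleI a).trans_lt hy1)
      (hy2.trans_le (T.scaleI_le_scaleRI b))
    exact ⟨⟨T.le_inverse hy hy1.le, T.inverse_le hy hy2⟩, hyC, hy⟩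

/-- The continuous part of the Lebesgue–Stieltjes measure of the scale function is the image of
Lebesgue measure on the complement of the jump intervals. -/
theorem muC_eq : T.muC = (volume.restrict (T.noJump ∩ T.hull)).map T.inverse := by
  have h : ∃ ν : Measure T.I, ∀ a b : T.I, a ≤ b → ν (Icc a b) = ENNReal.ofReal (T.sC b - T.sC a) :=
    ⟨_, fun a b => T.restrict_noJump_Icc⟩
  -- `muC` is defined as a measure with the values `s_c(b) - s_c(a)` on `[a, b]`; it is unique.
  rw [muC, dif_pos h]
  refine Measure.ext_of_Icc' _ _ (fun a b hab => ?_) fun a b hab => ?_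
  · rw [h.choose_spec a b hab]; exact ENNReal.ofReal_ne_top
  · rw [h.choose_spec a b hab, T.restrict_noJump_Icc hab]

end ScaleSpeed

/-! ### Absolute continuity with respect to a distribution function -/

section DistFun

variable {C : Set ℝ}

/-- The distribution function of Lebesgue measure on `C` maps this measure to Lebesgue measure. -/
theorem map_distFun (hC : MeasurableSet C) {a b : ℝ} (hab : a ≤ b) :
    (volume.restrict (C ∩ Ioc a b)).map (distFun C) =
      volume.restrict (Ioc (distFun C a) (distFun C b)) := by
  have hmono := distFun_mono hC
  have hcont := distFun_continuous hC
  have hfin : IsFiniteMeasure (volume.restrict (C ∩ Ioc a b)) :=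
    ⟨by rw [Measure.restrict_apply_univ]
        exact (measure_mono inter_subset_right).trans_lt measure_Ioc_lt_top⟩
  refine Measure.ext_of_Iic _ _ fun t => ?_
  rw [Measure.map_apply hcont.measurable measurableSet_Iic,
    Measure.restrict_apply (hcont.measurable measurableSet_Iic),
    Measure.restrict_apply measurableSet_Iic]
  rcases lt_or_ge t (distFun C a) with ht | ht
  · have h1 : distFun C ⁻¹' Iic t ∩ (C ∩ Ioc a b) = ∅ := by
      refine eq_empty_of_forall_notMem fun y ⟨hy, _, hy'⟩ => ?_
      exact not_lt.2 ((hmono hy'.1.le).trans hy) ht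
    have h2 : Iic t ∩ Ioc (distFun C a) (distFun C b) = ∅ := by
      refine eq_empty_of_forall_notMem fun y ⟨hy, hy'⟩ => ?_
      exact not_lt.2 (hy'.1.le.trans hy) ht
    rw [h1, h2, measure_empty]
  · -- With the last point `c` of `[a, b]` at which the function is at most `t`, both sides are the
    -- measure of `C ∩ (a, c]`.
    have hcomp : IsCompact (Icc a b ∩ {y | distFun C y ≤ t}) :=
      isCompact_Icc.inter_right (isClosed_le hcont continuous_const)
    obtain ⟨c, ⟨hc, hct⟩, hcmax⟩ := hcomp.exists_isGreatest ⟨a, ⟨le_rfl, hab⟩, ht⟩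
    have hct : distFun C c ≤ t := hct
    have h1 : distFun C ⁻¹' Iic t ∩ (C ∩ Ioc a b) = C ∩ Ioc a c := by
      ext y
      refine ⟨fun ⟨hy, hyC, hy'⟩ => ⟨hyC, hy'.1, hcmax ⟨Ioc_subset_Icc_self hy', hy⟩⟩,
        fun ⟨hyC, hy⟩ => ⟨(hmono hy.2).trans hct, hyC, hy.1, hy.2.trans hc.2⟩⟩
    have h2 : distFun C c = min (distFun C b) t := by
      refine le_antisymm (le_min (hmono hc.2) hct) ?_
      by_cases hlt : distFun C c ≤ min (distFun C b) t
      · obtain ⟨y, hy, hy'⟩ := intermediate_value_Icc hc.2 hcont.continuousOn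
          ⟨hlt, min_le_left (distFun C b) t⟩
        have : y ≤ c := hcmax ⟨⟨hc.1.trans hy.1, hy.2⟩, hy'.trans_le (min_le_right _ _)⟩
        rw [← hy']; exact hmono this
      · exact (not_le.1 hlt).le
    have h3 : Iic t ∩ Ioc (distFun C a) (distFun C b) =
        Ioc (distFun C a) (min (distFun C b) t) := by
      ext y; simp only [mem_inter_iff, mem_Iic, mem_Ioc, le_min_iff]; tauto
    rw [h1, h3, volume_inter_Ioc hC hc.1, Real.volume_Ioc, h2]

theorem intervalIntegrable_comp_distFun (hC : MeasurableSet C) {g : ℝ → ℝ} {a b : ℝ} (hab : a ≤ b)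
    (hm : AEStronglyMeasurable g (volume.restrict (Ioc (distFun C a) (distFun C b)))) :
    IntervalIntegrable (C.indicator (g ∘ distFun C)) volume a b ↔
      IntervalIntegrable g volume (distFun C a) (distFun C b) := by
  rw [intervalIntegrable_iff_integrableOn_Ioc_of_le hab,
    intervalIntegrable_iff_integrableOn_Ioc_of_le (distFun_mono hC hab), IntegrableOn,
    IntegrableOn, integrable_indicator_iff hC, IntegrableOn, Measure.restrict_restrict hC,
    ← map_distFun hC hab, integrable_map_measure (by rwa [map_distFun hC hab])
      (distFun_continuous hC).aemeasurable]

theorem integral_comp_distFun (hC : MeasurableSet C) {g : ℝ → ℝ} {a b : ℝ} (hab : a ≤ b)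
    (hm : AEStronglyMeasurable g (volume.restrict (Ioc (distFun C a) (distFun C b)))) :
    ∫ y in a..b, C.indicator (g ∘ distFun C) y = ∫ t in distFun C a..distFun C b, g t := by
  rw [intervalIntegral.integral_of_le hab,
    intervalIntegral.integral_of_le (distFun_mono hC hab), integral_indicator hC,
    Measure.restrict_restrict hC, ← map_distFun hC hab,
    integral_map (distFun_continuous hC).aemeasurable (by rwa [map_distFun hC hab])]
  rfl

/-- The fundamental theorem of calculus for `φ ∘ P`, where `P` is the distribution function of `C`:
on `C` its derivative is `φ' ∘ P`, and it does not vary off `C`. -/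
theorem integral_deriv_comp_distFun (hC : MeasurableSet C) {φ : ℝ → ℝ} (a b : ℝ)
    (hφ : AbsolutelyContinuousOnInterval φ (distFun C a) (distFun C b)) :
    IntervalIntegrable (C.indicator (deriv φ ∘ distFun C)) volume a b ∧
      ∫ y in a..b, C.indicator (deriv φ ∘ distFun C) y = φ (distFun C b) - φ (distFun C a) := by
  wlog hab : a ≤ b generalizing a b
  · obtain ⟨h1, h2⟩ := this b a hφ.symm (not_le.1 hab).le
    exact ⟨h1.symm, by rw [intervalIntegral.integral_symm, h2, neg_sub]⟩
  · have hm := (measurable_deriv φ).aestronglyMeasurable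
      (μ := volume.restrict (Ioc (distFun C a) (distFun C b)))
    exact ⟨(intervalIntegrable_comp_distFun hC hab hm).2 hφ.intervalIntegrable_deriv,
      (integral_comp_distFun hC hab hm).trans hφ.integral_deriv_eq_sub⟩

/-- Almost everywhere on `C`, the distribution function is inverted by any choice of preimages: it
is injective except on countably many level sets, and these are null sets for Lebesgue measure on
`C`. -/
theorem ae_invFun_distFun (hC : MeasurableSet C) {a b : ℝ} (hab : a ≤ b) :
    ∀ᵐ y ∂volume.restrict (C ∩ Ioc a b), Function.invFun (distFun C) (distFun C y) = y := by
  have hN := (distFun_mono hC).countable_setOfPred_two_preimages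
  have h1 : ∀ᵐ t ∂volume.restrict (Ioc (distFun C a) (distFun C b)),
      t ∉ {c | ∃ x y, x < y ∧ distFun C x = c ∧ distFun C y = c} :=
    ae_restrict_of_ae (compl_mem_ae_iff.2 (hN.measure_zero volume))
  rw [← map_distFun hC hab] at h1
  filter_upwards [ae_of_ae_map (distFun_continuous hC).aemeasurable h1] with y hy
  have h2 : distFun C (Function.invFun (distFun C) (distFun C y)) = distFun C y :=
    Function.invFun_eq ⟨y, rfl⟩
  by_contra hne
  rcases lt_or_gt_of_ne hne with h | h
  · exact hy ⟨_, _, h, h2, rfl⟩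
  · exact hy ⟨_, _, h, rfl, h2⟩

/-- Integrals over `C` are absolutely continuous functions of the distribution function of `C`: the
density is transported by a right inverse of the distribution function. -/
theorem exists_comp_distFun (hC : MeasurableSet C) {h : ℝ → ℝ} (hm : Measurable h)
    (hi : ∀ a b, IntervalIntegrable h volume a b) :
    ∃ φ : ℝ → ℝ, (∀ a b, AbsolutelyContinuousOnInterval φ (distFun C a) (distFun C b)) ∧
      ∀ y, φ (distFun C y) = ∫ t in (0 : ℝ)..y, C.indicator h t := by
  set P := distFun C with hP
  set Q := Function.invFun P with hQ
  have hmono : Monotone P := distFun_mono hC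
  have hPQ : ∀ t ∈ range P, P (Q t) = t := fun t ht => Function.invFun_eq ht
  have hrange : ∀ {a b : ℝ}, a ≤ b → Ioc (P a) (P b) ⊆ range P := fun hab t ht => by
    obtain ⟨y, -, hy⟩ := intermediate_value_Icc hab (distFun_continuous hC).continuousOn
      (Ioc_subset_Icc_self ht)
    exact ⟨y, hy⟩
  have hQmono : MonotoneOn Q (range P) := fun s hs t ht hst => by
    by_contra hlt
    have h1 := hmono (not_le.1 hlt).le
    rw [hPQ s hs, hPQ t ht] at h1
    exact hlt (le_of_eq (by rw [le_antisymm hst h1]))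
  have hgm : ∀ {a b : ℝ}, a ≤ b →
      AEStronglyMeasurable (h ∘ Q) (volume.restrict (Ioc (P a) (P b))) := fun hab =>
    (hm.comp_aemeasurable (aemeasurable_restrict_of_monotoneOn measurableSet_Ioc
      (hQmono.mono (hrange hab)))).aestronglyMeasurable
  have hcongr : ∀ {a b : ℝ}, a ≤ b →
      C.indicator ((h ∘ Q) ∘ P) =ᵐ[volume.restrict (Ioc a b)] C.indicator h := fun {a b} hab => by
    have := ae_invFun_distFun hC hab
    rw [← Measure.restrict_restrict hC, ae_restrict_iff' hC] at this
    filter_upwards [this] with y hy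
    by_cases hyC : y ∈ C
    · rw [indicator_of_mem hyC, indicator_of_mem hyC]
      exact congrArg h (hy hyC)
    · rw [indicator_of_notMem hyC, indicator_of_notMem hyC]
  have hgi : ∀ {a b : ℝ}, a ≤ b → IntervalIntegrable (h ∘ Q) volume (P a) (P b) :=
    fun {a b} hab => by
      rw [← intervalIntegrable_comp_distFun hC hab (hgm hab),
        intervalIntegrable_iff_integrableOn_Ioc_of_le hab]
      refine Integrable.congr ?_ (hcongr hab).symm
      exact ((intervalIntegrable_iff_integrableOn_Ioc_of_le hab).1 (hi a b)).indicator hC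
  have hint : ∀ {a b : ℝ}, a ≤ b → ∫ t in P a..P b, (h ∘ Q) t = ∫ y in a..b, C.indicator h y :=
    fun {a b} hab => by
      rw [← integral_comp_distFun hC hab (hgm hab), intervalIntegral.integral_of_le hab,
        intervalIntegral.integral_of_le hab]
      exact integral_congr_ae (hcongr hab)
  have hP0 : P 0 = 0 := intervalIntegral.integral_same
  refine ⟨fun t => ∫ v in (0 : ℝ)..t, (h ∘ Q) v, fun a b => ?_, fun y => ?_⟩
  · set a' := min 0 (min a b) with ha'
    set b' := max 0 (max a b) with hb'
    have h1 : a' ≤ b' := (min_le_left _ _).trans (le_max_left _ _)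
    have h2 : (0 : ℝ) ∈ uIcc (P a') (P b') := by
      rw [uIcc_of_le (hmono h1), ← hP0]
      exact ⟨hmono (min_le_left _ _), hmono (le_max_left _ _)⟩
    refine ((hgi h1).absolutelyContinuousOnInterval_intervalIntegral h2).mono ?_
    rw [uIcc_of_le (hmono h1)]
    refine uIcc_subset_Icc ⟨hmono ?_, hmono ?_⟩ ⟨hmono ?_, hmono ?_⟩ <;> simp [ha', hb']
  · simp only
    conv_lhs => rw [← hP0]
    rcases le_total 0 y with hy | hy
    · exact hint hy
    · rw [intervalIntegral.integral_symm, hint hy, ← intervalIntegral.integral_symm]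

/-- A function whose integrals over all compact intervals contained in an open set vanish is zero
almost everywhere on this set, by differentiation of its primitives on rational intervals. -/
theorem ae_eq_zero_of_integral_eq_zero {U : Set ℝ} (hU : IsOpen U) {F : ℝ → ℝ}
    (hF : ∀ a b, a ≤ b → Icc a b ⊆ U →
      IntervalIntegrable F volume a b ∧ ∫ y in a..b, F y = 0) :
    ∀ᵐ y, y ∈ U → F y = 0 := by
  have h1 : ∀ p q : ℚ, Icc (p : ℝ) q ⊆ U → ∀ᵐ y, y ∈ Ioo (p : ℝ) q → F y = 0 := by
    intro p q hpq
    rcases lt_or_ge (p : ℝ) q with hlt | hle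
    · have h2 := (hF p q hlt.le hpq).1
      filter_upwards [h2.ae_hasDerivAt_integral] with y hy hy'
      rw [uIcc_of_le hlt.le] at hy
      have h3 := hy (Ioo_subset_Icc_self hy') p (left_mem_Icc.2 hlt.le)
      have h4 : (fun x => ∫ t in (p : ℝ)..x, F t) =ᶠ[𝓝 y] fun _ => 0 := by
        filter_upwards [Ioo_mem_nhds hy'.1 hy'.2] with x hx
        exact (hF p x hx.1.le ((Icc_subset_Icc_right hx.2.le).trans hpq)).2
      exact (h3.congr_of_eventuallyEq h4.symm).unique (hasDerivAt_const y 0)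
    · exact Eventually.of_forall fun y hy => absurd (hy.1.trans hy.2) (not_lt.2 hle)
  have h2 : ∀ᵐ y, ∀ p q : ℚ, Icc (p : ℝ) q ⊆ U → y ∈ Ioo (p : ℝ) q → F y = 0 := by
    rw [ae_all_iff]; intro p
    rw [ae_all_iff]; intro q
    by_cases hpq : Icc (p : ℝ) q ⊆ U
    · filter_upwards [h1 p q hpq] with y hy _ using hy
    · exact Eventually.of_forall fun y h => absurd h hpq
  filter_upwards [h2] with y hy hyU
  obtain ⟨ε, hε, hball⟩ := Metric.isOpen_iff.1 hU y hyU
  rw [Real.ball_eq_Ioo] at hball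
  obtain ⟨p, hp1, hp2⟩ := exists_rat_btwn (show y - ε < y by linarith)
  obtain ⟨q, hq1, hq2⟩ := exists_rat_btwn (show y < y + ε by linarith)
  exact hy p q (fun z hz => hball ⟨hp1.trans_le hz.1, hz.2.trans_lt hq2⟩) ⟨hp2, hq1⟩

end DistFun

/-! ### The space `𝒮` in terms of densities -/

namespace ScaleSpeed

variable (T : ScaleSpeed)

theorem isOpen_hull : IsOpen T.hull :=
  (isOpen_lt continuous_const continuous_coe_real_ereal).inter
    (isOpen_lt continuous_coe_real_ereal continuous_const)

theorem ae_ne (c : ℝ) : ∀ᵐ y : ℝ, y ≠ c := by simp [ae_iff]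

theorem ae_mem_hull (x : T.I) : ∀ᵐ y, y ∈ uIoc 0 (T.scaleI x) → y ∈ T.hull := by
  filter_upwards [ae_ne 0, ae_ne (T.scaleI x)] with y h0 h1 hy
  rcases mem_uIoc.1 hy with ⟨h2, h3⟩ | ⟨h2, h3⟩
  · exact T.mem_hull_of_lt (x := T.origin) (x' := x) (by rwa [scaleLI_origin])
      ((lt_of_le_of_ne h3 h1).trans_le (T.scaleI_le_scaleRI x))
  · exact T.mem_hull_of_lt (x := x) (x' := T.origin) ((T.scaleLI_le_scaleI x).trans_lt h2)
      (by rw [scaleRI_origin]; exact lt_of_le_of_ne h3 h0)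

theorem distFun_noJump_eq {a b : ℝ} (hab : a ≤ b) (h : Ioo a b ⊆ T.jumpR ∪ T.jumpL) :
    distFun T.noJump a = distFun T.noJump b := by
  refine le_antisymm (distFun_mono T.measurableSet_noJump hab) ?_
  have h1 := volume_inter_Ioc T.measurableSet_noJump hab
  have h2 : volume (T.noJump ∩ Ioc a b) = 0 := by
    refine measure_mono_null (fun y hy => ?_) (measure_singleton b)
    by_contra hne
    exact hy.1 (h ⟨hy.2.1, lt_of_le_of_ne hy.2.2 hne⟩)
  rw [h2, eq_comm, ENNReal.ofReal_eq_zero, sub_nonpos] at h1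
  exact h1

theorem distFun_scaleRI (x : T.I) :
    distFun T.noJump (T.scaleRI x) = distFun T.noJump (T.scaleI x) :=
  (T.distFun_noJump_eq (T.scaleI_le_scaleRI x) fun _ hy => Or.inl
    (mem_iUnion.2 ⟨⟨x, T.mem_DR_iff'.2 (hy.1.trans hy.2)⟩, hy⟩)).symm

theorem distFun_scaleLI (x : T.I) :
    distFun T.noJump (T.scaleLI x) = distFun T.noJump (T.scaleI x) :=
  T.distFun_noJump_eq (T.scaleLI_le_scaleI x) fun _ hy => Or.inr
    (mem_iUnion.2 ⟨⟨x, T.mem_DL_iff'.2 (hy.1.trans hy.2)⟩, hy⟩)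

/-- The point `s(s⁻¹(y))` may differ from `y` only by a part of a jump interval, on which `s_c` does
not increase. -/
theorem distFun_scaleI_inverse {y : ℝ} (hy : y ∈ T.hull) :
    distFun T.noJump (T.scaleI (T.inverse y)) = distFun T.noJump y := by
  have hmono := distFun_mono T.measurableSet_noJump
  refine le_antisymm ?_ ?_
  · rw [← distFun_scaleLI]; exact hmono (T.scaleLI_inverse_le hy)
  · rw [← distFun_scaleRI]; exact hmono (T.le_scaleRI_inverse hy)

/-- The derivative of `f` with respect to the scale function, as a function of the scale: the
difference quotients on the jump intervals, `df^c/ds_c` on their complement, and `0` outside of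
`(s(l), s(r))`. -/
noncomputable def densityFun (f : T.I → ℝ) (y : ℝ) : ℝ :=
  T.jumpR.indicator (T.slopeR f ∘ T.inverse) y + T.jumpL.indicator (T.slopeL f ∘ T.inverse) y +
    (T.noJump ∩ T.hull).indicator (T.derivC (T.contPart f) ∘ T.inverse) y

theorem densityFun_jumpR (f : T.I → ℝ) {y : ℝ} (hy : y ∈ T.jumpR) :
    T.densityFun f y = T.slopeR f (T.inverse y) := by
  have h1 : y ∉ T.jumpL := Set.disjoint_left.1 T.disjoint_jump hy
  have h2 : y ∉ T.noJump ∩ T.hull := fun h => h.1 (Or.inl hy)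
  simp [densityFun, hy, h1, h2]

theorem densityFun_jumpL (f : T.I → ℝ) {y : ℝ} (hy : y ∈ T.jumpL) :
    T.densityFun f y = T.slopeL f (T.inverse y) := by
  have h1 : y ∉ T.jumpR := Set.disjoint_right.1 T.disjoint_jump hy
  have h2 : y ∉ T.noJump ∩ T.hull := fun h => h.1 (Or.inr hy)
  simp [densityFun, hy, h1, h2]

theorem densityFun_off (f : T.I → ℝ) {y : ℝ} (hy : y ∉ T.hull) : T.densityFun f y = 0 := by
  have h1 : y ∉ T.jumpR := fun h => hy (T.mem_jumpR.1 h).1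
  have h2 : y ∉ T.jumpL := fun h => hy (T.mem_jumpL.1 h).1
  simp [densityFun, hy, h1, h2]

theorem measurableSet_noJump_hull : MeasurableSet (T.noJump ∩ T.hull) :=
  T.measurableSet_noJump.inter T.isOpen_hull.measurableSet

section Density

variable {T} {f g : T.I → ℝ}

theorem memLp_indicator_inverse {V : Set ℝ} (hV : MeasurableSet V) {μ : Measure T.I}
    (hμ : μ = (volume.restrict V).map T.inverse) (hg : MemLp g 2 μ) :
    MemLp (V.indicator (g ∘ T.inverse)) 2 volume := by
  rw [hμ] at hg
  exact (memLp_indicator_iff_restrict hV).2 (hg.comp_of_map T.measurable_inverse.aemeasurable)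

theorem memLp_slopeR (hf : f ∈ T.S) :
    MemLp (T.jumpR.indicator (T.slopeR f ∘ T.inverse)) 2 volume :=
  memLp_indicator_inverse T.isOpen_jumpR.measurableSet T.muR_eq hf.2.1

theorem memLp_slopeL (hf : f ∈ T.S) :
    MemLp (T.jumpL.indicator (T.slopeL f ∘ T.inverse)) 2 volume :=
  memLp_indicator_inverse T.isOpen_jumpL.measurableSet T.muL_eq hf.2.2.1

theorem memLp_derivC (hf : f ∈ T.S) :
    MemLp ((T.noJump ∩ T.hull).indicator (T.derivC (T.contPart f) ∘ T.inverse)) 2 volume :=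
  memLp_indicator_inverse T.measurableSet_noJump_hull T.muC_eq hf.2.2.2.2.2

theorem memLp_densityFun (hf : f ∈ T.S) : MemLp (T.densityFun f) 2 volume :=
  ((memLp_slopeR hf).add (memLp_slopeL hf)).add (memLp_derivC hf)

theorem intervalIntegrable_of_memLp {F : ℝ → ℝ} (hF : MemLp F 2 volume) (a b : ℝ) :
    IntervalIntegrable F volume a b :=
  intervalIntegrable_iff.2 (((hF.locallyIntegrable (by norm_num)).integrableOn_isCompact
    isCompact_uIcc).mono_set uIoc_subset_uIcc)

/-- The fundamental theorem of calculus on `𝒮`: a function in `𝒮` is the sum of its continuous part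
and of its jumps, and each of the three contributions is an integral of the density between `0` and
`s(x)`. -/
theorem eq_add_integral (hf : f ∈ T.S) (x : T.I) :
    f x = f T.origin + ∫ y in 0..T.scaleI x, T.densityFun f y := by
  have hf' := hf
  obtain ⟨-, hR, hL, -, hrep, -⟩ := hf'
  have hspec := hrep.choose_spec
  set φ := hrep.choose with hφ
  have hder : T.derivC (T.contPart f) = fun x => deriv φ (T.sC x) := by
    rw [derivC, dif_pos hrep]
  have h0 : T.contPart f T.origin = f T.origin := by
    rw [contPart, T.intOpen_muR hR.1, T.intClosed_muL hL.1, scaleI_origin,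
      intervalIntegral.integral_same, intervalIntegral.integral_same]; ring
  have h1 : T.contPart f x - T.contPart f T.origin =
      ∫ y in 0..T.scaleI x, (T.noJump ∩ T.hull).indicator
        (T.derivC (T.contPart f) ∘ T.inverse) y := by
    have hac := hspec.2 T.origin x
    rw [sC_eq, sC_eq] at hac
    rw [hspec.1 x, hspec.1 T.origin, sC_eq, sC_eq,
      ← (integral_deriv_comp_distFun T.measurableSet_noJump _ _ hac).2, scaleI_origin]
    refine intervalIntegral.integral_congr_ae ?_
    filter_upwards [T.ae_mem_hull x] with y hy hyx
    by_cases hyC : y ∈ T.noJump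
    · have hyC' : y ∈ T.noJump ∩ T.hull := ⟨hyC, hy hyx⟩
      rw [indicator_of_mem hyC, indicator_of_mem hyC', hder,
        Function.comp_apply, Function.comp_apply, sC_eq, T.distFun_scaleI_inverse (hy hyx)]
    · rw [indicator_of_notMem hyC, indicator_of_notMem fun h => hyC h.1]
  have iR := intervalIntegrable_of_memLp (memLp_slopeR hf) 0 (T.scaleI x)
  have iL := intervalIntegrable_of_memLp (memLp_slopeL hf) 0 (T.scaleI x)
  have iC := intervalIntegrable_of_memLp (memLp_derivC hf) 0 (T.scaleI x)
  have h2 : ∫ y in 0..T.scaleI x, T.densityFun f y =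
      T.intOpen T.muR (T.slopeR f) x + T.intClosed T.muL (T.slopeL f) x +
        (T.contPart f x - T.contPart f T.origin) := by
    rw [h1, T.intOpen_muR hR.1, T.intClosed_muL hL.1, ← intervalIntegral.integral_add iR iL,
      ← intervalIntegral.integral_add (iR.add iL) iC]
    rfl
  rw [h2, h0, contPart]; ring

/-- The three integrals in the energy form are those of the product of the densities over the
complement of the jump intervals and over the jump intervals to the right and to the left. -/
theorem energy_eq (hf : f ∈ T.S) (hg : g ∈ T.S) :
    T.E f g = (1 / 2 : ℝ) * ∫ y, T.densityFun f y * T.densityFun g y := by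
  have key : ∀ {V : Set ℝ}, MeasurableSet V → ∀ {μ : Measure T.I},
      μ = (volume.restrict V).map T.inverse → ∀ {p q : T.I → ℝ}, MemLp p 2 μ → MemLp q 2 μ →
      ∫ x, p x * q x ∂μ =
        ∫ y, V.indicator (p ∘ T.inverse) y * V.indicator (q ∘ T.inverse) y := by
    intro V hV μ hμ p q hp hq
    have h1 : (fun y => V.indicator (p ∘ T.inverse) y * V.indicator (q ∘ T.inverse) y) =
        V.indicator fun y => p (T.inverse y) * q (T.inverse y) := by
      funext y
      by_cases hy : y ∈ V <;> simp [hy]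
    have hm : AEStronglyMeasurable (fun x => p x * q x) μ := hp.1.mul hq.1
    rw [hμ] at hm
    rw [h1, integral_indicator hV, hμ, integral_map T.measurable_inverse.aemeasurable hm]
  have iR := (memLp_slopeR hf).integrable_mul (memLp_slopeR hg)
  have iL := (memLp_slopeL hf).integrable_mul (memLp_slopeL hg)
  have iC := (memLp_derivC hf).integrable_mul (memLp_derivC hg)
  rw [E, key T.measurableSet_noJump_hull T.muC_eq hf.2.2.2.2.2 hg.2.2.2.2.2,
    key T.isOpen_jumpR.measurableSet T.muR_eq hf.2.1 hg.2.1,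
    key T.isOpen_jumpL.measurableSet T.muL_eq hf.2.2.1 hg.2.2.1]
  have h2 : ∀ y, T.densityFun f y * T.densityFun g y =
      (T.noJump ∩ T.hull).indicator (T.derivC (T.contPart f) ∘ T.inverse) y *
        (T.noJump ∩ T.hull).indicator (T.derivC (T.contPart g) ∘ T.inverse) y +
      T.jumpR.indicator (T.slopeR f ∘ T.inverse) y * T.jumpR.indicator (T.slopeR g ∘ T.inverse) y +
      T.jumpL.indicator (T.slopeL f ∘ T.inverse) y *
        T.jumpL.indicator (T.slopeL g ∘ T.inverse) y := by
    intro y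
    by_cases hR : y ∈ T.jumpR
    · have h1 : y ∉ T.jumpL := Set.disjoint_left.1 T.disjoint_jump hR
      have h2 : y ∉ T.noJump ∩ T.hull := fun h => h.1 (Or.inl hR)
      simp [densityFun, hR, h1, h2]
    · by_cases hL : y ∈ T.jumpL
      · have h2 : y ∉ T.noJump ∩ T.hull := fun h => h.1 (Or.inr hL)
        simp [densityFun, hR, hL, h2]
      · simp [densityFun, hR, hL]
  rw [integral_congr_ae (Eventually.of_forall h2)]
  have h3 := integral_add (iC.add iR) iL
  have h4 := integral_add iC iR
  simp only [Pi.mul_apply, Pi.add_apply] at h3 h4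
  rw [h3, h4]

end Density

section Converse

variable {T} {H : LineL2} {c : ℝ}

/-- Conversely, a primitive of an element of `L²(ℝ)` which is constant on the jump intervals is, as a
function of the scale, an element of `𝒮`. -/
theorem mem_S_of_density
    (hR : ∀ x : T.I, (x : EReal) ∈ T.DR →
      ∃ c : ℝ, ∀ᵐ y, y ∈ Ioo (T.scaleI x) (T.scaleRI x) → H y = c)
    (hL : ∀ x : T.I, (x : EReal) ∈ T.DL →
      ∃ c : ℝ, ∀ᵐ y, y ∈ Ioo (T.scaleLI x) (T.scaleI x) → H y = c)
    {G : ℝ → ℝ} (hG : ∀ a b : ℝ, ∫ y in a..b, H y = G b - G a) :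
    (fun x => G (T.scaleI x)) ∈ T.S := by
  set f : T.I → ℝ := fun x => G (T.scaleI x) with hf
  have hGc : Continuous G := primitive_continuous hG
  have hHi := lineL2_intervalIntegrable H
  have hquot : ∀ {a b c : ℝ}, a < b → (∀ᵐ y, y ∈ Ioo a b → H y = c) →
      (G a - G b) / (a - b) = c := by
    intro a b c hab h
    have h1 : G b - G a = (b - a) * c := by
      rw [← hG, intervalIntegral.integral_of_le hab.le, integral_Ioc_eq_integral_Ioo,
        setIntegral_congr_ae measurableSet_Ioo h, setIntegral_const, Measure.real,
        Real.volume_Ioo, ENNReal.toReal_ofReal (by linarith), smul_eq_mul]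
    have h2 : a - b ≠ 0 := (sub_neg.2 hab).ne
    rw [div_eq_iff h2]; linarith
  have hsR : ∀ x, T.slopeR f x = (G (T.scaleI x) - G (T.scaleRI x)) / (T.scaleI x - T.scaleRI x) :=
    fun x => by rw [slopeR, hf, T.rightLim_comp_scaleI hGc]; rfl
  have hsL : ∀ x, T.slopeL f x = (G (T.scaleI x) - G (T.scaleLI x)) / (T.scaleI x - T.scaleLI x) :=
    fun x => by rw [slopeL, hf, T.leftLim_comp_scaleI hGc]; rfl
  have hmσ : Measurable T.scaleI := T.scaleI_mono.measurable
  have hmR : Measurable (T.slopeR f) := by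
    have hm : Measurable T.scaleRI := T.scaleRI_mono.measurable
    rw [funext hsR]
    exact ((hGc.measurable.comp hmσ).sub (hGc.measurable.comp hm)).div (hmσ.sub hm)
  have hmL : Measurable (T.slopeL f) := by
    have hm : Measurable T.scaleLI := T.scaleLI_mono.measurable
    rw [funext hsL]
    exact ((hGc.measurable.comp hmσ).sub (hGc.measurable.comp hm)).div (hmσ.sub hm)
  -- The slopes of `f` at its jumps are the values of `H` on the jump intervals.
  have haeR : ∀ᵐ y, y ∈ T.jumpR → T.slopeR f (T.inverse y) = H y := by
    have : ∀ x : {x : T.I // (x : EReal) ∈ T.DR}, ∀ᵐ y,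
        y ∈ Ioo (T.scaleI x.1) (T.scaleRI x.1) → T.slopeR f (T.inverse y) = H y := by
      rintro ⟨x, hx⟩
      obtain ⟨c, hc⟩ := hR x hx
      filter_upwards [hc] with y hy hyx
      rw [T.inverse_eq_of_mem_R hyx, hy hyx, hsR, hquot (T.mem_DR_iff'.1 hx) hc]
    filter_upwards [ae_all_iff.2 this] with y hy hyR
    obtain ⟨x, hx⟩ := mem_iUnion.1 hyR
    exact hy x hx
  have haeL : ∀ᵐ y, y ∈ T.jumpL → T.slopeL f (T.inverse y) = H y := by
    have : ∀ x : {x : T.I // (x : EReal) ∈ T.DL}, ∀ᵐ y,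
        y ∈ Ioo (T.scaleLI x.1) (T.scaleI x.1) → T.slopeL f (T.inverse y) = H y := by
      rintro ⟨x, hx⟩
      obtain ⟨c, hc⟩ := hL x hx
      filter_upwards [hc] with y hy hyx
      rw [T.inverse_eq_of_mem_L hyx, hy hyx, hsL, ← hquot (T.mem_DL_iff'.1 hx) hc,
        ← neg_sub, ← neg_sub (T.scaleLI x), neg_div_neg_eq]
    filter_upwards [ae_all_iff.2 this] with y hy hyL
    obtain ⟨x, hx⟩ := mem_iUnion.1 hyL
    exact hy x hx
  have hmem : ∀ {V : Set ℝ}, MeasurableSet V → ∀ {μ : Measure T.I},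
      μ = (volume.restrict V).map T.inverse → ∀ {p : T.I → ℝ}, Measurable p →
      (∀ᵐ y, y ∈ V → p (T.inverse y) = H y) → MemLp p 2 μ := by
    intro V hV μ hμ p hp hpH
    rw [hμ, memLp_map_measure_iff hp.aestronglyMeasurable T.measurable_inverse.aemeasurable]
    refine MemLp.ae_eq ?_ ((Lp.memLp H).restrict V)
    filter_upwards [(ae_restrict_iff' hV).2 hpH] with y hy using hy.symm
  have hLpR := hmem T.isOpen_jumpR.measurableSet T.muR_eq hmR haeR
  have hLpL := hmem T.isOpen_jumpL.measurableSet T.muL_eq hmL haeL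
  -- What remains of `G` without the jumps is the integral of `H` off the jump intervals; this is an
  -- absolutely continuous function `φ` of `s_c`.
  obtain ⟨φ, hφac, hφ⟩ := exists_comp_distFun T.measurableSet_noJump
    (Lp.stronglyMeasurable H).measurable hHi
  have hiR : ∀ a b, IntervalIntegrable (T.jumpR.indicator H) volume a b := fun a b =>
    intervalIntegrable_indicator T.isOpen_jumpR.measurableSet (hHi a b)
  have hiL : ∀ a b, IntervalIntegrable (T.jumpL.indicator H) volume a b := fun a b =>
    intervalIntegrable_indicator T.isOpen_jumpL.measurableSet (hHi a b)
  have hiC : ∀ a b, IntervalIntegrable (T.noJump.indicator H) volume a b := fun a b =>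
    intervalIntegrable_indicator T.measurableSet_noJump (hHi a b)
  have hcont : ∀ x, T.contPart f x = G 0 + φ (distFun T.noJump (T.scaleI x)) := by
    intro x
    have h1 : ∫ y in 0..T.scaleI x, T.jumpR.indicator (T.slopeR f ∘ T.inverse) y =
        ∫ y in 0..T.scaleI x, T.jumpR.indicator H y := by
      refine intervalIntegral.integral_congr_ae ?_
      filter_upwards [haeR] with y hy _
      by_cases hyR : y ∈ T.jumpR
      · rw [indicator_of_mem hyR, indicator_of_mem hyR]; exact hy hyR
      · rw [indicator_of_notMem hyR, indicator_of_notMem hyR]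
    have h2 : ∫ y in 0..T.scaleI x, T.jumpL.indicator (T.slopeL f ∘ T.inverse) y =
        ∫ y in 0..T.scaleI x, T.jumpL.indicator H y := by
      refine intervalIntegral.integral_congr_ae ?_
      filter_upwards [haeL] with y hy _
      by_cases hyL : y ∈ T.jumpL
      · rw [indicator_of_mem hyL, indicator_of_mem hyL]; exact hy hyL
      · rw [indicator_of_notMem hyL, indicator_of_notMem hyL]
    have h3 : ∫ y in 0..T.scaleI x, H y = (∫ y in 0..T.scaleI x, T.noJump.indicator H y) +
        (∫ y in 0..T.scaleI x, T.jumpR.indicator H y) +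
        ∫ y in 0..T.scaleI x, T.jumpL.indicator H y := by
      rw [← intervalIntegral.integral_add (hiC _ _) (hiR _ _),
        ← intervalIntegral.integral_add ((hiC _ _).add (hiR _ _)) (hiL _ _)]
      refine intervalIntegral.integral_congr fun y _ => ?_
      by_cases hyR : y ∈ T.jumpR
      · have hyL : y ∉ T.jumpL := Set.disjoint_left.1 T.disjoint_jump hyR
        simp [noJump, hyR, hyL]
      · by_cases hyL : y ∈ T.jumpL <;> simp [noJump, hyR, hyL]
    rw [contPart, T.intOpen_muR hLpR.1, T.intClosed_muL hLpL.1, h1, h2, hφ]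
    rw [hG] at h3
    simp only [hf]
    linarith
  have hrep : ∃ φ, T.IsACRep (T.contPart f) φ := by
    refine ⟨(fun _ => G 0) + φ, fun x => by rw [hcont, sC_eq]; rfl, fun a b => ?_⟩
    rw [sC_eq, sC_eq]
    exact (LipschitzWith.const (G 0)).lipschitzOnWith.absolutelyContinuousOnInterval.add (hφac _ _)
  -- The continuous part has equal one-sided limits, as `s_c` is constant across the jump intervals.
  have hcontc : Continuous (T.contPart f) := by
    have hK : Continuous fun y => G 0 + φ (distFun T.noJump y) := by
      simp_rw [hφ]
      exact continuous_const.add (intervalIntegral.continuous_primitive hiC 0)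
    rw [funext hcont, continuous_iff_continuousAt]
    intro x
    rw [continuousAt_iff_continuous_left'_right']
    constructor
    · have h1 := (hK.tendsto _).comp (T.tendsto_scaleI_nhdsLT x)
      rwa [distFun_scaleLI] at h1
    · have h1 := (hK.tendsto _).comp (T.tendsto_scaleI_nhdsGT x)
      rwa [distFun_scaleRI] at h1
  refine ⟨T.sCont_comp_scaleI hGc, hLpR, hLpL, hcontc, hrep, ?_⟩
  -- The derivative `df^c/ds_c` is formed with some representing function `ψ`, possibly not `φ`. Since
  -- `ψ` and `φ` have the same increments along `s_c`, it still coincides with `H` off the jumps.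
  have hspec := hrep.choose_spec
  have hder : T.derivC (T.contPart f) = fun x => deriv hrep.choose (T.sC x) := by
    rw [derivC, dif_pos hrep]
  set ψ := hrep.choose with hψ
  have hsC : T.sC = fun x => distFun T.noJump (T.scaleI x) := funext T.sC_eq
  have hPm : Measurable (distFun T.noJump) :=
    (distFun_continuous T.measurableSet_noJump).measurable
  refine hmem T.measurableSet_noJump_hull T.muC_eq ?_ ?_
  · rw [hder, hsC]
    exact (measurable_deriv ψ).comp (hPm.comp hmσ)
  · have hψP : ∀ y ∈ T.hull, ψ (distFun T.noJump y) = G 0 + φ (distFun T.noJump y) := by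
      intro y hy
      rw [← T.distFun_scaleI_inverse hy, ← sC_eq, ← hspec.1, hcont, sC_eq]
    have h0 := ae_eq_zero_of_integral_eq_zero T.isOpen_hull
      (F := fun y => T.noJump.indicator (deriv ψ ∘ distFun T.noJump) y -
        T.noJump.indicator H y) <| by
        intro a b hab hsub
        have ha := hsub (left_mem_Icc.2 hab)
        have hb := hsub (right_mem_Icc.2 hab)
        have hac := hspec.2 (T.inverse a) (T.inverse b)
        rw [sC_eq, sC_eq, T.distFun_scaleI_inverse ha, T.distFun_scaleI_inverse hb] at hac
        obtain ⟨h1, h2⟩ := integral_deriv_comp_distFun T.measurableSet_noJump a b hac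
        refine ⟨h1.sub (hiC a b), ?_⟩
        rw [intervalIntegral.integral_sub h1 (hiC a b), h2, hψP a ha, hψP b hb, hφ, hφ,
          ← intervalIntegral.integral_interval_sub_left (hiC 0 b) (hiC 0 a)]
        ring
    filter_upwards [h0] with y hy hyC
    have := hy hyC.2
    simp only [indicator_of_mem hyC.1, Function.comp_apply] at this
    rw [hder]
    simp only
    rw [sC_eq, T.distFun_scaleI_inverse hyC.2]
    linarith

end Converse

end ScaleSpeed

/-! ### The state space of the regularization -/

namespace ScaleSpeed

variable (T : ScaleSpeed)

theorem exists_scale_eq (x : EReal) : ∃ z ∈ Icc T.l T.r, T.scale z = T.scale x := by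
  rcases le_or_gt x T.l with h | h
  · exact ⟨T.l, ⟨le_rfl, T.l_lt_r.le⟩, (T.scale_of_le_l h).symm⟩
  · rcases le_or_gt T.r x with h' | h'
    · exact ⟨T.r, ⟨T.l_lt_r.le, le_rfl⟩, (T.scale_of_r_le h').symm⟩
    · exact ⟨x, ⟨h.le, h'.le⟩, rfl⟩

theorem scale_mem_image (x : EReal) : T.scale x ∈ T.scale '' Icc T.l T.r := by
  obtain ⟨z, hz, h⟩ := T.exists_scale_eq x
  exact ⟨z, hz, h⟩

theorem scaleR_mem_closure (x : EReal) : T.scaleR x ∈ closure (T.scale '' Icc T.l T.r) := by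
  rcases le_or_gt T.r x with h | h
  · rw [T.scaleR_eq_of_r_le h]; exact subset_closure (T.scale_mem_image x)
  · have : (𝓝[>] x).NeBot := nhdsGT_neBot_of_exists_gt ⟨_, h⟩
    exact mem_closure_of_tendsto (T.scale_mono.tendsto_rightLim x)
      (Eventually.of_forall T.scale_mem_image)

theorem scaleL_mem_closure (x : EReal) : T.scaleL x ∈ closure (T.scale '' Icc T.l T.r) := by
  rcases le_or_gt x T.l with h | h
  · rw [T.scaleL_eq_of_le_l h]; exact subset_closure (T.scale_mem_image x)
  · have : (𝓝[<] x).NeBot := nhdsLT_neBot_of_exists_lt ⟨_, h⟩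
    exact mem_closure_of_tendsto (T.scale_mono.tendsto_leftLim x)
      (Eventually.of_forall T.scale_mem_image)

theorem closure_subset_Icc :
    closure (T.scale '' Icc T.l T.r) ⊆ Icc (T.scale T.l) (T.scale T.r) :=
  closure_minimal (by rintro _ ⟨x, -, rfl⟩; exact ⟨T.scale_l_le x, T.le_scale_r x⟩) isClosed_Icc

theorem notMem_closure_of_jumpR {y : ℝ} (hy : y ∈ T.jumpR) :
    (y : EReal) ∉ closure (T.scale '' Icc T.l T.r) := by
  obtain ⟨⟨x, hx⟩, h1, h2⟩ := mem_iUnion.1 hy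
  rw [← EReal.coe_lt_coe_iff, coe_scaleI] at h1
  rw [← EReal.coe_lt_coe_iff, coe_scaleRI] at h2
  intro hcl
  obtain ⟨_, h3, z, -, rfl⟩ := mem_closure_iff.1 hcl _ isOpen_Ioo ⟨h1, h2⟩
  rcases le_or_gt z x with hz | hz
  · exact not_le.2 h3.1 (T.scale_mono hz)
  · exact not_le.2 h3.2 (T.scaleR_le hz)

theorem notMem_closure_of_jumpL {y : ℝ} (hy : y ∈ T.jumpL) :
    (y : EReal) ∉ closure (T.scale '' Icc T.l T.r) := by
  obtain ⟨⟨x, hx⟩, h1, h2⟩ := mem_iUnion.1 hy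
  rw [← EReal.coe_lt_coe_iff, coe_scaleLI] at h1
  rw [← EReal.coe_lt_coe_iff, coe_scaleI] at h2
  intro hcl
  obtain ⟨_, h3, z, -, rfl⟩ := mem_closure_iff.1 hcl _ isOpen_Ioo ⟨h1, h2⟩
  rcases lt_or_ge z x with hz | hz
  · exact not_le.2 h3.1 (T.le_scaleL hz)
  · exact not_le.2 h3.2 (T.scale_mono hz)

theorem eq_of_mem_noJump {y : ℝ} (hy : y ∈ T.hull) (hy' : y ∈ T.noJump) :
    y = T.scaleI (T.inverse y) ∨
      ((T.inverse y : EReal) ∈ T.DR ∧ y = T.scaleRI (T.inverse y)) ∨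
      ((T.inverse y : EReal) ∈ T.DL ∧ y = T.scaleLI (T.inverse y)) := by
  rcases lt_trichotomy y (T.scaleI (T.inverse y)) with h | h | h
  · refine Or.inr (Or.inr ⟨T.mem_DL_iff'.2 ((T.scaleLI_inverse_le hy).trans_lt h), ?_⟩)
    by_contra hne
    exact hy' (Or.inr (T.mem_jumpL.2
      ⟨hy, lt_of_le_of_ne (T.scaleLI_inverse_le hy) (Ne.symm hne), h⟩))
  · exact Or.inl h
  · refine Or.inr (Or.inl ⟨T.mem_DR_iff'.2 (h.trans_le (T.le_scaleRI_inverse hy)), ?_⟩)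
    by_contra hne
    exact hy' (Or.inl (T.mem_jumpR.2 ⟨hy, h, lt_of_le_of_ne (T.le_scaleRI_inverse hy) hne⟩))

/-- Between `s(l)` and `s(r)`, the regularized state space is the complement of the jump
intervals. -/
theorem mem_IHat_of_hull {y : ℝ} (hy : y ∈ T.hull) : y ∈ T.IHat ↔ y ∈ T.noJump := by
  constructor
  · rintro ⟨h, -⟩ (h' | h')
    · exact T.notMem_closure_of_jumpR h' h
    · exact T.notMem_closure_of_jumpL h' h
  · intro h
    refine ⟨?_, fun h' => absurd h' hy.1.ne', fun h' => absurd h' hy.2.ne⟩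
    rcases T.eq_of_mem_noJump hy h with h1 | ⟨-, h1⟩ | ⟨-, h1⟩
    · rw [h1, coe_scaleI]; exact subset_closure (T.scale_mem_image _)
    · rw [h1, coe_scaleRI]; exact T.scaleR_mem_closure _
    · rw [h1, coe_scaleLI]; exact T.scaleL_mem_closure _

theorem mem_Icc_of_mem_IHat {y : ℝ} (hy : y ∈ T.IHat) :
    (y : EReal) ∈ Icc (T.scale T.l) (T.scale T.r) := T.closure_subset_Icc hy.1

theorem isClosed_noJump : IsClosed T.noJump := (T.isOpen_jumpR.union T.isOpen_jumpL).isClosed_compl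

theorem hull_of_notMem_noJump {y : ℝ} (hy : y ∉ T.noJump) : y ∈ T.hull := by
  rcases not_not.1 hy with h | h
  · exact (T.mem_jumpR.1 h).1
  · exact (T.mem_jumpL.1 h).1

theorem IHat_subset_noJump : T.IHat ⊆ T.noJump := fun y hy => by
  by_contra h
  exact h ((T.mem_IHat_of_hull (T.hull_of_notMem_noJump h)).1 hy)

theorem mem_IHat_of_scale {x : EReal} {y : ℝ} (h : (y : EReal) = T.scale x)
    (hl : T.scale x = T.scale T.l → T.ReflectingL) (hr : T.scale x = T.scale T.r → T.ReflectingR) :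
    y ∈ T.IHat :=
  ⟨by rw [h]; exact subset_closure (T.scale_mem_image x), by rwa [h], by rwa [h]⟩

/-- Each point of the regularized state space is a value or a one-sided limit of the scale
function at a point of the state space. -/
theorem exists_of_mem_IHat {y : ℝ} (hy : y ∈ T.IHat) : ∃ x : T.I, y = T.scaleI x ∨
    ((x : EReal) ∈ T.DR ∧ y = T.scaleRI x) ∨ ((x : EReal) ∈ T.DL ∧ y = T.scaleLI x) := by
  by_cases h : y ∈ T.hull
  · exact ⟨_, T.eq_of_mem_noJump h (T.IHat_subset_noJump hy)⟩
  · have h1 := T.mem_Icc_of_mem_IHat hy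
    by_cases h2 : (y : EReal) = T.scale T.l
    · have hI : T.l ∈ T.I :=
        ⟨⟨le_rfl, T.l_lt_r.le⟩, fun _ => hy.2.1 h2, fun h => absurd h T.l_lt_r.ne⟩
      exact ⟨⟨T.l, hI⟩, Or.inl (by rw [← EReal.coe_eq_coe_iff, coe_scaleI]; exact h2)⟩
    · have h3 : (y : EReal) = T.scale T.r := by
        by_contra h3
        exact h ⟨lt_of_le_of_ne h1.1 (Ne.symm h2), lt_of_le_of_ne h1.2 h3⟩
      have hI : T.r ∈ T.I :=
        ⟨⟨T.l_lt_r.le, le_rfl⟩, fun h => absurd h T.l_lt_r.ne', fun _ => hy.2.2 h3⟩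
      exact ⟨⟨T.r, hI⟩, Or.inl (by rw [← EReal.coe_eq_coe_iff, coe_scaleI]; exact h3)⟩

/-- `Î` differs from the closed set `noJump ∩ [s(l), s(r)]` at most in the ends `s(l)` and `s(r)`, and
an interval of `Î` contains such an end only if this is one of its own ends. -/
instance : CompactIccSpace T.IHat := by
  refine ⟨fun {a b} => ?_⟩
  rw [Topology.IsInducing.subtypeVal.isCompact_iff]
  have h1 : Subtype.val '' Icc a b = T.noJump ∩ Icc (a : ℝ) b := by
    ext y
    constructor
    · rintro ⟨z, hz, rfl⟩
      exact ⟨T.IHat_subset_noJump z.2, hz⟩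
    · rintro ⟨hy, hay, hyb⟩
      suffices h : y ∈ T.IHat from ⟨⟨y, h⟩, ⟨hay, hyb⟩, rfl⟩
      by_cases h : y ∈ T.hull
      · exact (T.mem_IHat_of_hull h).2 hy
      · have ha := (T.mem_Icc_of_mem_IHat a.2).1
        have hb := (T.mem_Icc_of_mem_IHat b.2).2
        have hay' : ((a : ℝ) : EReal) ≤ y := EReal.coe_le_coe_iff.2 hay
        have hyb' : (y : EReal) ≤ (b : ℝ) := EReal.coe_le_coe_iff.2 hyb
        by_cases h2 : T.scale T.l < y
        · have h3 : T.scale T.r ≤ y := not_lt.1 fun h3 => h ⟨h2, h3⟩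
          have h4 : y = b := EReal.coe_eq_coe_iff.1 (le_antisymm hyb' (hb.trans h3))
          rw [h4]; exact b.2
        · have h4 : y = a := EReal.coe_eq_coe_iff.1 (le_antisymm ((not_lt.1 h2).trans ha) hay')
          rw [h4]; exact a.2
  rw [h1]
  exact isCompact_Icc.inter_left T.isClosed_noJump

/-! ### Jump intervals and gaps -/

theorem notMem_flat_of_DR {x : EReal} (hx : x ∈ T.DR) : x ∉ T.flat := by
  rintro ⟨-, V, hV, h⟩
  have hx' := T.mem_Ioo_of_mem_DR hx
  rw [mem_DR_iff] at hx
  have : (𝓝[>] x).NeBot := nhdsGT_neBot_of_exists_gt ⟨_, hx'.2⟩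
  have h1 : ∀ᶠ z in 𝓝[>] x, z ∈ V ∩ Iio T.r :=
    mem_nhdsWithin_of_mem_nhds (inter_mem hV (Iio_mem_nhds hx'.2))
  obtain ⟨z, ⟨hzV, hzr⟩, hxz⟩ := (h1.and self_mem_nhdsWithin).exists
  have := h z ⟨hzV, (hx'.1.trans hxz).le, (show z < T.r from hzr).le⟩
  exact not_le.2 hx ((T.scaleR_le hxz).trans this.le)

theorem notMem_flat_of_DL {x : EReal} (hx : x ∈ T.DL) : x ∉ T.flat := by
  rintro ⟨-, V, hV, h⟩
  have hx' := T.mem_Ioo_of_mem_DL hx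
  rw [mem_DL_iff] at hx
  have : (𝓝[<] x).NeBot := nhdsLT_neBot_of_exists_lt ⟨_, hx'.1⟩
  have h1 : ∀ᶠ z in 𝓝[<] x, z ∈ V ∩ Ioi T.l :=
    mem_nhdsWithin_of_mem_nhds (inter_mem hV (Ioi_mem_nhds hx'.1))
  obtain ⟨z, ⟨hzV, hzl⟩, hxz⟩ := (h1.and self_mem_nhdsWithin).exists
  have := h z ⟨hzV, (show T.l < z from hzl).le, (lt_trans hxz hx'.2).le⟩
  exact not_le.2 hx (this.symm.le.trans (T.le_scaleL hxz))

theorem flat_of_const {c d v : EReal} (hl : T.l ≤ c) (hr : d ≤ T.r)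
    (h : ∀ z ∈ Ioo c d, T.scale z = v) : Ioo c d ⊆ T.flat \ {T.l, T.r} := fun z hz =>
  ⟨⟨⟨hl.trans hz.1.le, hz.2.le.trans hr⟩, Ioo c d, Ioo_mem_nhds hz.1 hz.2,
    fun w hw => (h w hw.1).trans (h z hz).symm⟩, by
      rintro (h' | h')
      · exact (hl.trans_lt hz.1).ne' h'
      · exact (hz.2.trans_le hr).ne h'⟩

variable {T}

/-- If the scale function is constant between `l` and a jump `x`, then `(l, x)` is an isolated
interval, and `l` is reflecting by (DK). -/
theorem reflectingL_of_DK (hDK : T.DK) {x : EReal} (hx : x ∈ T.DR ∪ T.DL)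
    (h : ∀ z, T.l < z → z < x → T.scale z = T.scale T.l) : T.ReflectingL := by
  have hx' : x ∈ Ioo T.l T.r := hx.elim T.mem_Ioo_of_mem_DR T.mem_Ioo_of_mem_DL
  have hflat : x ∉ T.flat := hx.elim T.notMem_flat_of_DR T.notMem_flat_of_DL
  have h1 : T.IsIsolatedInterval T.l x :=
    ⟨⟨hx'.1, T.flat_of_const le_rfl hx'.2.le fun z hz => h z hz.1 hz.2, by simp,
      fun h' => hflat h'.1⟩, Or.inr (Or.inl rfl), Or.inl hx⟩
  exact (hDK _ _ h1).1 rfl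

/-- If the scale function is constant between a jump `x` and `r`, then `(x, r)` is an isolated
interval, and `r` is reflecting by (DK). -/
theorem reflectingR_of_DK (hDK : T.DK) {x : EReal} (hx : x ∈ T.DR ∪ T.DL)
    (h : ∀ z, x < z → z < T.r → T.scale z = T.scale T.r) : T.ReflectingR := by
  have hx' : x ∈ Ioo T.l T.r := hx.elim T.mem_Ioo_of_mem_DR T.mem_Ioo_of_mem_DL
  have hflat : x ∉ T.flat := hx.elim T.notMem_flat_of_DR T.notMem_flat_of_DL
  have h1 : T.IsIsolatedInterval x T.r :=
    ⟨⟨hx'.2, T.flat_of_const hx'.1.le le_rfl fun z hz => h z hz.1 hz.2, fun h' => hflat h'.1,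
      by simp⟩, Or.inl hx, Or.inr (Or.inr rfl)⟩
  exact (hDK _ _ h1).2 rfl

/-- The ends of the jump interval at `x` belong to `Î`. If one of them is `s(l)` or `s(r)`, then the
scale function is constant between `x` and `l` or `r`, which is reflecting by (DK). -/
theorem mem_IHat_of_jumpR (hDK : T.DK) {x : T.I} (hx : (x : EReal) ∈ T.DR) :
    T.scaleI x ∈ T.IHat ∧ T.scaleRI x ∈ T.IHat := by
  have hlt := T.mem_DR_iff.1 hx
  have hle : T.scaleR x ≤ T.scale T.r := by
    rw [← T.scaleR_eq_of_r_le le_rfl]; exact T.scaleR_mono x.2.1.2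
  refine ⟨T.mem_IHat_of_scale (T.coe_scaleI x) (fun h => ?_)
    (fun h => absurd h (hlt.trans_le hle).ne), ⟨?_, ?_, ?_⟩⟩
  · exact reflectingL_of_DK hDK (Or.inl hx) fun z _ hzx =>
      le_antisymm (h ▸ T.scale_mono hzx.le) (T.scale_l_le z)
  · rw [coe_scaleRI]; exact T.scaleR_mem_closure _
  · rw [coe_scaleRI]; exact fun h => absurd h ((T.scale_l_le x).trans_lt hlt).ne'
  · rw [coe_scaleRI]
    exact fun h => reflectingR_of_DK hDK (Or.inl hx) fun z hxz _ =>
      le_antisymm (T.le_scale_r z) (h ▸ T.scaleR_le hxz)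

theorem mem_IHat_of_jumpL (hDK : T.DK) {x : T.I} (hx : (x : EReal) ∈ T.DL) :
    T.scaleLI x ∈ T.IHat ∧ T.scaleI x ∈ T.IHat := by
  have hlt := T.mem_DL_iff.1 hx
  have hle : T.scale T.l ≤ T.scaleL x := by
    rw [← T.scaleL_eq_of_le_l le_rfl]; exact T.scaleL_mono x.2.1.1
  refine ⟨⟨?_, ?_, ?_⟩, T.mem_IHat_of_scale (T.coe_scaleI x)
    (fun h => absurd h (hle.trans_lt hlt).ne') (fun h => ?_)⟩
  · rw [coe_scaleLI]; exact T.scaleL_mem_closure _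
  · rw [coe_scaleLI]
    exact fun h => reflectingL_of_DK hDK (Or.inr hx) fun z _ hzx =>
      le_antisymm (h ▸ T.le_scaleL hzx) (T.scale_l_le z)
  · rw [coe_scaleLI]; exact fun h => absurd h (hlt.trans_le (T.le_scale_r x)).ne
  · exact reflectingR_of_DK hDK (Or.inr hx) fun z hxz _ =>
      le_antisymm (T.le_scale_r z) (h ▸ T.scale_mono hxz.le)

/-- The jump interval `(s(x), s(x+))` as a gap of the regularized state space. -/
theorem gap_of_jumpR (hDK : T.DK) {x : T.I} (hx : (x : EReal) ∈ T.DR) :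
    ((⟨T.scaleI x, (mem_IHat_of_jumpR hDK hx).1⟩, ⟨T.scaleRI x, (mem_IHat_of_jumpR hDK hx).2⟩) :
      T.IHat × T.IHat) ∈ gapPairs T.IHat := by
  refine ⟨T.mem_DR_iff'.1 hx, fun z => ?_⟩
  by_contra h
  push Not at h
  exact T.IHat_subset_noJump z.2 (Or.inl (mem_iUnion.2 ⟨⟨x, hx⟩, h.1, h.2⟩))

/-- The jump interval `(s(x-), s(x))` as a gap of the regularized state space. -/
theorem gap_of_jumpL (hDK : T.DK) {x : T.I} (hx : (x : EReal) ∈ T.DL) :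
    ((⟨T.scaleLI x, (mem_IHat_of_jumpL hDK hx).1⟩, ⟨T.scaleI x, (mem_IHat_of_jumpL hDK hx).2⟩) :
      T.IHat × T.IHat) ∈ gapPairs T.IHat := by
  refine ⟨T.mem_DL_iff'.1 hx, fun z => ?_⟩
  by_contra h
  push Not at h
  exact T.IHat_subset_noJump z.2 (Or.inr (mem_iUnion.2 ⟨⟨x, hx⟩, h.1, h.2⟩))

theorem mem_gapUnion_of_hull (hDK : T.DK) {y : ℝ} (hy : y ∈ T.hull) (hy' : y ∉ T.IHat) :
    y ∈ gapUnion T.IHat := by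
  rw [T.mem_IHat_of_hull hy] at hy'
  rcases not_not.1 hy' with h | h
  · obtain ⟨⟨x, hx⟩, hyx⟩ := mem_iUnion.1 h
    exact mem_iUnion.2 ⟨⟨_, gap_of_jumpR hDK hx⟩, hyx⟩
  · obtain ⟨⟨x, hx⟩, hyx⟩ := mem_iUnion.1 h
    exact mem_iUnion.2 ⟨⟨_, gap_of_jumpL hDK hx⟩, hyx⟩

theorem mem_hull_of_gap {p : T.IHat × T.IHat} {y : ℝ} (hy : y ∈ Ioo (p.1 : ℝ) p.2) : y ∈ T.hull :=
  ⟨(T.mem_Icc_of_mem_IHat p.1.2).1.trans_lt (EReal.coe_lt_coe_iff.2 hy.1),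
    (EReal.coe_lt_coe_iff.2 hy.2).trans_le (T.mem_Icc_of_mem_IHat p.2.2).2⟩

/-- Every gap of the regularized state space is a jump interval of the scale function. -/
theorem exists_jump_of_gap (hDK : T.DK) {p : T.IHat × T.IHat} (hp : p ∈ gapPairs T.IHat) :
    ∃ x : T.I, ((x : EReal) ∈ T.DR ∧ (p.1 : ℝ) = T.scaleI x ∧ (p.2 : ℝ) = T.scaleRI x) ∨
      ((x : EReal) ∈ T.DL ∧ (p.1 : ℝ) = T.scaleLI x ∧ (p.2 : ℝ) = T.scaleI x) := by
  have hlt : (p.1 : ℝ) < p.2 := hp.1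
  obtain ⟨y, hy⟩ := exists_between hlt
  have hyK : y ∉ T.IHat := fun h =>
    Set.disjoint_left.1 disjoint_gapUnion h (mem_iUnion.2 ⟨⟨p, hp⟩, hy⟩)
  have huniq : ∀ q : gapPairs T.IHat, y ∈ Ioo (q.1.1 : ℝ) q.1.2 → p = q.1 := fun q hq => by
    by_contra hne
    exact Set.disjoint_left.1
      (gapPairs_disjoint (fun h => hne (congrArg Subtype.val h) : (⟨p, hp⟩ : gapPairs T.IHat) ≠ q))
      hy hq
  rw [T.mem_IHat_of_hull (mem_hull_of_gap hy)] at hyK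
  rcases not_not.1 hyK with h | h
  · obtain ⟨⟨x, hx⟩, hyx⟩ := mem_iUnion.1 h
    have := huniq ⟨_, gap_of_jumpR hDK hx⟩ hyx
    exact ⟨x, Or.inl ⟨hx, by rw [this], by rw [this]⟩⟩
  · obtain ⟨⟨x, hx⟩, hyx⟩ := mem_iUnion.1 h
    have := huniq ⟨_, gap_of_jumpL hDK hx⟩ hyx
    exact ⟨x, Or.inr ⟨hx, by rw [this], by rw [this]⟩⟩

theorem isComponentInterval_iff {p : T.IHat × T.IHat} :
    IsComponentInterval T.gapSet ((p.1 : ℝ) : EReal) ((p.2 : ℝ) : EReal) ↔ p ∈ gapPairs T.IHat := by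
  constructor
  · rintro ⟨h1, h2, -, -⟩
    refine ⟨EReal.coe_lt_coe_iff.1 h1, fun z => ?_⟩
    by_contra h
    push Not at h
    exact (h2 ⟨EReal.coe_lt_coe_iff.2 h.1, EReal.coe_lt_coe_iff.2 h.2⟩).2 ⟨z, z.2, rfl⟩
  · rintro ⟨h1, h2⟩
    refine ⟨EReal.coe_lt_coe_iff.2 h1, fun z hz => ⟨?_, ?_⟩, fun h => h.2 ⟨_, p.1.2, rfl⟩,
      fun h => h.2 ⟨_, p.2.2, rfl⟩⟩
    · exact ⟨(T.mem_Icc_of_mem_IHat p.1.2).1.trans_lt hz.1,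
        hz.2.trans_le (T.mem_Icc_of_mem_IHat p.2.2).2⟩
    · rintro ⟨y, hy, rfl⟩
      rcases h2 ⟨y, hy⟩ with h | h
      · exact not_le.2 hz.1 (EReal.coe_le_coe_iff.2 h)
      · exact not_le.2 hz.2 (EReal.coe_le_coe_iff.2 h)

/-- The components of `(s(l), s(r)) \ Î` with ends in `Î` are the intervals between consecutive points
of `Î`. -/
def gapEquiv (T : ScaleSpeed) : T.Gap ≃ gapPairs T.IHat :=
  Equiv.subtypeEquivRight fun _ => isComponentInterval_iff

theorem exists_gap (hDK : T.DK) {a b : EReal} (h : IsComponentInterval T.gapSet a b) :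
    ∃ k : T.Gap, ((k.left : ℝ) : EReal) = a ∧ ((k.right : ℝ) : EReal) = b := by
  obtain ⟨hab, hsub, ha, hb⟩ := h
  obtain ⟨y, hay, hyb⟩ := EReal.lt_iff_exists_real_btwn.1 hab
  obtain ⟨hy, hyK⟩ := hsub ⟨hay, hyb⟩
  have hyK : y ∉ T.IHat := fun h => hyK ⟨y, h, rfl⟩
  obtain ⟨⟨p, hp⟩, hyp⟩ := mem_iUnion.1 (mem_gapUnion_of_hull hDK hy hyK)
  have hcomp := isComponentInterval_iff.2 hp
  have h1 : ((p.1 : ℝ) : EReal) < y := EReal.coe_lt_coe_iff.2 hyp.1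
  have h2 : (y : EReal) < ((p.2 : ℝ) : EReal) := EReal.coe_lt_coe_iff.2 hyp.2
  refine ⟨⟨p, hcomp⟩, ?_, ?_⟩
  · rcases lt_trichotomy ((p.1 : ℝ) : EReal) a with h | h | h
    · exact absurd (hcomp.2.1 ⟨h, hay.trans h2⟩) ha
    · exact h
    · exact absurd (hsub ⟨h, h1.trans hyb⟩) hcomp.2.2.1
  · rcases lt_trichotomy ((p.2 : ℝ) : EReal) b with h | h | h
    · exact absurd (hsub ⟨hay.trans h2, h⟩) hcomp.2.2.2
    · exact h
    · exact absurd (hcomp.2.1 ⟨h1.trans hyb, h⟩) hb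

/-! ### The ends of the regularized state space -/

theorem exists_mem_IHat_le (hDK : T.DK) {y : ℝ} (hy : y ∈ T.hull) :
    ∃ z ∈ T.IHat, z ≤ y := by
  by_cases h : y ∈ T.IHat
  · exact ⟨y, h, le_rfl⟩
  · obtain ⟨⟨p, hp⟩, hyp⟩ := mem_iUnion.1 (mem_gapUnion_of_hull hDK hy h)
    exact ⟨p.1, p.1.2, hyp.1.le⟩

theorem exists_le_mem_IHat (hDK : T.DK) {y : ℝ} (hy : y ∈ T.hull) :
    ∃ z ∈ T.IHat, y ≤ z := by
  by_cases h : y ∈ T.IHat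
  · exact ⟨y, h, le_rfl⟩
  · obtain ⟨⟨p, hp⟩, hyp⟩ := mem_iUnion.1 (mem_gapUnion_of_hull hDK hy h)
    exact ⟨p.2, p.2.2, hyp.2.le⟩

theorem hull_nonempty (T : ScaleSpeed) : T.hull.Nonempty := by
  obtain ⟨y, h⟩ := EReal.lt_iff_exists_real_btwn.1 T.scale_l_lt_scale_r
  exact ⟨y, h⟩

theorem nonempty_IHat (hDK : T.DK) : Nonempty T.IHat := by
  obtain ⟨y, hy⟩ := T.hull_nonempty
  obtain ⟨z, hz, -⟩ := exists_mem_IHat_le hDK hy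
  exact ⟨⟨z, hz⟩⟩

/-- The limit points of `Î` outside `Î` are the finite ends which are not reflecting. -/
theorem mem_closure_diff_iff (hDK : T.DK) {j : ℝ} : j ∈ closure T.IHat \ T.IHat ↔
    j ∉ T.IHat ∧ ((j : EReal) = T.scale T.l ∨ (j : EReal) = T.scale T.r) := by
  constructor
  · rintro ⟨h, h'⟩
    refine ⟨h', ?_⟩
    have h1 : j ∈ T.noJump :=
      closure_minimal T.IHat_subset_noJump T.isClosed_noJump h
    have h2 : (j : EReal) ∈ Icc (T.scale T.l) (T.scale T.r) :=
      closure_minimal (fun y hy => T.mem_Icc_of_mem_IHat hy)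
        (isClosed_Icc.preimage continuous_coe_real_ereal) h
    by_contra hne
    push Not at hne
    exact h' ((T.mem_IHat_of_hull ⟨lt_of_le_of_ne h2.1 (Ne.symm hne.1),
      lt_of_le_of_ne h2.2 hne.2⟩).2 h1)
  · rintro ⟨h', h⟩
    refine ⟨?_, h'⟩
    rw [Metric.mem_closure_iff]
    intro ε hε
    rcases h with h | h
    · have h1 : (j : EReal) < min ((j + ε : ℝ) : EReal) (T.scale T.r) :=
        lt_min (EReal.coe_lt_coe_iff.2 (by linarith)) (h ▸ T.scale_l_lt_scale_r)
      obtain ⟨y, hjy, hy⟩ := EReal.lt_iff_exists_real_btwn.1 h1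
      obtain ⟨z, hz, hzy⟩ := exists_mem_IHat_le hDK
        (⟨h ▸ hjy, hy.trans_le (min_le_right _ _)⟩ : y ∈ T.hull)
      have h2 : j ≤ z := EReal.coe_le_coe_iff.1 (h.symm ▸ (T.mem_Icc_of_mem_IHat hz).1)
      have h3 : y < j + ε := EReal.coe_lt_coe_iff.1 (hy.trans_le (min_le_left _ _))
      refine ⟨z, hz, ?_⟩
      rw [Real.dist_eq, abs_lt]
      constructor <;> linarith
    · have h1 : max ((j - ε : ℝ) : EReal) (T.scale T.l) < (j : EReal) :=
        max_lt (EReal.coe_lt_coe_iff.2 (by linarith)) (h ▸ T.scale_l_lt_scale_r)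
      obtain ⟨y, hy, hyj⟩ := EReal.lt_iff_exists_real_btwn.1 h1
      obtain ⟨z, hz, hzy⟩ := exists_le_mem_IHat hDK
        (⟨(le_max_right _ _).trans_lt hy, h ▸ hyj⟩ : y ∈ T.hull)
      have h2 : z ≤ j := EReal.coe_le_coe_iff.1 (h.symm ▸ (T.mem_Icc_of_mem_IHat hz).2)
      have h3 : j - ε < y := EReal.coe_lt_coe_iff.1 ((le_max_left _ _).trans_lt hy)
      refine ⟨z, hz, ?_⟩
      rw [Real.dist_eq, abs_lt]
      constructor <;> linarith

end ScaleSpeed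

/-! ### The speed measure of the regularization -/

namespace ScaleSpeed

variable {T : ScaleSpeed}

theorem exists_right_mem_preimage {p q x : EReal} (hx : x < T.r) (h : T.scaleR x ∈ Ioo p q) :
    ∃ z, x < z ∧ z < T.r ∧ T.scale z ∈ Ioo p q := by
  have : (𝓝[>] x).NeBot := nhdsGT_neBot_of_exists_gt ⟨_, hx⟩
  have h1 : ∀ᶠ z in 𝓝[>] x, z < T.r := mem_nhdsWithin_of_mem_nhds (Iio_mem_nhds hx)
  have h2 := (T.scale_mono.tendsto_rightLim x).eventually (Ioo_mem_nhds h.1 h.2)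
  obtain ⟨z, ⟨hz1, hz2⟩, hz3⟩ := ((h1.and h2).and self_mem_nhdsWithin).exists
  exact ⟨z, hz3, hz1, hz2⟩

theorem exists_left_mem_preimage {p q x : EReal} (hx : T.l < x) (h : T.scaleL x ∈ Ioo p q) :
    ∃ z, z < x ∧ T.l < z ∧ T.scale z ∈ Ioo p q := by
  have : (𝓝[<] x).NeBot := nhdsLT_neBot_of_exists_lt ⟨_, hx⟩
  have h1 : ∀ᶠ z in 𝓝[<] x, T.l < z := mem_nhdsWithin_of_mem_nhds (Ioi_mem_nhds hx)
  have h2 := (T.scale_mono.tendsto_leftLim x).eventually (Ioo_mem_nhds h.1 h.2)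
  obtain ⟨z, ⟨hz1, hz2⟩, hz3⟩ := ((h1.and h2).and self_mem_nhdsWithin).exists
  exact ⟨z, hz3, hz1, hz2⟩

theorem scaleR_eq_of_notMem {x : EReal} (h : x ∉ T.DR) : T.scaleR x = T.scale x :=
  le_antisymm (not_lt.1 (T.mem_DR_iff.not.1 h)) (T.scale_le_scaleR x)

theorem scaleL_eq_of_notMem {x : EReal} (h : x ∉ T.DL) : T.scaleL x = T.scale x :=
  le_antisymm (T.scaleL_le_scale x) (not_lt.1 (T.mem_DL_iff.not.1 h))

theorem scaleR_eq_of_const {c d v : EReal} (hcd : c < d) (h : ∀ z ∈ Ioo c d, T.scale z = v) :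
    T.scaleR c = v := by
  have : (𝓝[>] c).NeBot := nhdsGT_neBot_of_exists_gt ⟨_, hcd⟩
  refine rightLim_eq_of_tendsto (tendsto_const_nhds.congr' ?_)
  filter_upwards [Ioo_mem_nhdsGT hcd] with z hz using (h z hz).symm

theorem scaleL_eq_of_const {c d v : EReal} (hcd : c < d) (h : ∀ z ∈ Ioo c d, T.scale z = v) :
    T.scaleL d = v := by
  have : (𝓝[<] d).NeBot := nhdsLT_neBot_of_exists_lt ⟨_, hcd⟩
  refine leftLim_eq_of_tendsto (tendsto_const_nhds.congr' ?_)
  filter_upwards [Ioo_mem_nhdsLT hcd] with z hz using (h z hz).symm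

theorem scale_const_of_flat {c d : EReal} (hl : T.l ≤ c) (hr : d ≤ T.r)
    (h : ∀ z ∈ Ioo c d, z ∈ T.flat) {u v : EReal} (hu : u ∈ Ioo c d) (hv : v ∈ Ioo c d) :
    T.scale u = T.scale v := by
  have : PreconnectedSpace (Ioo c d) := Subtype.preconnectedSpace isPreconnected_Ioo
  have h1 : IsLocallyConstant fun z : Ioo c d => T.scale z := by
    rw [IsLocallyConstant.iff_eventually_eq]
    intro z
    obtain ⟨-, V, hV, hconst⟩ := h z z.2
    filter_upwards [continuous_subtype_val.continuousAt.preimage_mem_nhds hV] with w hw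
    exact hconst w ⟨hw, hl.trans w.2.1.le, w.2.2.le.trans hr⟩
  exact h1.apply_eq_of_preconnectedSpace ⟨u, hu⟩ ⟨v, hv⟩

/-- Hypothesis (DM) says that the image of the speed measure under the scale function charges every
open interval which contains a value of the scale function. -/
theorem measure_preimage_pos (hDM : T.DM) {p q : EReal}
    (h : ∃ x ∈ Icc T.l T.r, T.scale x ∈ Ioo p q) : 0 < T.m (T.scale ⁻¹' Ioo p q) := by
  set A : Set EReal := {x | x ∈ Icc T.l T.r ∧ T.scale x ∈ Ioo p q} with hA
  by_cases htwo : ∃ x ∈ A, ∃ y ∈ A, x < y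
  · obtain ⟨x, hx, y, hy, hxy⟩ := htwo
    set c := sInf A with hc
    set d := sSup A with hd
    have hcx : c ≤ x := sInf_le hx
    have hyd : y ≤ d := le_sSup hy
    have hcd : c < d := hcx.trans_lt (hxy.trans_le hyd)
    have hlc : T.l ≤ c := le_sInf fun z hz => hz.1.1
    have hdr : d ≤ T.r := sSup_le fun z hz => hz.1.2
    have hsub : ∀ z ∈ Ioo c d, T.scale z ∈ Ioo p q := by
      rintro z ⟨hz1, hz2⟩
      obtain ⟨a, ha, haz⟩ := sInf_lt_iff.1 hz1
      obtain ⟨b, hb, hzb⟩ := lt_sSup_iff.1 hz2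
      exact ⟨ha.2.1.trans_le (T.scale_mono haz.le), (T.scale_mono hzb.le).trans_lt hb.2.2⟩
    -- Either the scale function is constant on the interval `(c, d)` spanned by `A`, or this
    -- interval contains a point of the support.
    by_cases hflat : ∀ z ∈ Ioo c d, z ∈ T.flat
    · -- In the first case `c` and `d` are jumps or ends of the state space, as otherwise `A` would
      -- extend beyond `(c, d)`; so `(c, d)` is an isolated interval.
      obtain ⟨w, hw⟩ := exists_between hcd
      have hconst : ∀ z ∈ Ioo c d, T.scale z = T.scale w := fun z hz =>
        scale_const_of_flat hlc hdr hflat hz hw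
      have hRc : T.scaleR c = T.scale w := scaleR_eq_of_const hcd hconst
      have hLd : T.scaleL d = T.scale w := scaleL_eq_of_const hcd hconst
      have hwW := hsub w hw
      have hleft : T.l < c → T.scaleL c ∉ Ioo p q := fun hl hmem => by
        obtain ⟨z, hz1, hz2, hz3⟩ := exists_left_mem_preimage hl hmem
        exact not_le.2 hz1 (sInf_le ⟨⟨hz2.le, (hz1.trans hcd).le.trans hdr⟩, hz3⟩)
      have hright : d < T.r → T.scaleR d ∉ Ioo p q := fun hr hmem => by
        obtain ⟨z, hz1, hz2, hz3⟩ := exists_right_mem_preimage hr hmem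
        exact not_le.2 hz1 (le_sSup ⟨⟨hlc.trans (hcd.trans hz1).le, hz2.le⟩, hz3⟩)
      have hcJ : T.l < c → c ∈ T.DR ∪ T.DL := fun hl => by
        by_contra hn
        have h1 : c ∉ T.DR := fun h => hn (Or.inl h)
        have h2 : c ∉ T.DL := fun h => hn (Or.inr h)
        exact hleft hl (by rwa [scaleL_eq_of_notMem h2, ← scaleR_eq_of_notMem h1, hRc])
      have hdJ : d < T.r → d ∈ T.DR ∪ T.DL := fun hr => by
        by_contra hn
        have h1 : d ∉ T.DR := fun h => hn (Or.inl h)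
        have h2 : d ∉ T.DL := fun h => hn (Or.inr h)
        exact hright hr (by rwa [scaleR_eq_of_notMem h1, ← scaleL_eq_of_notMem h2, hLd])
      have hnf : ∀ {z : EReal}, z ∈ T.DR ∪ T.DL → z ∉ T.flat := fun h =>
        h.elim T.notMem_flat_of_DR T.notMem_flat_of_DL
      have hiso : T.IsIsolatedInterval c d := by
        refine ⟨⟨hcd, T.flat_of_const hlc hdr hconst, fun hcf => ?_, fun hdf => ?_⟩, ?_, ?_⟩
        · exact hnf (hcJ (lt_of_le_of_ne hlc fun h => hcf.2 (Or.inl h.symm))) hcf.1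
        · exact hnf (hdJ (lt_of_le_of_ne hdr fun h => hdf.2 (Or.inr h))) hdf.1
        · rcases hlc.eq_or_lt with h | h
          · exact Or.inr (Or.inl h.symm)
          · exact Or.inl (hcJ h)
        · rcases hdr.eq_or_lt with h | h
          · exact Or.inr (Or.inr h)
          · exact Or.inl (hdJ h)
      refine (hDM.2.2 c d hiso).trans_le (measure_mono ?_)
      rintro z (hz | ⟨rfl, hz⟩ | ⟨rfl, hz⟩)
      · exact hsub z hz
      · change T.scale c ∈ Ioo p q
        rwa [← scaleR_eq_of_notMem hz, hRc]
      · change T.scale d ∈ Ioo p q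
        rwa [← scaleL_eq_of_notMem hz, hLd]
    · push Not at hflat
      obtain ⟨z, hz, hzf⟩ := hflat
      have h1 : z ∈ T.m.support := hDM.1 ⟨⟨hlc.trans hz.1.le, hz.2.le.trans hdr⟩, hzf⟩
      exact ((Measure.mem_support_iff_forall z).1 h1 _ (Ioo_mem_nhds hz.1 hz.2)).trans_le
        (measure_mono hsub)
  · -- If `x` is the only point with a value in `(p, q)`, then `s` jumps at `x` from both sides.
    push Not at htwo
    obtain ⟨x, hx, hxW⟩ := h
    have hxA : x ∈ A := ⟨hx, hxW⟩
    have hr : x < T.r → T.scaleR x ∉ Ioo p q := fun hr hmem => by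
      obtain ⟨z, hz1, hz2, hz3⟩ := exists_right_mem_preimage hr hmem
      exact not_le.2 hz1 (htwo x hxA z ⟨⟨hx.1.trans hz1.le, hz2.le⟩, hz3⟩)
    have hl : T.l < x → T.scaleL x ∉ Ioo p q := fun hl hmem => by
      obtain ⟨z, hz1, hz2, hz3⟩ := exists_left_mem_preimage hl hmem
      exact not_le.2 hz1 (htwo z ⟨⟨hz2.le, hz1.le.trans hx.2⟩, hz3⟩ x hxA)
    have hxl : T.l < x := by
      refine lt_of_le_of_ne hx.1 fun h => ?_
      subst h
      exact hr T.l_lt_r (by rwa [T.scaleR_eq_of_le_l le_rfl])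
    have hxr : x < T.r := by
      refine lt_of_le_of_ne hx.2 fun h => ?_
      subst h
      exact hl T.l_lt_r (by rwa [T.scaleL_eq_of_r_le le_rfl])
    have hDR : x ∈ T.DR := by
      by_contra h
      exact hr hxr (by rwa [scaleR_eq_of_notMem h])
    have hDL : x ∈ T.DL := by
      by_contra h
      exact hl hxl (by rwa [scaleL_eq_of_notMem h])
    refine (hDM.2.1 x ⟨hDR, hDL⟩).trans_le (measure_mono ?_)
    rintro _ rfl
    exact hxW

theorem measurableSet_IHat (T : ScaleSpeed) : MeasurableSet T.IHat := measurableSet_of_compactIcc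

theorem measurableEmbedding_coe (T : ScaleSpeed) :
    MeasurableEmbedding fun y : T.IHat => ((y : ℝ) : EReal) :=
  EReal.measurableEmbedding_coe.comp (MeasurableEmbedding.subtype_coe T.measurableSet_IHat)

theorem mHat_apply {B : Set T.IHat} (hB : MeasurableSet B) :
    T.mHat B = T.m (T.scale ⁻¹' ((fun y : T.IHat => ((y : ℝ) : EReal)) '' B)) := by
  rw [mHat, T.measurableEmbedding_coe.comap_apply,
    Measure.map_apply T.scale_mono.measurable (T.measurableEmbedding_coe.measurableSet_image.2 hB)]

/-- The image of the speed measure on `Î` is fully supported. The interval around a point of `Î` is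
chosen so as to avoid the ends `s(l)` and `s(r)` which do not belong to `Î`; it contains a value of
the scale function since `Î` is contained in the closure of these values. -/
theorem isOpenPosMeasure_mHat (hDM : T.DM) : T.mHat.IsOpenPosMeasure := by
  refine ⟨fun U hU ⟨y, hy⟩ => ?_⟩
  obtain ⟨V, hV, rfl⟩ := isOpen_induced_iff.1 hU
  obtain ⟨ε, hε, hball⟩ := Metric.isOpen_iff.1 hV y hy
  rw [Real.ball_eq_Ioo] at hball
  have hyIcc := T.mem_Icc_of_mem_IHat y.2
  obtain ⟨p, hpy, hp1, hp2⟩ : ∃ p : EReal, p < (y : ℝ) ∧ ((y - ε : ℝ) : EReal) ≤ p ∧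
      (p < T.scale T.l → T.ReflectingL) := by
    by_cases h : ((y : ℝ) : EReal) = T.scale T.l
    · exact ⟨_, EReal.coe_lt_coe_iff.2 (by linarith : (y : ℝ) - ε < y), le_rfl, fun _ => y.2.2.1 h⟩
    · refine ⟨max ((y - ε : ℝ) : EReal) (T.scale T.l), max_lt (EReal.coe_lt_coe_iff.2 (by linarith))
        (lt_of_le_of_ne hyIcc.1 (Ne.symm h)), le_max_left _ _, fun h' => ?_⟩
      exact absurd (le_max_right ((y - ε : ℝ) : EReal) (T.scale T.l)) (not_le.2 h')
  obtain ⟨q, hyq, hq1, hq2⟩ : ∃ q : EReal, ((y : ℝ) : EReal) < q ∧ q ≤ ((y + ε : ℝ) : EReal) ∧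
      (T.scale T.r < q → T.ReflectingR) := by
    by_cases h : ((y : ℝ) : EReal) = T.scale T.r
    · exact ⟨_, EReal.coe_lt_coe_iff.2 (by linarith : (y : ℝ) < y + ε), le_rfl, fun _ => y.2.2.2 h⟩
    · refine ⟨min ((y + ε : ℝ) : EReal) (T.scale T.r), lt_min (EReal.coe_lt_coe_iff.2 (by linarith))
        (lt_of_le_of_ne hyIcc.2 h), min_le_left _ _, fun h' => ?_⟩
      exact absurd (min_le_right ((y + ε : ℝ) : EReal) (T.scale T.r)) (not_le.2 h')
  obtain ⟨_, hz, x, hx, rfl⟩ := mem_closure_iff.1 y.2.1 _ isOpen_Ioo ⟨hpy, hyq⟩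
  have hpos := measure_preimage_pos hDM ⟨x, hx, hz⟩
  rw [mHat_apply hU.measurableSet]
  refine (hpos.trans_le (measure_mono fun z hz => ?_)).ne'
  have h1 : T.scale z ≠ ⊤ := ((hz : T.scale z ∈ Ioo p q).2.trans_le hq1 |>.trans
    (EReal.coe_lt_top _)).ne
  have h2 : T.scale z ≠ ⊥ := ((EReal.bot_lt_coe _).trans_le hp1 |>.trans
    (hz : T.scale z ∈ Ioo p q).1).ne'
  have h3 : ((T.scale z).toReal : EReal) = T.scale z := EReal.coe_toReal h1 h2
  have h4 : (T.scale z).toReal ∈ T.IHat := T.mem_IHat_of_scale h3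
    (fun h => hp2 (h ▸ (hz : T.scale z ∈ Ioo p q).1))
    (fun h => hq2 (h ▸ (hz : T.scale z ∈ Ioo p q).2))
  refine ⟨⟨_, h4⟩, hball ⟨?_, ?_⟩, h3⟩
  · rw [← EReal.coe_lt_coe_iff, h3]; exact hp1.trans_lt hz.1
  · rw [← EReal.coe_lt_coe_iff, h3]; exact hz.2.trans_le hq1

/-- Near a reflecting end the speed measure is finite. -/
theorem m_Iic_lt_top {x : EReal} (hl : T.ReflectingL) (hx : x < T.r) : T.m (Iic x) < ∞ := by
  obtain ⟨-, ⟨a, ha, ha'⟩, hl'⟩ := hl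
  have h1 : Iic x ⊆ (Icc T.l T.r)ᶜ ∪ {T.l} ∪ Ioo T.l a ∪ Icc a x := by
    intro z hz
    rcases lt_trichotomy z T.l with h | h | h
    · exact Or.inl (Or.inl (Or.inl fun h' => not_lt.2 h'.1 h))
    · exact Or.inl (Or.inl (Or.inr h))
    · rcases lt_or_ge z a with h' | h'
      · exact Or.inl (Or.inr ⟨h, h'⟩)
      · exact Or.inr ⟨h', hz⟩
  refine (measure_mono h1).trans_lt ?_
  refine measure_union_lt_top (measure_union_lt_top (measure_union_lt_top ?_ hl') ha')
    (T.m_radon a x ha hx)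
  rw [T.m_compl]; exact ENNReal.zero_lt_top

theorem m_Ici_lt_top {x : EReal} (hr : T.ReflectingR) (hx : T.l < x) : T.m (Ici x) < ∞ := by
  obtain ⟨-, ⟨a, ha, ha'⟩, hr'⟩ := hr
  have h1 : Ici x ⊆ (Icc T.l T.r)ᶜ ∪ {T.r} ∪ Ioo a T.r ∪ Icc x a := by
    intro z hz
    rcases lt_trichotomy T.r z with h | h | h
    · exact Or.inl (Or.inl (Or.inl fun h' => not_lt.2 h'.2 h))
    · exact Or.inl (Or.inl (Or.inr h.symm))
    · rcases lt_or_ge a z with h' | h'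
      · exact Or.inl (Or.inr ⟨h', h⟩)
      · exact Or.inr ⟨hz, h'⟩
  refine (measure_mono h1).trans_lt ?_
  refine measure_union_lt_top (measure_union_lt_top (measure_union_lt_top ?_ hr') ha')
    (T.m_radon x a hx ha)
  rw [T.m_compl]; exact ENNReal.zero_lt_top

/-- A neighbourhood of a point of `Î` other than `s(l)` and `s(r)` has its preimage in a compact
subinterval of `(l, r)`; the ends `s(l)` and `s(r)` belong to `Î` only if they are reflecting. -/
instance isLocallyFiniteMeasure_mHat : IsLocallyFiniteMeasure T.mHat := by
  have hcoe : Continuous fun y : T.IHat => ((y : ℝ) : EReal) :=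
    continuous_coe_real_ereal.comp continuous_subtype_val
  have key : ∀ {U : Set EReal}, IsOpen U → T.m (T.scale ⁻¹' U) < ∞ → ∀ {y : T.IHat},
      ((y : ℝ) : EReal) ∈ U → T.mHat.FiniteAtFilter (𝓝 y) := by
    intro U hU hfin y hy
    refine ⟨_, (hU.preimage hcoe).mem_nhds hy, ?_⟩
    rw [mHat_apply (hU.preimage hcoe).measurableSet]
    exact (measure_mono (preimage_mono (image_preimage_subset _ _))).trans_lt hfin
  refine ⟨fun y => ?_⟩
  have hyIcc := T.mem_Icc_of_mem_IHat y.2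
  by_cases h1 : ((y : ℝ) : EReal) = T.scale T.l
  · obtain ⟨x, -, hx, hx'⟩ := T.exists_lt_scale T.scale_l_lt_scale_r
    refine key (isOpen_Iio (a := T.scale x)) ?_ (h1 ▸ hx')
    refine (measure_mono fun z hz => ?_).trans_lt (m_Iic_lt_top (y.2.2.1 h1) hx)
    exact (lt_of_not_ge fun h => not_le.2 hz (T.scale_mono h)).le
  · obtain ⟨x, hx, hxr, hx'⟩ := T.exists_scale_lt (lt_of_le_of_ne hyIcc.1 (Ne.symm h1))
    by_cases h2 : ((y : ℝ) : EReal) = T.scale T.r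
    · refine key (isOpen_Ioi (a := T.scale x)) ?_ hx'
      refine (measure_mono fun z hz => ?_).trans_lt (m_Ici_lt_top (y.2.2.2 h2) hx)
      exact (lt_of_not_ge fun h => not_le.2 hz (T.scale_mono h)).le
    · obtain ⟨w, hw, hwr, hw'⟩ := T.exists_lt_scale (lt_of_le_of_ne hyIcc.2 h2)
      refine key (isOpen_Ioo (a := T.scale x) (b := T.scale w)) ?_ ⟨hx', hw'⟩
      refine (measure_mono fun z hz => ?_).trans_lt (T.m_radon x w hx hwr)
      exact ⟨(lt_of_not_ge fun h => not_le.2 hz.1 (T.scale_mono h)).le,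
        (lt_of_not_ge fun h => not_le.2 hz.2 (T.scale_mono h)).le⟩

theorem regular_mHat (T : ScaleSpeed) : T.mHat.Regular := by
  have : LocallyCompactSpace T.IHat := locallyCompactSpace_of_compactIcc
  infer_instance

/-! ### The speed measures on both state spaces -/

/-- The part of the state space that the scale function maps to `Î`. -/
def core (T : ScaleSpeed) : Set T.I := {x | T.scaleI x ∈ T.IHat}

theorem measurableSet_core (T : ScaleSpeed) : MeasurableSet T.core :=
  T.scaleI_mono.measurable T.measurableSet_IHat

open Classical in
/-- The scale function as a map from the state space to `Î`; off `core` it takes an irrelevant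
value. -/
noncomputable def toIHat (T : ScaleSpeed) [Nonempty T.IHat] (x : T.I) : T.IHat :=
  if h : T.scaleI x ∈ T.IHat then ⟨T.scaleI x, h⟩ else Classical.arbitrary _

theorem coe_toIHat [Nonempty T.IHat] {x : T.I} (hx : x ∈ T.core) :
    (T.toIHat x : ℝ) = T.scaleI x := by
  have h : T.scaleI x ∈ T.IHat := hx
  rw [toIHat, dif_pos h]

theorem measurable_toIHat (T : ScaleSpeed) [Nonempty T.IHat] : Measurable T.toIHat := by
  classical
  have h1 : Measurable fun x => if T.scaleI x ∈ T.IHat then T.scaleI x else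
      (Classical.arbitrary T.IHat : ℝ) :=
    Measurable.ite T.measurableSet_core T.scaleI_mono.measurable measurable_const
  have h2 : ∀ x, (if T.scaleI x ∈ T.IHat then T.scaleI x else (Classical.arbitrary T.IHat : ℝ)) ∈
      T.IHat := fun x => by
    split_ifs with h
    · exact h
    · exact (Classical.arbitrary T.IHat).2
  have h3 : T.toIHat = fun x => ⟨_, h2 x⟩ := by
    funext x
    refine Subtype.ext ?_
    simp only [toIHat]
    split_ifs with h
    · rfl
    · rfl
  rw [h3]
  exact h1.subtype_mk

/-- `m̂` is the image of `m` on the part of the state space that the scale maps to `Î`; the remaining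
part of the state space is disregarded. -/
theorem mHat_eq_map (T : ScaleSpeed) [Nonempty T.IHat] :
    T.mHat = (T.mI.restrict T.core).map T.toIHat := by
  refine Measure.ext fun B hB => ?_
  have hset := T.measurable_toIHat hB
  rw [mHat_apply hB, Measure.map_apply T.measurable_toIHat hB, Measure.restrict_apply hset, mI,
    (MeasurableEmbedding.subtype_coe T.measurableSet_I).comap_apply]
  have hnull : ∀ᵐ x ∂T.m, x ∈ Icc T.l T.r := by
    rw [ae_iff]; exact T.m_compl
  refine measure_congr ?_
  filter_upwards [hnull] with x hx
  refine propext ⟨?_, ?_⟩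
  · rintro ⟨y, hy, hyx⟩
    simp only at hyx
    have hxI : x ∈ T.I := ⟨hx, fun h => y.2.2.1 (by rw [hyx, h]), fun h => y.2.2.2 (by rw [hyx, h])⟩
    have h1 : T.scaleI ⟨x, hxI⟩ = y := by
      rw [← EReal.coe_eq_coe_iff, coe_scaleI]; exact hyx.symm
    have hcore : (⟨x, hxI⟩ : T.I) ∈ T.core := by
      change T.scaleI ⟨x, hxI⟩ ∈ T.IHat
      rw [h1]; exact y.2
    refine ⟨⟨x, hxI⟩, ⟨?_, hcore⟩, rfl⟩
    have h2 : T.toIHat ⟨x, hxI⟩ = y := Subtype.ext ((coe_toIHat hcore).trans h1)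
    change T.toIHat ⟨x, hxI⟩ ∈ B
    rwa [h2]
  · rintro ⟨x, ⟨hxB, hcore⟩, rfl⟩
    exact ⟨T.toIHat x, hxB, by simp only; rw [coe_toIHat hcore, coe_scaleI]⟩

end ScaleSpeed

/-! ### The regularization map -/

namespace ScaleSpeed

variable {T : ScaleSpeed} {f g : T.I → ℝ} {H : LineL2} {G : ℝ → ℝ}

/-- The density of `f ∈ 𝒮` as an element of `L²(ℝ)`. -/
noncomputable def densityL2 (hf : f ∈ T.S) : LineL2 := (memLp_densityFun hf).toLp _

theorem densityL2_coeFn (hf : f ∈ T.S) : densityL2 hf =ᵐ[volume] T.densityFun f :=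
  (memLp_densityFun hf).coeFn_toLp

theorem densityL2_mem (hDK : T.DK) (hf : f ∈ T.S) : densityL2 hf ∈ densitySpace T.IHat := by
  refine mem_densitySpace_of_const ?_ fun p hp => ?_
  · filter_upwards [densityL2_coeFn hf] with y hy h1 h2
    rw [hy]
    by_cases h : y ∈ T.hull
    · exact absurd (mem_gapUnion_of_hull hDK h h1) h2
    · exact T.densityFun_off f h
  · obtain ⟨x, ⟨hx, h1, h2⟩ | ⟨hx, h1, h2⟩⟩ := exists_jump_of_gap hDK hp
    · refine ⟨T.slopeR f x, ?_⟩
      filter_upwards [densityL2_coeFn hf] with y hy hyp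
      rw [h1, h2] at hyp
      rw [hy, T.densityFun_jumpR f (mem_iUnion.2 ⟨⟨x, hx⟩, hyp⟩), T.inverse_eq_of_mem_R hyp]
    · refine ⟨T.slopeL f x, ?_⟩
      filter_upwards [densityL2_coeFn hf] with y hy hyp
      rw [h1, h2] at hyp
      rw [hy, T.densityFun_jumpL f (mem_iUnion.2 ⟨⟨x, hx⟩, hyp⟩), T.inverse_eq_of_mem_L hyp]

/-- Every `f ∈ 𝒮` is a function of the scale, namely a primitive of its density. -/
theorem exists_eq_comp (hf : f ∈ T.S) : ∃ G : ℝ → ℝ, (f = fun x => G (T.scaleI x)) ∧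
    ∀ a b : ℝ, ∫ y in a..b, densityL2 hf y = G b - G a := by
  refine ⟨fun y => f T.origin + ∫ t in (0 : ℝ)..y, densityL2 hf t, funext fun x => ?_,
    fun a b => ?_⟩
  · refine (eq_add_integral hf x).trans ?_
    congr 1
    exact intervalIntegral.integral_congr_ae
      ((densityL2_coeFn hf).mono fun y hy _ => hy.symm)
  · rw [add_sub_add_left_eq_sub, intervalIntegral.integral_interval_sub_left] <;>
      exact lineL2_intervalIntegrable _ _ _

theorem comp_mem_S (hDK : T.DK) (hH : H ∈ densitySpace T.IHat)
    (hG : ∀ a b : ℝ, ∫ y in a..b, H y = G b - G a) : (fun x => G (T.scaleI x)) ∈ T.S := by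
  refine mem_S_of_density (fun x hx => ?_) (fun x hx => ?_) hG
  · have h := gap_of_jumpR hDK hx
    exact densitySpace_ae_const hH h.1 fun z hz => h.2 ⟨z, hz⟩
  · have h := gap_of_jumpL hDK hx
    exact densitySpace_ae_const hH h.1 fun z hz => h.2 ⟨z, hz⟩

theorem isHat_comp (hG : Continuous G) : T.IsHat (fun x => G (T.scaleI x)) fun y => G y := by
  refine ⟨fun x y h => ?_, fun x y _ h => ?_, fun x y _ h => ?_⟩
  · rw [← coe_scaleI, EReal.coe_eq_coe_iff] at h
    simp only [h]
  · rw [← coe_scaleRI, EReal.coe_eq_coe_iff] at h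
    rw [T.rightLim_comp_scaleI hG, ← h]
  · rw [← coe_scaleLI, EReal.coe_eq_coe_iff] at h
    rw [T.leftLim_comp_scaleI hG, ← h]

theorem IsHat.unique {u v : T.IHat → ℝ} (hu : T.IsHat f u) (hv : T.IsHat f v) : u = v := by
  funext y
  obtain ⟨x, h | ⟨hx, h⟩ | ⟨hx, h⟩⟩ := T.exists_of_mem_IHat y.2
  · have h' : ((y : ℝ) : EReal) = T.scale x := by rw [h, coe_scaleI]
    rw [hu.1 x y h', hv.1 x y h']
  · have h' : ((y : ℝ) : EReal) = T.scaleR x := by rw [h, coe_scaleRI]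
    rw [hu.2.1 x y hx h', hv.2.1 x y hx h']
  · have h' : ((y : ℝ) : EReal) = T.scaleL x := by rw [h, coe_scaleLI]
    rw [hu.2.2 x y hx h', hv.2.2 x y hx h']

theorem hat_comp (hG : Continuous G) : T.hat (fun x => G (T.scaleI x)) = fun y : T.IHat => G y := by
  have h : ∃ u, T.IsHat (fun x => G (T.scaleI x)) u := ⟨_, isHat_comp hG⟩
  rw [hat, dif_pos h]
  exact h.choose_spec.unique (isHat_comp hG)

theorem isHat_hat (hf : f ∈ T.S) : T.IsHat f (T.hat f) := by
  obtain ⟨G, hfG, hG⟩ := exists_eq_comp hf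
  have hGc := primitive_continuous hG
  subst hfG
  rw [hat_comp hGc]
  exact isHat_comp hGc

theorem isDensity_of_primitive {K : Set ℝ} (hH : H ∈ densitySpace K)
    (hG : ∀ a b : ℝ, ∫ y in a..b, H y = G b - G a) : IsDensity (fun y : K => G y) H :=
  ⟨hH, fun _ _ _ => (hG _ _).symm⟩

theorem isDensity_hat (hDK : T.DK) (hf : f ∈ T.S) : IsDensity (T.hat f) (densityL2 hf) := by
  obtain ⟨G, hfG, hG⟩ := exists_eq_comp hf
  have h : T.hat f = fun y : T.IHat => G y := by rw [hfG, hat_comp (primitive_continuous hG)]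
  rw [h]
  exact isDensity_of_primitive (densityL2_mem hDK hf) hG

theorem scaleI_mem_closure (hDK : T.DK) (x : T.I) : T.scaleI x ∈ closure T.IHat := by
  by_cases h : T.scaleI x ∈ T.IHat
  · exact subset_closure h
  · refine ((mem_closure_diff_iff hDK).2 ⟨h, ?_⟩).1
    rw [coe_scaleI]
    by_contra h'
    push Not at h'
    exact h (T.mem_IHat_of_scale (T.coe_scaleI x) (fun h => absurd h h'.1) fun h => absurd h h'.2)

theorem eqOn_closure_of_eq {G G' : ℝ → ℝ} {K : Set ℝ} (hG : Continuous G) (hG' : Continuous G')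
    (h : (fun y : K => G y) = fun y : K => G' y) : EqOn G G' (closure K) :=
  (show EqOn G G' K from fun y hy => congrFun h ⟨y, hy⟩).closure hG hG'

theorem injOn_hat (hDK : T.DK) : InjOn T.hat T.S := by
  intro f hf g hg h
  obtain ⟨G, hfG, hG⟩ := exists_eq_comp hf
  obtain ⟨G', hgG, hG'⟩ := exists_eq_comp hg
  have hc := primitive_continuous hG
  have hc' := primitive_continuous hG'
  rw [hfG, hgG, hat_comp hc, hat_comp hc'] at h
  rw [hfG, hgG]
  exact funext fun x => eqOn_closure_of_eq hc hc' h (scaleI_mem_closure hDK x)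

/-- `𝒮̂` consists of all functions of finite energy on `Î`. -/
theorem mem_SHat_iff (hDK : T.DK) {u : T.IHat → ℝ} : u ∈ T.SHat ↔ ∃ H, IsDensity u H := by
  constructor
  · rintro ⟨f, hf, rfl⟩
    exact ⟨_, isDensity_hat hDK hf⟩
  · rintro ⟨H, hH⟩
    obtain ⟨G, hGu, hG⟩ := hH.exists_primitive
    refine ⟨_, comp_mem_S hDK hH.mem hG, ?_⟩
    rw [hat_comp (primitive_continuous hG)]
    exact funext hGu

/-! ### The domain of the form -/

theorem l_mem_closure_I (T : ScaleSpeed) : T.l ∈ closure T.I := by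
  have h : Ioo T.l T.r ⊆ T.I := fun x hx => T.mem_I_of_mem hx.1 hx.2
  refine closure_mono h ?_
  rw [closure_Ioo T.l_lt_r.ne]
  exact left_mem_Icc.2 T.l_lt_r.le

theorem r_mem_closure_I (T : ScaleSpeed) : T.r ∈ closure T.I := by
  have h : Ioo T.l T.r ⊆ T.I := fun x hx => T.mem_I_of_mem hx.1 hx.2
  refine closure_mono h ?_
  rw [closure_Ioo T.l_lt_r.ne]
  exact right_mem_Icc.2 T.l_lt_r.le

theorem tendsto_scaleI_of_scale {e : EReal} {j : ℝ} (hL : T.scaleL e = T.scale e)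
    (hR : T.scaleR e = T.scale e) (hj : (j : EReal) = T.scale e) :
    Tendsto T.scaleI (comap Subtype.val (𝓝 e)) (𝓝 j) := by
  have hc : ContinuousAt T.scale e :=
    T.scale_mono.continuousAt_iff_leftLim_eq_rightLim.2 (hL.trans hR.symm)
  have h1 : Tendsto (fun x : T.I => T.scale x) (comap Subtype.val (𝓝 e)) (𝓝 (j : EReal)) := by
    rw [hj]; exact hc.tendsto.comp tendsto_comap
  have := (EReal.tendsto_toReal (EReal.coe_ne_top j) (EReal.coe_ne_bot j)).comp h1
  rwa [EReal.toReal_coe] at this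

theorem tendsto_end_iff {e : EReal} {j : ℝ} (hG : Continuous G) (he : e ∈ closure T.I)
    (hL : T.scaleL e = T.scale e) (hR : T.scaleR e = T.scale e) (hj : (j : EReal) = T.scale e) :
    Tendsto (fun x : T.I => G (T.scaleI x)) (comap Subtype.val (𝓝 e)) (𝓝 0) ↔ G j = 0 := by
  have : (comap (Subtype.val : T.I → EReal) (𝓝 e)).NeBot := mem_closure_iff_comap_neBot.1 he
  have h := (hG.tendsto j).comp (tendsto_scaleI_of_scale hL hR hj)
  exact ⟨fun h' => tendsto_nhds_unique h h', fun h' => h' ▸ h⟩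

theorem tendsto_hat_iff {K : Set ℝ} {j : ℝ} (hG : Continuous G) (hj : j ∈ closure K) :
    Tendsto (fun y : K => G y) (comap Subtype.val (𝓝 j)) (𝓝 0) ↔ G j = 0 := by
  have := comap_val_neBot hj
  have h : Tendsto (fun y : K => G y) (comap Subtype.val (𝓝 j)) (𝓝 (G j)) :=
    (hG.tendsto j).comp tendsto_comap
  exact ⟨fun h' => tendsto_nhds_unique h h', fun h' => h' ▸ h⟩

theorem l_notMem_I_iff : T.l ∉ T.I ↔ ¬ T.ReflectingL := by
  refine not_congr ⟨fun h => h.2.1 rfl, fun h => ⟨left_mem_Icc.2 T.l_lt_r.le, fun _ => h,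
    fun h' => absurd h' T.l_lt_r.ne⟩⟩

theorem r_notMem_I_iff : T.r ∉ T.I ↔ ¬ T.ReflectingR := by
  refine not_congr ⟨fun h => h.2.2 rfl, fun h => ⟨right_mem_Icc.2 T.l_lt_r.le,
    fun h' => absurd h' T.l_lt_r.ne', fun _ => h⟩⟩

theorem coe_scale_l (h : T.ApproachableL) : ((T.scale T.l).toReal : EReal) = T.scale T.l :=
  EReal.coe_toReal (ne_top_of_le_ne_top (by simp) T.scale_l_le_zero) h

theorem coe_scale_r (h : T.ApproachableR) : ((T.scale T.r).toReal : EReal) = T.scale T.r :=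
  EReal.coe_toReal h (ne_bot_of_le_ne_bot (by simp) T.zero_le_scale_r)

/-- Through the scale, the boundary conditions for functions on `I` become the boundary conditions
for functions on `Î`. -/
theorem boundary_iff (hDK : T.DK) (hG : Continuous G) :
    ((T.l ∉ T.I → T.ApproachableL →
        Tendsto (fun x : T.I => G (T.scaleI x)) (comap Subtype.val (𝓝 T.l)) (𝓝 0)) ∧
      (T.r ∉ T.I → T.ApproachableR →
        Tendsto (fun x : T.I => G (T.scaleI x)) (comap Subtype.val (𝓝 T.r)) (𝓝 0))) ↔
    ∀ j ∈ closure T.IHat \ T.IHat, G j = 0 := by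
  have hl : ∀ {j : ℝ}, (j : EReal) = T.scale T.l → _ := fun {j} =>
    tendsto_end_iff (T := T) hG T.l_mem_closure_I (T.scaleL_eq_of_le_l le_rfl)
      (T.scaleR_eq_of_le_l le_rfl) (j := j)
  have hr : ∀ {j : ℝ}, (j : EReal) = T.scale T.r → _ := fun {j} =>
    tendsto_end_iff (T := T) hG T.r_mem_closure_I (T.scaleL_eq_of_r_le le_rfl)
      (T.scaleR_eq_of_r_le le_rfl) (j := j)
  constructor
  · rintro ⟨h1, h2⟩ j hj
    obtain ⟨hj', hj | hj⟩ := (mem_closure_diff_iff hDK).1 hj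
    · refine (hl hj).1 (h1 (l_notMem_I_iff.2 fun h => hj' ?_) ?_)
      · exact T.mem_IHat_of_scale hj (fun _ => h) fun h' => absurd h' T.scale_l_lt_scale_r.ne
      · rw [ApproachableL, ← hj]; exact EReal.coe_ne_bot j
    · refine (hr hj).1 (h2 (r_notMem_I_iff.2 fun h => hj' ?_) ?_)
      · exact T.mem_IHat_of_scale hj (fun h' => absurd h' T.scale_l_lt_scale_r.ne') fun _ => h
      · rw [ApproachableR, ← hj]; exact EReal.coe_ne_top j
  · intro h
    constructor
    · intro h1 h2
      have hc := coe_scale_l h2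
      exact (hl hc).2 (h _ ((mem_closure_diff_iff hDK).2
        ⟨fun h' => l_notMem_I_iff.1 h1 (h'.2.1 hc), Or.inl hc⟩))
    · intro h1 h2
      have hc := coe_scale_r h2
      exact (hr hc).2 (h _ ((mem_closure_diff_iff hDK).2
        ⟨fun h' => r_notMem_I_iff.1 h1 (h'.2.2 hc), Or.inr hc⟩))

theorem indicator_core_comp (hDK : T.DK) [Nonempty T.IHat]
    (h : ∀ j ∈ closure T.IHat \ T.IHat, G j = 0) :
    T.core.indicator ((fun y : T.IHat => G y) ∘ T.toIHat) = fun x => G (T.scaleI x) := by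
  funext x
  by_cases hx : x ∈ T.core
  · rw [indicator_of_mem hx, Function.comp_apply, coe_toIHat hx]
  · rw [indicator_of_notMem hx, h _ ⟨scaleI_mem_closure hDK x, hx⟩]

theorem memLp_comp_iff (hDK : T.DK) (hG : Continuous G)
    (h : ∀ j ∈ closure T.IHat \ T.IHat, G j = 0) :
    MemLp (fun x => G (T.scaleI x)) 2 T.mI ↔ MemLp (fun y : T.IHat => G y) 2 T.mHat := by
  have := nonempty_IHat hDK
  rw [← indicator_core_comp hDK h, memLp_indicator_iff_restrict T.measurableSet_core,
    T.mHat_eq_map]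
  exact (memLp_map_measure_iff (hG.comp continuous_subtype_val).aestronglyMeasurable
    T.measurable_toIHat.aemeasurable).symm

theorem comp_mem_F_iff (hDK : T.DK) (hH : H ∈ densitySpace T.IHat)
    (hG : ∀ a b : ℝ, ∫ y in a..b, H y = G b - G a) :
    (fun x => G (T.scaleI x)) ∈ T.F ↔ (fun y : T.IHat => G y) ∈ energyDomain T.mHat := by
  have hGc := primitive_continuous hG
  have hb := boundary_iff hDK hGc
  have hb' : (∀ j ∈ closure T.IHat \ T.IHat,
      Tendsto (fun y : T.IHat => G y) (comap Subtype.val (𝓝 j)) (𝓝 0)) ↔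
      ∀ j ∈ closure T.IHat \ T.IHat, G j = 0 :=
    forall₂_congr fun j hj => tendsto_hat_iff hGc hj.1
  constructor
  · rintro ⟨-, h1, h2⟩
    have h3 := hb.1 h2
    exact ⟨⟨H, isDensity_of_primitive hH hG⟩, (memLp_comp_iff hDK hGc h3).1 h1, hb'.2 h3⟩
  · rintro ⟨-, h1, h2⟩
    have h3 := hb'.1 h2
    exact ⟨comp_mem_S hDK hH hG, (memLp_comp_iff hDK hGc h3).2 h1, hb.2 h3⟩

/-- Every `f ∈ F` is the pull-back of its regularization: points which the scale does not map into
`Î` are mapped to boundary points of `Î`, where the regularization vanishes. -/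
theorem indicator_core_hat (hDK : T.DK) [Nonempty T.IHat] (hf : f ∈ T.F) :
    T.core.indicator (T.hat f ∘ T.toIHat) = f := by
  obtain ⟨G, hfG, hG⟩ := exists_eq_comp hf.1
  have hGc := primitive_continuous hG
  have h := hf.2.2
  rw [hfG] at h
  rw [hfG, hat_comp hGc, indicator_core_comp hDK ((boundary_iff hDK hGc).1 h)]

theorem hat_mem_energyDomain (hDK : T.DK) (hf : f ∈ T.F) : T.hat f ∈ energyDomain T.mHat := by
  obtain ⟨G, hfG, hG⟩ := exists_eq_comp hf.1
  have h := (comp_mem_F_iff hDK (densityL2_mem hDK hf.1) hG).1 (hfG ▸ hf)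
  rwa [hfG, hat_comp (primitive_continuous hG)]

theorem FHat_eq (hDK : T.DK) : T.FHat = energyDomain T.mHat := by
  refine Subset.antisymm (image_subset_iff.2 fun f hf => hat_mem_energyDomain hDK hf) fun u hu => ?_
  obtain ⟨H, hH⟩ := hu.1
  obtain ⟨G, hGu, hG⟩ := hH.exists_primitive
  have hu' : u = fun y : T.IHat => G y := funext fun y => (hGu y).symm
  rw [hu'] at hu ⊢
  exact ⟨_, (comp_mem_F_iff hDK hH.mem hG).2 hu, hat_comp (primitive_continuous hG)⟩

theorem FHat_eq_setOf (hDK : T.DK) :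
    T.FHat = {fh | MemLp fh 2 T.mHat ∧ fh ∈ T.SHat ∧
      ∀ j : ℝ, j ∉ T.IHat → ((j : EReal) = T.scale T.l ∨ (j : EReal) = T.scale T.r) →
        Tendsto fh (comap Subtype.val (𝓝 j)) (𝓝 0)} := by
  rw [FHat_eq hDK]
  ext u
  simp only [energyDomain, mem_ofPred_eq, mem_closure_diff_iff hDK, mem_SHat_iff hDK, and_imp]
  tauto

end ScaleSpeed

/-! ### The forms on both state spaces -/

theorem L2Form.Descends.ofFun_form {X : Type*} [MeasurableSpace X] {μ : Measure X}
    {F : Set (X → ℝ)} {E : (X → ℝ) → (X → ℝ) → ℝ} (h : L2Form.Descends μ F E)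
    {U V : Lp ℝ 2 μ} {f g : X → ℝ} (hf : f ∈ F) (hg : g ∈ F) (hU : U =ᵐ[μ] f) (hV : V =ᵐ[μ] g) :
    (L2Form.ofFun μ F E).form U V = E f g := by
  have h1 : (∃ f ∈ F, U =ᵐ[μ] f) ∧ ∃ g ∈ F, V =ᵐ[μ] g := ⟨⟨f, hf, hU⟩, ⟨g, hg, hV⟩⟩
  refine (dif_pos h1).trans ?_
  exact h.2 _ h1.1.choose_spec.1 _ hf _ h1.2.choose_spec.1 _ hg
    (h1.1.choose_spec.2.symm.trans hU) (h1.2.choose_spec.2.symm.trans hV)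

namespace ScaleSpeed

variable {T : ScaleSpeed} {f g : T.I → ℝ} {H : LineL2} {G : ℝ → ℝ}

theorem hat_ae_eq (hDK : T.DK) (hf : f ∈ T.F) (hg : g ∈ T.F) (h : f =ᵐ[T.mI] g) :
    T.hat f =ᵐ[T.mHat] T.hat g := by
  have := nonempty_IHat hDK
  have hmeas : MeasurableSet {y | T.hat f y = T.hat g y} :=
    (isClosed_eq (isDensity_hat hDK hf.1).continuous
      (isDensity_hat hDK hg.1).continuous).measurableSet
  rw [T.mHat_eq_map]
  refine (ae_map_iff T.measurable_toIHat.aemeasurable hmeas).2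
    ((ae_restrict_iff' T.measurableSet_core).2 ?_)
  rw [← indicator_core_hat hDK hf, ← indicator_core_hat hDK hg] at h
  filter_upwards [h] with x hx hxc
  simpa [hxc] using hx

/-- Elements of `F` which agree almost everywhere are equal: their regularizations are continuous
and agree almost everywhere for a measure of full support, and regularization is injective. -/
theorem eq_of_ae_eq (hDK : T.DK) (hDM : T.DM) (hf : f ∈ T.F) (hg : g ∈ T.F)
    (h : f =ᵐ[T.mI] g) : f = g := by
  have := isOpenPosMeasure_mHat hDM
  exact injOn_hat hDK hf.1 hg.1 (Continuous.ae_eq_iff_eq _ (isDensity_hat hDK hf.1).continuous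
    (isDensity_hat hDK hg.1).continuous |>.1 (hat_ae_eq hDK hf hg h))

theorem descends_E (hDK : T.DK) (hDM : T.DM) : L2Form.Descends T.mI T.F T.E :=
  ⟨fun _ hf => hf.2.1, fun _ hf _ hf' _ hg _ hg' h h' => by
    rw [eq_of_ae_eq hDK hDM hf hf' h, eq_of_ae_eq hDK hDM hg hg' h']⟩

theorem descends_EHat (hDK : T.DK) (hDM : T.DM) : L2Form.Descends T.mHat T.FHat T.EHat := by
  have := isOpenPosMeasure_mHat hDM
  rw [FHat_eq hDK]
  have key : ∀ u ∈ energyDomain T.mHat, ∀ v ∈ energyDomain T.mHat, u =ᵐ[T.mHat] v → u = v := by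
    rintro u ⟨⟨H, hu⟩, -⟩ v ⟨⟨H', hv⟩, -⟩ h
    exact (Continuous.ae_eq_iff_eq _ hu.continuous hv.continuous).1 h
  exact ⟨fun _ hf => hf.2.1, fun u hu u' hu' v hv v' hv' h h' => by
    rw [key u hu u' hu' h, key v hv v' hv' h']⟩

theorem hatInv_hat (hDK : T.DK) (hf : f ∈ T.S) : T.hatInv (T.hat f) = f :=
  (injOn_hat hDK).leftInvOn_invFunOn hf

theorem E_eq (hf : f ∈ T.S) (hg : g ∈ T.S) :
    T.E f g = (1 / 2 : ℝ) * inner ℝ (densityL2 hf) (densityL2 hg) := by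
  rw [energy_eq hf hg, L2.inner_def]
  congr 1
  refine integral_congr_ae ?_
  filter_upwards [densityL2_coeFn hf, densityL2_coeFn hg] with y h1 h2
  simp [h1, h2, mul_comm]

theorem EHat_eq (hDK : T.DK) {u v : T.IHat → ℝ} {H H' : LineL2} (hu : u ∈ energyDomain T.mHat)
    (hv : v ∈ energyDomain T.mHat) (hH : IsDensity u H) (hH' : IsDensity v H') :
    T.EHat u v = (1 / 2 : ℝ) * inner ℝ H H' := by
  rw [← FHat_eq hDK] at hu hv
  obtain ⟨f, hf, rfl⟩ := hu
  obtain ⟨g, hg, rfl⟩ := hv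
  rw [EHat, hatInv_hat hDK hf.1, hatInv_hat hDK hg.1, E_eq hf.1 hg.1,
    hH.unique (isDensity_hat hDK hf.1), hH'.unique (isDensity_hat hDK hg.1)]

theorem isEnergyForm_formHat (hDK : T.DK) (hDM : T.DM) : IsEnergyForm T.formHat where
  mem_dom_iff U := by rw [← FHat_eq hDK]; rfl
  form_eq U V u v H H' hu hv hU hV hH hH' := by
    rw [← EHat_eq hDK hu hv hH hH']
    rw [← FHat_eq hDK] at hu hv
    exact (descends_EHat hDK hDM).ofFun_form hu hv hU hV

theorem pullL2_hat_coeFn (hDK : T.DK) [Nonempty T.IHat] {U : Lp ℝ 2 T.mHat} (hf : f ∈ T.F)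
    (hU : U =ᵐ[T.mHat] T.hat f) :
    pullL2 T.measurableSet_core T.measurable_toIHat T.mHat_eq_map U =ᵐ[T.mI] f := by
  have h := pullL2_coeFn T.measurableSet_core T.measurable_toIHat T.mHat_eq_map hU
  rwa [indicator_core_hat hDK hf] at h

/-- The equivalence between the two forms is composition with the scale function. -/
theorem form_equivalent (hDK : T.DK) (hDM : T.DM) : T.form.Equivalent T.formHat := by
  have := nonempty_IHat hDK
  have := isOpenPosMeasure_mHat hDM
  have hb := isEnergyForm_formHat hDK hDM
  refine hb.isDirichletWide.equivalent_pull T.measurableSet_core T.measurable_toIHat T.mHat_eq_map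
    (Subset.antisymm ?_ ?_) ?_ fun U hU V hV => hb.exists_mul hU hV
  · rintro U ⟨f, hf, hU⟩
    have hfh := hat_mem_energyDomain hDK hf
    refine ⟨hfh.2.1.toLp _, (hb.mem_dom_iff _).2 ⟨_, hfh, hfh.2.1.coeFn_toLp⟩, Lp.ext ?_⟩
    exact (pullL2_hat_coeFn hDK hf hfh.2.1.coeFn_toLp).trans hU.symm
  · rintro _ ⟨U, ⟨_, ⟨f, hf, rfl⟩, hU⟩, rfl⟩
    exact ⟨f, hf, pullL2_hat_coeFn hDK hf hU⟩
  · rintro U ⟨_, ⟨f, hf, rfl⟩, hU⟩ V ⟨_, ⟨g, hg, rfl⟩, hV⟩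
    have h1 : T.formHat.form U V = T.EHat (T.hat f) (T.hat g) :=
      (descends_EHat hDK hDM).ofFun_form ⟨f, hf, rfl⟩ ⟨g, hg, rfl⟩ hU hV
    have h2 : T.form.form _ _ = T.E f g :=
      (descends_E hDK hDM).ofFun_form hf hg (pullL2_hat_coeFn hDK hf hU)
        (pullL2_hat_coeFn hDK hg hV)
    rw [h1, h2, EHat, hatInv_hat hDK hf.1, hatInv_hat hDK hg.1]

/-- The norm of the density of `f̂` splits into the contributions of `Î` and of its gaps. -/
theorem EHat_self_eq (hDK : T.DK) {fh : T.IHat → ℝ} (hfh : fh ∈ T.FHat) :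
    (∀ᵐ x ∂volume.restrict T.IHat, DifferentiableWithinAt ℝ (T.ext fh) T.IHat x) ∧
      IntegrableOn (fun x => T.derivHat fh x ^ 2) T.IHat ∧
      Summable (fun k : T.Gap => (fh k.left - fh k.right) ^ 2 / |(k.right : ℝ) - k.left|) ∧
      T.EHat fh fh = (1 / 2 : ℝ) * (∫ x in T.IHat, T.derivHat fh x ^ 2) +
        (1 / 2 : ℝ) * ∑' k : T.Gap, (fh k.left - fh k.right) ^ 2 / |(k.right : ℝ) - k.left| := by
  rw [FHat_eq hDK] at hfh
  obtain ⟨H, hH⟩ := hfh.1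
  obtain ⟨h1, h2, h3, h4⟩ := hH.norm_sq_eq
  refine ⟨h1, h2, (gapEquiv T).summable_iff.2 h3, ?_⟩
  have h5 : ∑' k : T.Gap, (fh k.left - fh k.right) ^ 2 / |(k.right : ℝ) - k.left| =
      ∑' p : gapPairs T.IHat, (fh p.1.1 - fh p.1.2) ^ 2 / |(p.1.2 : ℝ) - p.1.1| :=
    (gapEquiv T).tsum_eq fun p : gapPairs T.IHat =>
      (fh p.1.1 - fh p.1.2) ^ 2 / |(p.1.2 : ℝ) - p.1.1|
  rw [EHat_eq hDK hfh hfh hH hH, real_inner_self_eq_norm_sq, h4, h5, mul_add]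
  rfl

end ScaleSpeed
theorem mainTheorem1 (T : ScaleSpeed) (hDK : T.DK) (hDM : T.DM) :
    -- the map `f ↦ f̂` is a well-defined injection of `𝒮` into the continuous functions on `Î`
    ((∀ f ∈ T.S, T.IsHat f (T.hat f) ∧ Continuous (T.hat f)) ∧ InjOn T.hat T.S) ∧
    -- both forms are well defined on equivalence classes
    L2Form.Descends T.mI T.F T.E ∧ L2Form.Descends T.mHat T.FHat T.EHat ∧
    -- `m̂` is a fully supported Radon measure on `Î`
    (T.mHat.Regular ∧ T.mHat.IsOpenPosMeasure) ∧
    -- `(Ê, F̂)` is a regular and irreducible Dirichlet form on `L²(Î, m̂)`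
    (T.formHat.IsDirichletForm ∧ T.formHat.IsRegular ∧ T.formHat.IsIrreducible) ∧
    -- the explicit form of `F̂`
    T.FHat = {fh | MemLp fh 2 T.mHat ∧ fh ∈ T.SHat ∧
      ∀ j : ℝ, j ∉ T.IHat → ((j : EReal) = T.scale T.l ∨ (j : EReal) = T.scale T.r) →
        Tendsto fh (comap Subtype.val (𝓝 j)) (𝓝 0)} ∧
    -- every component of `(s(l), s(r)) \ Î` is a bounded interval with both ends in `Î`
    (∀ a b : EReal, IsComponentInterval T.gapSet a b →
      ∃ k : T.Gap, ((k.left : ℝ) : EReal) = a ∧ ((k.right : ℝ) : EReal) = b) ∧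
    -- the explicit form of `Ê`
    (∀ fh ∈ T.FHat,
      (∀ᵐ x ∂volume.restrict T.IHat, DifferentiableWithinAt ℝ (T.ext fh) T.IHat x) ∧
      IntegrableOn (fun x => T.derivHat fh x ^ 2) T.IHat ∧
      Summable (fun k : T.Gap => (fh k.left - fh k.right) ^ 2 / |(k.right : ℝ) - k.left|) ∧
      T.EHat fh fh = (1 / 2 : ℝ) * (∫ x in T.IHat, T.derivHat fh x ^ 2) +
        (1 / 2 : ℝ) * ∑' k : T.Gap, (fh k.left - fh k.right) ^ 2 / |(k.right : ℝ) - k.left|) ∧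
    -- `(Î, m̂, Ê, F̂)` is a regular representation of `(I, m, E, F)`
    T.formHat.IsRegularRepresentation T.form := by
  have := ScaleSpeed.nonempty_IHat hDK
  have := ScaleSpeed.isOpenPosMeasure_mHat hDM
  have ha := ScaleSpeed.isEnergyForm_formHat hDK hDM
  have hdir : T.formHat.IsDirichletForm := ⟨ha.isDirichletWide, ha.dense⟩
  exact ⟨⟨fun f hf => ⟨ScaleSpeed.isHat_hat hf, (ScaleSpeed.isDensity_hat hDK hf).continuous⟩,
      ScaleSpeed.injOn_hat hDK⟩,
    ScaleSpeed.descends_E hDK hDM, ScaleSpeed.descends_EHat hDK hDM, ⟨T.regular_mHat, this⟩,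
    ⟨hdir, ha.isRegular, ha.isIrreducible⟩, ScaleSpeed.FHat_eq_setOf hDK,
    fun _ _ h => ScaleSpeed.exists_gap hDK h, fun _ hfh => ScaleSpeed.EHat_self_eq hDK hfh,
    ScaleSpeed.form_equivalent hDK hDM, hdir, ha.isRegular⟩
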